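/- Let $q$ be a prime power with $q\equiv 1\pmod 4$, and let $\mathrm C$ be an irreducible (that is, nonsingular) conic in the projective plane $PG(2,q)$ over $\mathbb F_q$. A line is a tangent of $\mathrm C$ if it meets $\mathrm C$ in exactly one point, and a point is internal to $\mathrm C$ if it is not on $\mathrm C$ and lies on no tangent of $\mathrm C$. Let $\mathcal L$ be a line partition of the set of internal points of $\mathrm C$, that is, a set of lines such that every line of $\mathcal L$ contains at least one internal point and every internal point lies on exactly one line of $\mathcal L$. Suppose that $\#\mathcal L=q$. Then at least one of the following holds. (a) There is a point $P$ of $\mathrm C$ such that $\mathcal L$ consists of the $q$ lines through $P$ distinct from the tangent to $\mathrm C$ at $P$ (equivalently, of the lines through $P$ that are not tangents of $\mathrm C$). (b) $q$ is a square, and there is a Baer subgeometry $B\cong PG(2,\sqrt q)$ of $PG(2,q)$ such that $\mathcal L$ consists of the lines of $B$ that are not tangents of $\mathrm C$. Here a Baer subgeometry is the set of points that have coordinates in the subfield $\mathbb F_{\sqrt q}$ with respect to some basis of $\mathbb F_q^3$, and its lines are the lines of $PG(2,q)$ that join two distinct points of it. -/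

import Mathlib

open scoped LinearAlgebra.Projectivization

namespace ConicPartition

/-- The points of `PG(2, K)`. -/
abbrev Point (K : Type*) [Field K] := ℙ K (Fin 3 → K)

/-- The lines of `PG(2, K)`, in homogeneous line coordinates: `[a : b : c]` is the line
`aX + bY + cZ = 0`. Incidence `p ∈ l` is the incidence relation of Mathlib's projective plane
over `K`, the vanishing of the dot product of the coordinate vectors. -/
abbrev Line (K : Type*) [Field K] := ℙ K (Fin 3 → K)

variable {K : Type*} [Field K]

/-- The points of the conic `Q = 0`. In odd characteristic the conic is irreducible (that is,
nonsingular) exactly if the polar form `Q(x + y) - Q(x) - Q(y)` is nondegenerate. -/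
def conic (Q : QuadraticForm K (Fin 3 → K)) : Set (Point K) :=
  {p | Q p.rep = 0}

/-- Vanishing of `Q` does not depend on the homogeneous coordinates chosen for the point. -/
theorem mk_mem_conic (Q : QuadraticForm K (Fin 3 → K)) (v : Fin 3 → K) (hv : v ≠ 0) :
    Projectivization.mk K v hv ∈ conic Q ↔ Q v = 0 := by
  obtain ⟨a, ha⟩ := Projectivization.exists_smul_eq_mk_rep K v hv
  have h : Q (a • v) = (a : K) * (a : K) * Q v := QuadraticMap.map_smul Q (a : K) v
  change Q (Projectivization.mk K v hv).rep = 0 ↔ _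
  rw [← ha, h]
  simp

/-- A tangent of `C`: a line with exactly one point on `C`. -/
def IsTangent (C : Set (Point K)) (l : Line K) : Prop :=
  ∃! p : Point K, p ∈ l ∧ p ∈ C

/-- The internal points of `C`: the points off `C` that lie on no tangent of `C`. -/
def internalPoints (C : Set (Point K)) : Set (Point K) :=
  {p | p ∉ C ∧ ∀ l : Line K, p ∈ l → ¬ IsTangent C l}

/-- `L` is a line partition of the point set `S`: the sets `{p ∈ S | p ∈ l}`, for `l ∈ L`, are
the blocks of a partition of `S`. So every block is nonempty, and every point of `S` lies on
exactly one line of `L`. -/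
structure IsLinePartition (L : Set (Line K)) (S : Set (Point K)) : Prop where
  nonempty : ∀ l ∈ L, ∃ p ∈ S, p ∈ l
  existsUnique : ∀ p ∈ S, ∃! l : Line K, l ∈ L ∧ p ∈ l

/-- The points of `PG(2, K)` having coordinates in the subfield `k` with respect to the
basis `b` of `K³`: a subgeometry `PG(2, k)` of `PG(2, K)`. -/
def subgeometry (k : Subfield K) (b : Module.Basis (Fin 3) K (Fin 3 → K)) : Set (Point K) :=
  {p | ∃ (v : Fin 3 → K) (hv : v ≠ 0), (∀ i, b.repr v i ∈ k) ∧ p = Projectivization.mk K v hv}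

/-- `B` is a Baer subgeometry `PG(2, √q)` of `PG(2, q)`, where `q` is the order of `K`. -/
def IsBaerSubgeometry (B : Set (Point K)) : Prop :=
  ∃ (k : Subfield K) (b : Module.Basis (Fin 3) K (Fin 3 → K)),
    Nat.card k ^ 2 = Nat.card K ∧ B = subgeometry k b

/-- The lines of a subgeometry: the lines joining two distinct points of it. -/
def linesOf (B : Set (Point K)) : Set (Line K) :=
  {l | ∃ p ∈ B, ∃ r ∈ B, p ≠ r ∧ p ∈ l ∧ r ∈ l}

end ConicPartition

/-!
A conic over a field of order `q` has the parametrization `(s, t) ↦ (s², st, t²)` in suitable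
coordinates, in which its equation is `Y² = XZ`. A line then restricts to a binary quadratic form
`f`: its zeros are the points of the line on the conic, and it touches the conic if and only if
`fdisc f = 0`. As `-1` is a square, the internal points of the secant `uv` are the points
`c(u) + t c(v)` with `t` a nonsquare, and the line with form `f` meets the secant in one of them
if and only if the quadratic character separates `f(u)` from `f(v)`.

Call two points of the conic adjacent if a line of the partition joins them. Adjacent points are
separated by no line, and nonadjacent ones by exactly `(q - 1) / 2` lines (`opp_eq_empty`,
`card_opp`). A count shows that all `q` lines are secants (`exists_zero`), so they are the edges of
a graph on the `q + 1` points of the conic. A path of length two with nonadjacent ends has a middle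
point on at least `(q + 3) / 2` lines, and such a point lies on all of them (`card_star_of_path`,
`star_eq_univ`); this is the first alternative. Otherwise the graph is a disjoint union of complete
graphs.

Let `S` be a component with more than two points. The signs `χ(det(u, v))` have rank one off the
diagonal of `S × S`, and seen from a point outside `S` they are constant or sum to zero
(`exists_signs`, `const_or_sum_eq_zero`). They form a conference matrix, and they are values of
polynomials of degree `(q - 1) / 2`; together this yields `|S| = √q + 1` (`card_component`).
Counting edges, there is one such component, and all other components are single edges
(`star_or_cliqueWithMatching`).

The structure of `S` comes from a congruence for the number of lines of the partition through the
pole of a secant (`card_star_add_card_star`). Conjugate pairs of points of the conic over the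
quadratic extension correspond to internal points, each on one line; so a polynomial in two
variables built from the forms of the lines vanishes at all points `(x, x ^ q)` of the extension,
and its degrees are too small for that unless it is zero. As a consequence `S` is closed under
harmonic conjugation (`pt_harmonic_mem`), hence a projective line over a subfield of order `√q`
(`exists_subfield`), and the remaining lines join the points that are conjugate over this subfield
(`adj_conj`). So the partition consists of all secants whose forms have coefficients in the subfield
(`exists_iff_isRational`), and these are the lines of a Baer subgeometry
(`mem_linesOf_iff_isRational`) that are not tangents.
-/

namespace ConicPartition

/-! ### Binary quadratic forms and the conic `Y² = XZ` -/

section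

variable {K : Type*} [Field K]

/-- The determinant of two vectors of `K²`. -/
def wedge (v w : K × K) : K := v.1 * w.2 - v.2 * w.1

/-- The value at `v` of the binary quadratic form with coefficient vector `f`. -/
def ev (f : Fin 3 → K) (v : K × K) : K := f 0 * v.1 ^ 2 + f 1 * (v.1 * v.2) + f 2 * v.2 ^ 2

/-- The polar form `f (v + w) - f v - f w` of the binary quadratic form `f`. -/
def pol (f : Fin 3 → K) (v w : K × K) : K :=
  2 * f 0 * (v.1 * w.1) + f 1 * (v.1 * w.2 + v.2 * w.1) + 2 * f 2 * (v.2 * w.2)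

/-- The discriminant of a binary quadratic form. -/
def fdisc (f : Fin 3 → K) : K := f 1 ^ 2 - 4 * f 0 * f 2

/-- The ternary quadratic form `Y² - XZ`. -/
def qform (g : Fin 3 → K) : K := g 1 ^ 2 - g 0 * g 2

/-- The parametrization `(s, t) ↦ (s², st, t²)` of the conic `Y² = XZ`. -/
def ver (v : K × K) : Fin 3 → K := ![v.1 ^ 2, v.1 * v.2, v.2 ^ 2]

/-- The coordinate vector of a point of the projective line `K ∪ {∞}`. -/
def vec : Option K → K × K
  | none => (1, 0)
  | some a => (a, 1)

@[simp] lemma vec_none : vec (none : Option K) = (1, 0) := rfl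

@[simp] lemma vec_some (a : K) : vec (some a) = (a, 1) := rfl

lemma four_ne_zero_of_two_ne_zero (h2 : (2 : K) ≠ 0) : (4 : K) ≠ 0 := by
  have h : (4 : K) = 2 * 2 := by norm_num
  rw [h]; exact mul_ne_zero h2 h2

lemma wedge_vec_eq_zero {u v : Option K} : wedge (vec u) (vec v) = 0 ↔ u = v := by
  cases u <;> cases v <;> simp [wedge, sub_eq_zero]

lemma wedge_comm (v w : K × K) : wedge v w = -wedge w v := by simp only [wedge]; ring

lemma wedge_self (v : K × K) : wedge v v = 0 := by simp only [wedge]; ring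

lemma vec_ne_zero (u : Option K) : vec u ≠ 0 := by
  cases u <;> simp [Prod.ext_iff]

lemma exists_vec {v : K × K} (hv : v ≠ 0) : ∃ u, ∃ c : K, c ≠ 0 ∧ v = c • vec u := by
  by_cases h : v.2 = 0
  · refine ⟨none, v.1, fun h1 => hv (Prod.ext h1 h), Prod.ext ?_ ?_⟩ <;> simp [h]
  · refine ⟨some (v.1 / v.2), v.2, h, Prod.ext ?_ ?_⟩
    · simp [mul_div_cancel₀, h]
    · simp

lemma ev_smul (f : Fin 3 → K) (c : K) (v : K × K) : ev f (c • v) = c ^ 2 * ev f v := by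
  simp only [ev, Prod.smul_fst, Prod.smul_snd, smul_eq_mul]; ring

lemma ev_smul_left (f : Fin 3 → K) (c : K) (v : K × K) : ev (c • f) v = c * ev f v := by
  simp only [ev, Pi.smul_apply, smul_eq_mul]; ring

lemma wedge_smul_left (c : K) (v w : K × K) : wedge (c • v) w = c * wedge v w := by
  simp only [wedge, Prod.smul_fst, Prod.smul_snd, smul_eq_mul]; ring

lemma wedge_smul_right (c : K) (v w : K × K) : wedge v (c • w) = c * wedge v w := by
  simp only [wedge, Prod.smul_fst, Prod.smul_snd, smul_eq_mul]; ring

lemma ev_comb (f : Fin 3 → K) (a b : K) (v w : K × K) :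
    ev f (a • v + b • w) = a ^ 2 * ev f v + a * b * pol f v w + b ^ 2 * ev f w := by
  simp only [ev, pol, Prod.smul_fst, Prod.smul_snd, smul_eq_mul, Prod.fst_add, Prod.snd_add]; ring

lemma pol_sq (f : Fin 3 → K) (v w : K × K) :
    pol f v w ^ 2 - 4 * ev f v * ev f w = fdisc f * wedge v w ^ 2 := by
  simp only [ev, pol, fdisc, wedge]; ring

/-- A binary quadratic form with the zeros `v` and `w` is a multiple of the product of the two
corresponding linear forms. -/
lemma ev_of_zeros {f : Fin 3 → K} {v w : K × K} (hv : ev f v = 0) (hw : ev f w = 0)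
    (x : K × K) :
    wedge v w ^ 2 * ev f x = -pol f v w * (wedge x v * wedge x w) := by
  have h1 := ev_comb f (wedge x w) (-wedge x v) v w
  have h2 : wedge x w • v + (-wedge x v) • w = wedge v w • x := by
    ext <;> simp [wedge] <;> ring
  rw [h2, ev_smul, hv, hw] at h1
  rw [h1]; ring

lemma fdisc_smul (c : K) (f : Fin 3 → K) : fdisc (c • f) = c ^ 2 * fdisc f := by
  simp only [fdisc, Pi.smul_apply, smul_eq_mul]; ring

lemma pol_smul (f : Fin 3 → K) (a b : K) (v w : K × K) :
    pol f (a • v) (b • w) = a * b * pol f v w := by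
  simp only [pol, Prod.smul_fst, Prod.smul_snd, smul_eq_mul]; ring

lemma pol_ne_zero {f : Fin 3 → K} (hf : fdisc f ≠ 0) {v w : K × K} (hv : ev f v = 0)
    (hvw : wedge v w ≠ 0) : pol f v w ≠ 0 := by
  intro h
  have h1 := pol_sq f v w
  rw [h, hv] at h1
  have : fdisc f * wedge v w ^ 2 = 0 := by rw [← h1]; ring
  simp [hf, hvw] at this

lemma ev_ver (f : Fin 3 → K) (v : K × K) : f ⬝ᵥ ver v = ev f v := by
  simp [dotProduct, Fin.sum_univ_three, ver, ev]

/-- When `-1` is a square, the point `a c(v) + b c(w)` of a secant is internal if and only if `a b`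
is a nonsquare. -/
lemma qform_comb (a b : K) (v w : K × K) :
    qform (a • ver v + b • ver w) = -(a * b) * wedge v w ^ 2 := by
  simp only [qform, ver, wedge, Pi.add_apply, Pi.smul_apply, smul_eq_mul, Matrix.cons_val_zero,
    Matrix.cons_val_one, Matrix.cons_val]
  ring

lemma dot_comb (f : Fin 3 → K) (a b : K) (v w : K × K) :
    f ⬝ᵥ (a • ver v + b • ver w) = a * ev f v + b * ev f w := by
  rw [dotProduct_add, dotProduct_smul, dotProduct_smul, ev_ver, ev_ver]; rfl

/-- A form with nonzero discriminant that has a zero has exactly two. -/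
lemma exists_other_zero {f : Fin 3 → K} (hf : fdisc f ≠ 0) {u : Option K}
    (hu : ev f (vec u) = 0) : ∃ v, v ≠ u ∧ ev f (vec v) = 0 := by
  obtain ⟨w, hw⟩ : ∃ w : Option K, w ≠ u := exists_ne u
  have hwd : wedge (vec u) (vec w) ≠ 0 := fun h => hw (wedge_vec_eq_zero.1 h).symm
  have hp := pol_ne_zero hf hu hwd
  set x := ev f (vec w) • vec u + (-pol f (vec u) (vec w)) • vec w with hx
  have hwx : wedge (vec u) x = -pol f (vec u) (vec w) * wedge (vec u) (vec w) := by
    simp only [hx, wedge, Prod.smul_fst, Prod.smul_snd, smul_eq_mul, Prod.fst_add, Prod.snd_add]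
    ring
  have hwx0 : wedge (vec u) x ≠ 0 := by rw [hwx]; exact mul_ne_zero (neg_ne_zero.2 hp) hwd
  have hx0 : x ≠ 0 := by
    rintro h; rw [h] at hwx0; simp [wedge] at hwx0
  have hex : ev f x = 0 := by rw [hx, ev_comb, hu]; ring
  obtain ⟨v, c, hc, hv⟩ := exists_vec hx0
  refine ⟨v, ?_, ?_⟩
  · rintro rfl
    rw [hv, wedge_smul_right, wedge_self, mul_zero] at hwx0
    exact hwx0 rfl
  · rw [hv, ev_smul] at hex
    simpa [hc] using hex

lemma eq_or_eq_of_zeros {f : Fin 3 → K} (hf : fdisc f ≠ 0) {u v w : Option K}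
    (hu : ev f (vec u) = 0) (hv : ev f (vec v) = 0) (huv : u ≠ v) (hw : ev f (vec w) = 0) :
    w = u ∨ w = v := by
  have hd : wedge (vec u) (vec v) ≠ 0 := fun h => huv (wedge_vec_eq_zero.1 h)
  have h := ev_of_zeros hu hv (vec w)
  rw [hw, mul_zero, eq_comm, mul_eq_zero, mul_eq_zero, wedge_vec_eq_zero, wedge_vec_eq_zero] at h
  exact h.resolve_left (neg_ne_zero.2 (pol_ne_zero hf hu hd))

/-- On a line that touches the conic, `Y² - XZ` takes square values only. -/
lemma isSquare_qform_of_fdisc_eq_zero (h2 : (2 : K) ≠ 0) {f : Fin 3 → K} (hf0 : f ≠ 0)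
    (hf : fdisc f = 0) {g : Fin 3 → K} (hg : f ⬝ᵥ g = 0) : IsSquare (qform g) := by
  simp only [dotProduct, Fin.sum_univ_three] at hg
  simp only [fdisc] at hf
  by_cases h0 : f 0 = 0
  · have h1 : f 1 = 0 := by
      rw [h0] at hf
      simpa using hf
    have h3 : f 2 ≠ 0 := by
      intro h3; apply hf0; funext j; fin_cases j <;> simp [h0, h1, h3]
    rw [h0, h1] at hg
    have : g 2 = 0 := by simpa [h3] using hg
    exact ⟨g 1, by simp [qform, this]; ring⟩
  · refine ⟨g 1 + f 1 * g 2 / (2 * f 0), ?_⟩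
    have hx : g 0 = -(f 1 * g 1 + f 2 * g 2) / f 0 := by
      field_simp; linear_combination hg
    have hz : f 2 = f 1 ^ 2 / (4 * f 0) := by
      have := four_ne_zero_of_two_ne_zero h2
      field_simp; linear_combination -hf
    have h4 := four_ne_zero_of_two_ne_zero h2
    simp only [qform]
    rw [hx, hz]
    field_simp
    ring

end

/-! ### Quadratic character sums -/

section

variable {K : Type*} [Field K] [Fintype K]

lemma ringChar_ne_two (h4 : Fintype.card K % 4 = 1) : ringChar K ≠ 2 := by
  intro h
  have := FiniteField.even_card_of_char_two h
  omega

lemma two_ne_zero_of_card (h4 : Fintype.card K % 4 = 1) : (2 : K) ≠ 0 :=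
  Ring.two_ne_zero (ringChar_ne_two h4)

variable [DecidableEq K]

lemma quadraticChar_neg_of_card (h4 : Fintype.card K % 4 = 1) (a : K) :
    quadraticChar K (-a) = quadraticChar K a := by
  have h : IsSquare (-1 : K) := FiniteField.isSquare_neg_one_iff.2 (by omega)
  rw [← neg_one_mul, map_mul, (quadraticChar_one_iff_isSquare (by simp)).2 h, one_mul]

lemma quadraticChar_values (a : K) :
    quadraticChar K a = 0 ∨ quadraticChar K a = 1 ∨ quadraticChar K a = -1 := by
  by_cases h : a = 0
  · left; rw [h, quadraticChar_zero]
  · right; exact quadraticChar_dichotomy h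

lemma quadraticChar_sq_mul {c : K} (hc : c ≠ 0) (a : K) :
    quadraticChar K (c ^ 2 * a) = quadraticChar K a := by
  rw [map_mul, quadraticChar_sq_one' hc, one_mul]

/-- A sign function with sum zero takes the value `-1` on half of its support. -/
lemma two_mul_card_neg {α : Type*} [Fintype α] (s : α → ℤ)
    (hs : ∀ a, s a = 0 ∨ s a = 1 ∨ s a = -1) (h0 : ∑ a, s a = 0) :
    2 * (Finset.univ.filter fun a => s a = -1).card +
      (Finset.univ.filter fun a => s a = 0).card = Fintype.card α := by
  have h1 : ∑ a, (1 + s a) = ∑ a, (2 - 2 * (if s a = -1 then 1 else 0)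
      - (if s a = 0 then 1 else 0) : ℤ) := by
    refine Finset.sum_congr rfl fun a _ => ?_
    rcases hs a with h | h | h <;> simp [h]
  simp only [Finset.sum_add_distrib, Finset.sum_sub_distrib, ← Finset.mul_sum, Finset.sum_boole,
    h0, Finset.sum_const, Finset.card_univ, nsmul_eq_mul] at h1
  omega

lemma card_nonsquares (h4 : Fintype.card K % 4 = 1) :
    2 * (Finset.univ.filter fun t : K => quadraticChar K t = -1).card + 1 = Fintype.card K := by
  have h := two_mul_card_neg (fun t : K => quadraticChar K t) quadraticChar_values
    (quadraticChar_sum_zero (ringChar_ne_two h4))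
  have h1 : (Finset.univ.filter fun t : K => quadraticChar K t = 0) = {0} := by
    ext t
    rw [Finset.mem_filter, Finset.mem_singleton, quadraticChar_eq_zero_iff]
    simp
  rw [h1, Finset.card_singleton] at h
  exact h

/-- The hyperbola `c² - t² = D` has `q - 1` affine points. -/
lemma card_hyperbola (h2 : (2 : K) ≠ 0) {D : K} (hD : D ≠ 0) :
    (Finset.univ.filter fun x : K × K => x.2 ^ 2 = x.1 ^ 2 - D).card + 1 = Fintype.card K := by
  have h : (Finset.univ.filter fun x : K × K => x.2 ^ 2 = x.1 ^ 2 - D).card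
      = (Finset.univ.erase (0 : K)).card := by
    refine Finset.card_nbij' (fun x => x.1 + x.2) (fun y => ((y + D / y) / 2, (y - D / y) / 2))
      ?_ ?_ ?_ ?_
    · intro x hx
      simp only [Finset.coe_filter, Finset.mem_univ, true_and, Set.mem_ofPred_eq] at hx
      simp only [Finset.coe_erase, Finset.coe_univ, Set.mem_sdiff, Set.mem_univ, true_and,
        Set.mem_singleton_iff]
      intro h
      apply hD
      linear_combination (x.1 - x.2) * h + hx
    · intro y hy
      simp only [Finset.coe_erase, Finset.coe_univ, Set.mem_sdiff, Set.mem_univ, true_and,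
        Set.mem_singleton_iff] at hy
      simp only [Finset.coe_filter, Finset.mem_univ, true_and, Set.mem_ofPred_eq]
      field_simp
      ring
    · intro x hx
      simp only [Finset.coe_filter, Finset.mem_univ, true_and, Set.mem_ofPred_eq] at hx
      have h0 : x.1 + x.2 ≠ 0 := by
        intro h
        apply hD
        linear_combination (x.1 - x.2) * h + hx
      have hDx : D / (x.1 + x.2) = x.1 - x.2 := by
        rw [div_eq_iff h0]; linear_combination hx
      ext
      · simp only [hDx]; field_simp; ring
      · simp only [hDx]; field_simp; ring
    · intro y hy
      simp only [Finset.coe_erase, Finset.coe_univ, Set.mem_sdiff, Set.mem_univ, true_and,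
        Set.mem_singleton_iff] at hy
      field_simp
      ring
  rw [h, Finset.card_erase_of_mem (Finset.mem_univ _), Finset.card_univ]
  exact Nat.sub_add_cancel Fintype.card_pos

lemma sum_quadraticChar_sq_sub (h4 : Fintype.card K % 4 = 1) {D : K} (hD : D ≠ 0) :
    ∑ c : K, quadraticChar K (c ^ 2 - D) = -1 := by
  have h1 : ∑ c : K, (quadraticChar K (c ^ 2 - D) + 1)
      = (Finset.univ.filter fun x : K × K => x.2 ^ 2 = x.1 ^ 2 - D).card := by
    rw [Finset.card_filter, Fintype.sum_prod_type, Nat.cast_sum]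
    refine Finset.sum_congr rfl fun c _ => ?_
    rw [← quadraticChar_card_sqrts (ringChar_ne_two h4), ← Finset.card_filter]
    congr 2
    ext t; simp
  rw [Finset.sum_add_distrib, Finset.sum_const, Finset.card_univ] at h1
  have h2 := card_hyperbola (two_ne_zero_of_card h4) hD
  simp only [nsmul_eq_mul, mul_one] at h1
  omega

/-- A binary quadratic form with nonzero discriminant takes equally many square and nonsquare
values on the projective line. -/
lemma sum_quadraticChar_ev (h4 : Fintype.card K % 4 = 1) {f : Fin 3 → K} (hf : fdisc f ≠ 0) :
    ∑ u : Option K, quadraticChar K (ev f (vec u)) = 0 := by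
  have h2 := two_ne_zero_of_card h4
  rw [Fintype.sum_option]
  by_cases h0 : f 0 = 0
  · have h1 : f 1 ≠ 0 := by
      intro h1; apply hf; simp [fdisc, h0, h1]
    have hs : ∑ a : K, quadraticChar K (ev f (vec (some a))) = ∑ a : K, quadraticChar K a := by
      refine Fintype.sum_bijective (fun a => f 1 * a + f 2) ?_ _ _ ?_
      · exact Finite.injective_iff_bijective.1 fun a b hab => by
          simpa [h1] using hab
      · intro a; congr 1; simp [ev, h0]
    rw [hs, quadraticChar_sum_zero (ringChar_ne_two h4)]
    simp [ev, h0]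
  · have hs : ∑ a : K, quadraticChar K (4 * f 0 * ev f (vec (some a)))
        = ∑ c : K, quadraticChar K (c ^ 2 - fdisc f) := by
      refine Fintype.sum_bijective (fun a => 2 * f 0 * a + f 1) ?_ _ _ ?_
      · exact Finite.injective_iff_bijective.1 fun a b hab => by
          simpa [h0, h2] using hab
      · intro a; congr 1; simp only [ev, vec_some, fdisc]; ring
    rw [sum_quadraticChar_sq_sub h4 hf] at hs
    have hs' : quadraticChar K (f 0) * ∑ a : K, quadraticChar K (ev f (vec (some a))) = -1 := by
      rw [← hs, Finset.mul_sum]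
      refine Finset.sum_congr rfl fun a _ => ?_
      rw [← map_mul, ← quadraticChar_sq_mul h2]
      congr 1; ring
    have h3 : ev f (vec none) = f 0 := by simp [ev]
    rw [h3]
    have h5 := quadraticChar_sq_one h0
    linear_combination quadraticChar K (f 0) * hs' -
      (∑ a : K, quadraticChar K (ev f (vec (some a)))) * h5

end

/-! ### The graph on the points of the conic -/

section

variable {K : Type*} [Field K]

/-- The lines with coordinate vectors `e i` partition the internal points of the conic
`Y² = XZ`, which are the points at which `Y² - XZ` is a nonsquare. -/
structure IsInternalPartition {ι : Type*} (e : ι → Fin 3 → K) : Prop where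
  ne_zero : ∀ i, e i ≠ 0
  existsUnique : ∀ g, ¬IsSquare (qform g) → ∃! i, e i ⬝ᵥ g = 0
  nonempty : ∀ i, ∃ g, ¬IsSquare (qform g) ∧ e i ⬝ᵥ g = 0

/-- The points `u` and `v` of the conic are joined by one of the lines `e i`. -/
def Adj {ι : Type*} (e : ι → Fin 3 → K) (u v : Option K) : Prop :=
  u ≠ v ∧ ∃ i, ev (e i) (vec u) = 0 ∧ ev (e i) (vec v) = 0

lemma Adj.symm {ι : Type*} {e : ι → Fin 3 → K} {u v : Option K} (h : Adj e u v) : Adj e v u :=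
  ⟨h.1.symm, h.2.imp fun _ h => h.symm⟩

section

open Classical in
/-- The lines `e i` that meet the secant through `u` and `v` in an internal point. -/
noncomputable def opp {ι : Type*} [Fintype ι] [Fintype K] (e : ι → Fin 3 → K)
    (u v : Option K) : Finset ι :=
  Finset.univ.filter fun i => quadraticChar K (ev (e i) (vec u) * ev (e i) (vec v)) = -1

open Classical in
/-- The lines `e i` through the point `u` of the conic. -/
noncomputable def star {ι : Type*} [Fintype ι] (e : ι → Fin 3 → K) (u : Option K) : Finset ι :=
  Finset.univ.filter fun i => ev (e i) (vec u) = 0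

open Classical in
/-- The points of the conic that some `e i` joins to `u`. -/
noncomputable def nbr {ι : Type*} [Fintype K] (e : ι → Fin 3 → K) (u : Option K) :
    Finset (Option K) :=
  Finset.univ.filter fun v => Adj e u v

end

variable [Fintype K] [DecidableEq K] {ι : Type*} [Fintype ι] {e : ι → Fin 3 → K}

lemma mem_opp {u v : Option K} {i : ι} :
    i ∈ opp e u v ↔ quadraticChar K (ev (e i) (vec u) * ev (e i) (vec v)) = -1 := by
  simp only [opp, Finset.mem_filter, Finset.mem_univ, true_and]
  convert Iff.rfl

omit [Fintype K] [DecidableEq K] in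
lemma mem_star {u : Option K} {i : ι} : i ∈ star e u ↔ ev (e i) (vec u) = 0 := by
  simp [star]

omit [DecidableEq K] [Fintype ι] in
lemma mem_nbr {u v : Option K} : v ∈ nbr e u ↔ Adj e u v := by
  simp [nbr]

lemma not_isSquare_comb (h4 : Fintype.card K % 4 = 1) {u v : Option K} (huv : u ≠ v) {t : K}
    (ht : quadraticChar K t = -1) :
    ¬IsSquare (qform ((1 : K) • ver (vec u) + t • ver (vec v))) := by
  rw [← quadraticChar_neg_one_iff_not_isSquare, qform_comb, mul_comm, quadraticChar_sq_mul,
    quadraticChar_neg_of_card h4, one_mul, ht]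
  exact fun h => huv (wedge_vec_eq_zero.1 h)

lemma exists_nonsquare (h4 : Fintype.card K % 4 = 1) : ∃ t : K, quadraticChar K t = -1 :=
  quadraticChar_exists_neg_one (ringChar_ne_two h4)

omit [Fintype ι] in
lemma eq_of_zeros (h4 : Fintype.card K % 4 = 1) (hp : IsInternalPartition e) {u v : Option K}
    (huv : u ≠ v) {i j : ι} (hiu : ev (e i) (vec u) = 0) (hiv : ev (e i) (vec v) = 0)
    (hju : ev (e j) (vec u) = 0) (hjv : ev (e j) (vec v) = 0) : i = j := by
  obtain ⟨t, ht⟩ := exists_nonsquare h4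
  refine (hp.existsUnique _ (not_isSquare_comb h4 huv ht)).unique ?_ ?_
  · rw [dot_comb, hiu, hiv]; simp
  · rw [dot_comb, hju, hjv]; simp

omit [Fintype ι] in
lemma quadraticChar_ratio (h4 : Fintype.card K % 4 = 1) (a b : K) :
    quadraticChar K (-a / b) = quadraticChar K (a * b) := by
  by_cases hb : b = 0
  · simp [hb]
  · rw [← quadraticChar_sq_mul hb, ← quadraticChar_neg_of_card h4]
    congr 1; field_simp

/-- An internal point of a line of the partition lies on no other line of the partition. -/
lemma opp_eq_empty (h4 : Fintype.card K % 4 = 1) (hp : IsInternalPartition e) {u v : Option K}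
    (huv : Adj e u v) : opp e u v = ∅ := by
  obtain ⟨huv, j, hju, hjv⟩ := huv
  refine Finset.eq_empty_of_forall_notMem fun i hi => ?_
  rw [mem_opp] at hi
  have hu : ev (e i) (vec u) ≠ 0 := by rintro h; simp [h] at hi
  have hv : ev (e i) (vec v) ≠ 0 := by rintro h; simp [h] at hi
  have hij : i = j := by
    refine (hp.existsUnique _ (not_isSquare_comb h4 huv
      (t := -ev (e i) (vec u) / ev (e i) (vec v)) ?_)).unique ?_ ?_
    · rw [quadraticChar_ratio h4, hi]
    · rw [dot_comb]; field_simp; ring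
    · rw [dot_comb, hju, hjv]; simp
  exact hu (hij ▸ hju)

/-- A secant that is not one of the `e i` has `(q - 1) / 2` internal points, each of them on
exactly one `e i`. -/
lemma card_opp (h4 : Fintype.card K % 4 = 1) (hp : IsInternalPartition e) {u v : Option K}
    (huv : u ≠ v) (hn : ¬Adj e u v) : 2 * (opp e u v).card + 1 = Fintype.card K := by
  rw [← card_nonsquares h4]
  congr 2
  symm
  have hne : ∀ i, ev (e i) (vec u) = 0 → ev (e i) (vec v) ≠ 0 :=
    fun i h h' => hn ⟨huv, i, h, h'⟩
  have key : ∀ t : K, quadraticChar K t = -1 →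
      ∃ i, ev (e i) (vec u) + t * ev (e i) (vec v) = 0 := by
    intro t ht
    obtain ⟨i, hi, -⟩ := hp.existsUnique _ (not_isSquare_comb h4 huv ht)
    rw [dot_comb, one_mul] at hi
    exact ⟨i, hi⟩
  have : Nonempty ι := (exists_nonsquare h4).elim fun t ht => (key t ht).nonempty
  choose! F hF using key
  refine Finset.card_nbij' F (fun i => -ev (e i) (vec u) / ev (e i) (vec v)) ?_ ?_ ?_ ?_
  · intro t ht
    simp only [Finset.coe_filter, Finset.mem_univ, true_and, Set.mem_ofPred_eq] at ht
    have h := hF t ht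
    have hv : ev (e (F t)) (vec v) ≠ 0 := by
      intro h0
      rw [h0, mul_zero, add_zero] at h
      exact hne _ h h0
    rw [Finset.mem_coe, mem_opp, ← quadraticChar_ratio h4, ← ht]
    congr 1
    field_simp; linear_combination -h
  · intro i hi
    rw [Finset.mem_coe, mem_opp] at hi
    simp only [Finset.coe_filter, Finset.mem_univ, true_and, Set.mem_ofPred_eq]
    rw [quadraticChar_ratio h4, hi]
  · intro t ht
    simp only [Finset.coe_filter, Finset.mem_univ, true_and, Set.mem_ofPred_eq] at ht
    have h := hF t ht
    have hv : ev (e (F t)) (vec v) ≠ 0 := by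
      intro h0
      rw [h0, mul_zero, add_zero] at h
      exact hne _ h h0
    field_simp; linear_combination -h
  · intro i hi
    rw [Finset.mem_coe, mem_opp] at hi
    have hv : ev (e i) (vec v) ≠ 0 := by rintro h; simp [h] at hi
    have ht : quadraticChar K (-ev (e i) (vec u) / ev (e i) (vec v)) = -1 := by
      rw [quadraticChar_ratio h4, hi]
    refine (hp.existsUnique _ (not_isSquare_comb h4 huv ht)).unique ?_ ?_
    · rw [dot_comb, one_mul]; exact hF _ ht
    · rw [dot_comb]; field_simp; ring

omit [Fintype ι] [DecidableEq K] in
lemma fdisc_ne_zero (h4 : Fintype.card K % 4 = 1) (hp : IsInternalPartition e) (i : ι) :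
    fdisc (e i) ≠ 0 := by
  intro h
  obtain ⟨g, hg, hig⟩ := hp.nonempty i
  exact hg (isSquare_qform_of_fdisc_eq_zero (two_ne_zero_of_card h4) (hp.ne_zero i) h hig)

lemma card_zeros_le {f : Fin 3 → K} (hf : fdisc f ≠ 0) :
    (Finset.univ.filter fun u : Option K => ev f (vec u) = 0).card ≤ 2 := by
  by_contra! h
  obtain ⟨a, ha, b, hb, c, hc, hab, hac, hbc⟩ := Finset.two_lt_card.1 h
  simp only [Finset.mem_filter, Finset.mem_univ, true_and] at ha hb hc
  rcases eq_or_eq_of_zeros hf ha hb hab hc with h | h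
  · exact hac h.symm
  · exact hbc h.symm

/-- Counting neighbours of `u` amounts to counting lines: each line through `u` meets the conic
again, and two lines of the partition have no second common point. -/
lemma card_nbr (h4 : Fintype.card K % 4 = 1) (hp : IsInternalPartition e) (u : Option K) :
    (nbr e u).card = (star e u).card := by
  symm
  have key : ∀ i, ev (e i) (vec u) = 0 → ∃ v, v ≠ u ∧ ev (e i) (vec v) = 0 :=
    fun i hi => exists_other_zero (fdisc_ne_zero h4 hp i) hi
  choose! F hF using key
  refine Finset.card_bij (fun i _ => F i) ?_ ?_ ?_
  · intro i hi
    rw [mem_star] at hi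
    exact mem_nbr.2 ⟨(hF i hi).1.symm, i, hi, (hF i hi).2⟩
  · intro i hi j hj hij
    rw [mem_star] at hi hj
    exact eq_of_zeros h4 hp (hF i hi).1.symm hi (hF i hi).2 hj (by rw [hij]; exact (hF j hj).2)
  · intro v hv
    obtain ⟨huv, i, hiu, hiv⟩ := mem_nbr.1 hv
    refine ⟨i, mem_star.2 hiu, ?_⟩
    rcases eq_or_eq_of_zeros (fdisc_ne_zero h4 hp i) hiu hiv huv (hF i hiu).2 with h | h
    · exact absurd h (hF i hiu).1
    · exact h

/-- All lines of a partition into `q` lines are secants of the conic. Fix a point `u` of the conic,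
on `d` lines of the partition, and count the pairs of a secant through `u` and a line of the
partition that meets it in an internal point. By secants the number is `(q - d) (q - 1) / 2`. By
lines, each of the `q - d` lines that miss `u` contributes at least `(q - 1) / 2`, and a line that
misses the conic contributes `(q + 1) / 2`. -/
lemma exists_zero (h4 : Fintype.card K % 4 = 1) (hp : IsInternalPartition e)
    (hc : Fintype.card ι = Fintype.card K) (i : ι) : ∃ u, ev (e i) (vec u) = 0 := by
  classical
  by_contra! hi
  let u : Option K := none
  -- Double counting of the pairs of a point `v` and a line of the partition that meets the
  -- secant through `u` and `v` in an internal point.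
  have hdc : ∑ v, (opp e u v).card
      = ∑ j, (Finset.univ.filter fun v : Option K =>
          quadraticChar K (ev (e j) (vec u) * ev (e j) (vec v)) = -1).card := by
    simp only [opp, Finset.card_filter]
    rw [Finset.sum_comm]
    convert rfl
  have hL : ∀ v, 2 * (opp e u v).card
      = if v ∈ insert u (nbr e u) then 0 else Fintype.card K - 1 := by
    intro v
    split_ifs with h
    · rw [Finset.mem_insert, mem_nbr] at h
      rcases h with rfl | h
      · rw [Nat.mul_eq_zero, Finset.card_eq_zero]
        refine Or.inr (Finset.eq_empty_of_forall_notMem fun j hj => ?_)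
        rw [mem_opp, quadraticChar_neg_one_iff_not_isSquare] at hj
        exact hj ⟨_, rfl⟩
      · rw [opp_eq_empty h4 hp h]; rfl
    · rw [Finset.mem_insert, mem_nbr, not_or] at h
      have := card_opp h4 hp (Ne.symm h.1) h.2
      omega
  have hR : ∀ j, 2 * (Finset.univ.filter fun v : Option K =>
          quadraticChar K (ev (e j) (vec u) * ev (e j) (vec v)) = -1).card
        ≥ (if j ∈ star e u then 0 else Fintype.card K - 1) + if j = i then 2 else 0 := by
    intro j
    by_cases hj : ev (e j) (vec u) = 0
    · have hji : j ≠ i := by rintro rfl; exact hi u hj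
      simp [mem_star, hj, hji]
    · have h := two_mul_card_neg (fun v : Option K =>
        quadraticChar K (ev (e j) (vec u) * ev (e j) (vec v))) (fun v => quadraticChar_values _) (by
          simp only [map_mul, ← Finset.mul_sum]
          rw [sum_quadraticChar_ev h4 (fdisc_ne_zero h4 hp j), mul_zero])
      have h0 : (Finset.univ.filter fun v : Option K =>
          quadraticChar K (ev (e j) (vec u) * ev (e j) (vec v)) = 0)
          = Finset.univ.filter fun v : Option K => ev (e j) (vec v) = 0 := by
        ext v
        rw [Finset.mem_filter, Finset.mem_filter, quadraticChar_eq_zero_iff]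
        simp [hj]
      rw [h0, Fintype.card_option] at h
      have hle := card_zeros_le (fdisc_ne_zero h4 hp j)
      rw [if_neg (fun h => hj (mem_star.1 h))]
      split_ifs with hji
      · have : (Finset.univ.filter fun v : Option K => ev (e j) (vec v) = 0) = ∅ := by
          refine Finset.filter_eq_empty_iff.2 fun v _ => ?_
          rw [hji]; exact hi v
        rw [this, Finset.card_empty] at h
        omega
      · omega
  have h1 : ∑ v, 2 * (opp e u v).card
      = (Fintype.card K - (star e u).card) * (Fintype.card K - 1) := by
    simp only [hL]
    rw [Finset.sum_ite, Finset.sum_const_zero, zero_add, Finset.sum_const, smul_eq_mul,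
      Finset.filter_not, Finset.filter_mem_eq_inter, Finset.univ_inter,
      Finset.card_sdiff_of_subset (Finset.subset_univ _), Finset.card_univ, Fintype.card_option,
      Finset.card_insert_of_notMem (by rw [mem_nbr]; exact fun h => h.1 rfl), card_nbr h4 hp]
    congr 1; omega
  have h2 : ∑ j, ((if j ∈ star e u then 0 else Fintype.card K - 1) + if j = i then 2 else 0)
      = (Fintype.card K - (star e u).card) * (Fintype.card K - 1) + 2 := by
    rw [Finset.sum_add_distrib, Finset.sum_ite_eq' Finset.univ i, if_pos (Finset.mem_univ _),
      Finset.sum_ite, Finset.sum_const_zero, zero_add, Finset.sum_const, smul_eq_mul,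
      Finset.filter_not, Finset.filter_mem_eq_inter, Finset.univ_inter,
      Finset.card_sdiff_of_subset (Finset.subset_univ _), Finset.card_univ, hc]
  have h3 := Finset.sum_le_sum fun j (_ : j ∈ Finset.univ) => hR j
  rw [h2, ← Finset.mul_sum, ← hdc, Finset.mul_sum, h1] at h3
  omega

lemma exists_zeros (h4 : Fintype.card K % 4 = 1) (hp : IsInternalPartition e)
    (hc : Fintype.card ι = Fintype.card K) (i : ι) :
    ∃ u v, u ≠ v ∧ ev (e i) (vec u) = 0 ∧ ev (e i) (vec v) = 0 := by
  obtain ⟨u, hu⟩ := exists_zero h4 hp hc i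
  obtain ⟨v, hvu, hv⟩ := exists_other_zero (fdisc_ne_zero h4 hp i) hu
  exact ⟨u, v, hvu.symm, hu, hv⟩

lemma card_zeros (h4 : Fintype.card K % 4 = 1) (hp : IsInternalPartition e)
    (hc : Fintype.card ι = Fintype.card K) (i : ι) :
    (Finset.univ.filter fun u : Option K => ev (e i) (vec u) = 0).card = 2 := by
  obtain ⟨u, v, huv, hu, hv⟩ := exists_zeros h4 hp hc i
  refine le_antisymm (card_zeros_le (fdisc_ne_zero h4 hp i)) ?_
  rw [← Finset.card_pair huv]
  refine Finset.card_le_card fun w hw => ?_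
  rw [Finset.mem_insert, Finset.mem_singleton] at hw
  rcases hw with rfl | rfl <;> simpa

lemma sum_card_star (h4 : Fintype.card K % 4 = 1) (hp : IsInternalPartition e)
    (hc : Fintype.card ι = Fintype.card K) :
    ∑ u, (star e u).card = 2 * Fintype.card K := by
  classical
  have : ∑ u, (star e u).card
      = ∑ i, (Finset.univ.filter fun u : Option K => ev (e i) (vec u) = 0).card := by
    simp only [star, Finset.card_filter]
    rw [Finset.sum_comm]
    convert rfl
  rw [this, Finset.sum_congr rfl fun i _ => card_zeros h4 hp hc i, Finset.sum_const,
    Finset.card_univ, hc, smul_eq_mul, mul_comm]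

end

/-! ### Paley signs and points on many lines -/

section

variable {K : Type*} [Field K]

/-- The binary quadratic form with zeros `a` and `b`. -/
def pairForm (a b : K × K) : Fin 3 → K :=
  ![a.2 * b.2, -(a.2 * b.1 + a.1 * b.2), a.1 * b.1]

lemma ev_pairForm (a b x : K × K) : ev (pairForm a b) x = wedge x a * wedge x b := by
  simp [ev, pairForm, wedge]; ring

lemma fdisc_pairForm (a b : K × K) : fdisc (pairForm a b) = wedge a b ^ 2 := by
  simp [fdisc, pairForm, wedge]; ring

variable [Fintype K] [DecidableEq K]

/-- The quadratic character of the determinant of two points of the projective line; the values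
form a symmetric conference matrix when `q ≡ 1 (mod 4)`. -/
def pal (u v : Option K) : ℤ := quadraticChar K (wedge (vec u) (vec v))

lemma pal_comm (h4 : Fintype.card K % 4 = 1) (u v : Option K) : pal u v = pal v u := by
  rw [pal, wedge_comm, quadraticChar_neg_of_card h4, pal]

lemma pal_self (u : Option K) : pal u u = 0 := by
  rw [pal, wedge_self, quadraticChar_zero]

lemma pal_cases {u v : Option K} (h : u ≠ v) : pal u v = 1 ∨ pal u v = -1 :=
  quadraticChar_dichotomy fun h' => h (wedge_vec_eq_zero.1 h')

lemma pal_mul_self {u v : Option K} (h : u ≠ v) : pal u v * pal u v = 1 := by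
  rcases pal_cases h with h | h <;> rw [h] <;> rfl

/-- The columns of `pal` are orthogonal. -/
lemma sum_pal_mul (h4 : Fintype.card K % 4 = 1) {s t : Option K} (h : s ≠ t) :
    ∑ u, pal u s * pal u t = 0 := by
  have := sum_quadraticChar_ev h4 (f := pairForm (vec s) (vec t)) (by
    rw [fdisc_pairForm]
    exact pow_ne_zero _ fun h' => h (wedge_vec_eq_zero.1 h'))
  rw [← this]
  refine Finset.sum_congr rfl fun u _ => ?_
  rw [ev_pairForm, map_mul, pal, pal]

lemma sum_pal_sq (s : Option K) : ∑ u, pal u s * pal u s = Fintype.card K := by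
  have : ∀ u, pal u s * pal u s = if u = s then 0 else 1 := by
    intro u
    split_ifs with h
    · rw [h, pal_self, mul_zero]
    · exact pal_mul_self h
  simp only [this]
  rw [Finset.sum_ite, Finset.sum_const_zero, zero_add, Finset.sum_const, Finset.filter_ne',
    Finset.card_erase_of_mem (Finset.mem_univ _), Finset.card_univ, Fintype.card_option]
  simp

variable {ι : Type*} {e : ι → Fin 3 → K}

/-- The signs of a line with the zeros `a` and `b` in terms of `pal`. -/
lemma quadraticChar_ev_mul (h4 : Fintype.card K % 4 = 1) {f : Fin 3 → K} (hf : fdisc f ≠ 0)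
    {a b : Option K} (hab : a ≠ b) (ha : ev f (vec a) = 0) (hb : ev f (vec b) = 0)
    (x y : Option K) :
    quadraticChar K (ev f (vec x) * ev f (vec y)) = pal x a * pal x b * (pal y a * pal y b) := by
  have hw : wedge (vec a) (vec b) ≠ 0 := fun h => hab (wedge_vec_eq_zero.1 h)
  have h : ∀ z, quadraticChar K (ev f (vec z))
      = quadraticChar K (pol f (vec a) (vec b)) * (pal z a * pal z b) := by
    intro z
    rw [← quadraticChar_sq_mul hw, ev_of_zeros ha hb, map_mul, quadraticChar_neg_of_card h4,
      map_mul, pal, pal]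
  have h1 := quadraticChar_sq_one (pol_ne_zero hf ha hw)
  rw [map_mul, h, h]
  linear_combination (pal x a * pal x b * (pal y a * pal y b)) * h1

variable [Fintype ι]

lemma quadraticChar_mul_eq_one_of_adj (h4 : Fintype.card K % 4 = 1) (hp : IsInternalPartition e)
    {u v : Option K} (huv : Adj e u v) {i : ι} (hu : ev (e i) (vec u) ≠ 0)
    (hv : ev (e i) (vec v) ≠ 0) : quadraticChar K (ev (e i) (vec u) * ev (e i) (vec v)) = 1 := by
  refine (quadraticChar_dichotomy (mul_ne_zero hu hv)).resolve_right fun h => ?_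
  have := mem_opp.2 h
  rw [opp_eq_empty h4 hp huv] at this
  simp at this

/-- No line of the partition separates two points that a line of the partition joins. -/
lemma quadraticChar_eq_of_adj (h4 : Fintype.card K % 4 = 1) (hp : IsInternalPartition e)
    {u v : Option K} (huv : Adj e u v) {i : ι} (hu : ev (e i) (vec u) ≠ 0)
    (hv : ev (e i) (vec v) ≠ 0) :
    quadraticChar K (ev (e i) (vec u)) = quadraticChar K (ev (e i) (vec v)) := by
  have h := quadraticChar_mul_eq_one_of_adj h4 hp huv hu hv
  rw [map_mul] at h
  rcases quadraticChar_dichotomy hu with h1 | h1 <;>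
    rcases quadraticChar_dichotomy hv with h2 | h2 <;>
    rw [h1, h2] at h ⊢ <;> simp at h

lemma ne_zero_of_mem_opp {u v : Option K} {i : ι} (hi : i ∈ opp e u v) :
    ev (e i) (vec u) ≠ 0 ∧ ev (e i) (vec v) ≠ 0 := by
  rw [mem_opp] at hi
  constructor <;> (intro h; simp [h] at hi)

/-- A path `u, v, w` with `u` and `w` not adjacent forces many lines through `v`. -/
lemma card_star_of_path (h4 : Fintype.card K % 4 = 1) (hp : IsInternalPartition e)
    {u v w : Option K} (huv : Adj e u v) (hvw : Adj e v w) (huw : u ≠ w) (hn : ¬Adj e u w) :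
    Fintype.card K + 3 ≤ 2 * (star e v).card := by
  classical
  have hcard := card_opp h4 hp huw hn
  obtain ⟨i, hiu, hiv⟩ := huv.2
  obtain ⟨j, hjv, hjw⟩ := hvw.2
  have hij : i ≠ j := by
    rintro rfl
    exact hn ⟨huw, i, hiu, hjw⟩
  have hsub : insert i (insert j (opp e u w)) ⊆ star e v := by
    intro k hk
    rw [Finset.mem_insert, Finset.mem_insert] at hk
    rcases hk with rfl | rfl | hk
    · exact mem_star.2 hiv
    · exact mem_star.2 hjv
    · rw [mem_star]
      by_contra hkv
      obtain ⟨hku, hkw⟩ := ne_zero_of_mem_opp hk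
      rw [mem_opp, map_mul, quadraticChar_eq_of_adj h4 hp huv hku hkv,
        quadraticChar_eq_of_adj h4 hp hvw hkv hkw, ← map_mul, ← pow_two,
        quadraticChar_sq_one' hkw] at hk
      simp at hk
  have hle := Finset.card_le_card hsub
  rw [Finset.card_insert_of_notMem, Finset.card_insert_of_notMem] at hle
  · omega
  · exact fun h => (ne_zero_of_mem_opp h).2 hjw
  · rw [Finset.mem_insert, not_or]
    exact ⟨hij, fun h => (ne_zero_of_mem_opp h).1 hiu⟩

/-- A point of the conic on many lines of the partition lies on all of them. -/
lemma star_eq_univ (h4 : Fintype.card K % 4 = 1) (hp : IsInternalPartition e)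
    (hc : Fintype.card ι = Fintype.card K) {v : Option K}
    (hv : Fintype.card K + 3 ≤ 2 * (star e v).card) : star e v = Finset.univ := by
  classical
  have hadj : ∀ w, w ≠ v → Adj e v w := by
    intro w hw
    by_contra hn
    have h1 := card_opp h4 hp hw.symm hn
    have h2 : (opp e v w).card ≤ (star e v)ᶜ.card := by
      refine Finset.card_le_card fun i hi => ?_
      rw [Finset.mem_compl, mem_star]
      exact (ne_zero_of_mem_opp hi).1
    rw [Finset.card_compl] at h2
    have h3 := Finset.card_le_univ (star e v)
    omega
  have h : nbr e v = Finset.univ.erase v := by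
    ext w
    rw [mem_nbr, Finset.mem_erase]
    exact ⟨fun h => ⟨h.1.symm, Finset.mem_univ _⟩, fun h => hadj w h.1⟩
  rw [← Finset.card_eq_iff_eq_univ, ← card_nbr h4 hp, h,
    Finset.card_erase_of_mem (Finset.mem_univ _), Finset.card_univ, Fintype.card_option, hc]
  rfl

end

/-! ### Signs on a complete component -/

section

variable {K : Type*} [Field K]

/-- A connected component of the graph `Adj e` that is a complete graph. -/
structure IsCliqueComponent {ι : Type*} (e : ι → Fin 3 → K) (S : Finset (Option K)) : Prop where
  adj : ∀ s ∈ S, ∀ t ∈ S, s ≠ t → Adj e s t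
  closed : ∀ s ∈ S, ∀ t, Adj e s t → t ∈ S

variable [Fintype K] [DecidableEq K] {ι : Type*} [Fintype ι] {e : ι → Fin 3 → K}
  {S : Finset (Option K)}

/-- A line `ab` of the partition does not separate `c` from `d` if `cd` is one too. -/
lemma pal_compat (h4 : Fintype.card K % 4 = 1) (hp : IsInternalPartition e) {a b c d : Option K}
    (hab : Adj e a b) (hcd : Adj e c d) (hca : c ≠ a) (hcb : c ≠ b) (hda : d ≠ a) (hdb : d ≠ b) :
    pal c a * pal c b = pal d a * pal d b := by
  obtain ⟨hne, i, hia, hib⟩ := hab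
  have hf := fdisc_ne_zero h4 hp i
  have hz : ∀ z, z ≠ a → z ≠ b → ev (e i) (vec z) ≠ 0 := fun z h1 h2 h =>
    (eq_or_eq_of_zeros hf hia hib hne h).elim h1 h2
  have h := quadraticChar_mul_eq_one_of_adj h4 hp hcd (hz c hca hcb) (hz d hda hdb)
  rw [quadraticChar_ev_mul h4 hf hne hia hib] at h
  rcases pal_cases hca with h1 | h1 <;> rcases pal_cases hcb with h2 | h2 <;>
    rcases pal_cases hda with h3 | h3 <;> rcases pal_cases hdb with h5 | h5 <;>
    rw [h1, h2, h3, h5] at h ⊢ <;> simp at h ⊢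

/-- On a component with at least three points, `pal` has rank one off the diagonal. -/
lemma exists_signs (h4 : Fintype.card K % 4 = 1) (hp : IsInternalPartition e)
    (hS : IsCliqueComponent e S) (hn : 2 < S.card) :
    ∃ (y : Option K → ℤ) (τ : ℤ), (∀ s ∈ S, y s * y s = 1) ∧ τ * τ = 1 ∧
      ∀ s ∈ S, ∀ t ∈ S, s ≠ t → pal s t = τ * (y s * y t) := by
  obtain ⟨a, ha, b, hb, c, hc, hab, hac, hbc⟩ := Finset.two_lt_card.1 hn
  -- Normalize the rows and columns of `pal` so that those of `a` become constant; then all other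
  -- entries off the diagonal agree.
  let T : Option K → Option K → ℤ := fun s t => pal a s * pal s t * pal a t
  have hT1 : ∀ s ∈ S, ∀ t ∈ S, ∀ t' ∈ S, s ≠ a → t ≠ a → t' ≠ a → t ≠ s → t' ≠ s →
      T s t = T s t' := by
    intro s hs t ht t' ht' hsa hta hta' hts hts'
    by_cases htt : t = t'
    · rw [htt]
    have h := pal_compat h4 hp (hS.adj a ha s hs hsa.symm)
      (hS.adj t ht t' ht' htt) hta hts hta' hts'
    simp only [T]
    rw [pal_comm h4 t a, pal_comm h4 t s, pal_comm h4 t' a, pal_comm h4 t' s] at h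
    linear_combination pal a s * h
  have hTsymm : ∀ s t, T s t = T t s := by
    intro s t
    simp only [T]
    rw [pal_comm h4 s t]; ring
  have hT : ∀ s ∈ S, ∀ t ∈ S, s ≠ a → t ≠ a → t ≠ s → T s t = T b c := by
    intro s hs t ht hsa hta hts
    by_cases hsb : s = b
    · subst hsb
      exact hT1 s hs t ht c hc hsa hta hac.symm hts hbc.symm
    · rw [hT1 s hs t ht b hb hsa hta hab.symm hts (Ne.symm hsb), hTsymm,
        hT1 b hb s hs c hc hab.symm hsa hac.symm hsb hbc.symm]
  have hτ : T b c * T b c = 1 := by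
    simp only [T]
    linear_combination (pal b c * pal b c * (pal a c * pal a c)) * pal_mul_self hab +
      (pal a c * pal a c) * pal_mul_self hbc + pal_mul_self hac
  refine ⟨fun s => if s = a then T b c else pal a s, T b c, ?_, hτ, ?_⟩
  · intro s _
    by_cases h : s = a
    · simp only [h, if_true, hτ]
    · simp only [h, if_false]
      exact pal_mul_self (Ne.symm h)
  · intro s hs t ht hst
    by_cases hsa : s = a
    · have hta : t ≠ a := fun h => hst (hsa.trans h.symm)
      simp only [hsa, hta, if_true, if_false]
      linear_combination -pal a t * hτ
    · by_cases hta : t = a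
      · simp only [hsa, hta, if_true, if_false]
        rw [pal_comm h4 s a]
        linear_combination -pal a s * hτ
      · simp only [hsa, hta, if_false]
        rw [← hT s hs t ht hsa hta (Ne.symm hst)]
        simp only [T]
        linear_combination -pal s t * pal a t * pal a t * pal_mul_self (Ne.symm hsa) -
          pal s t * pal_mul_self (Ne.symm hta)

/-- The lines through `v'` that separate `u` from `v` correspond to the points of the component
whose sign differs from that of `v'`. -/
lemma card_opp_inter_star (h4 : Fintype.card K % 4 = 1) (hp : IsInternalPartition e)
    (hS : IsCliqueComponent e S) {y : Option K → ℤ} {τ : ℤ} (hy : ∀ s ∈ S, y s * y s = 1)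
    (hτ : τ * τ = 1) (hpal : ∀ s ∈ S, ∀ t ∈ S, s ≠ t → pal s t = τ * (y s * y t))
    {u v v' : Option K} (hv : v ∈ S) (hv' : v' ∈ S) (hvv : v ≠ v') :
    ((opp e u v).filter fun i => ev (e i) (vec v') = 0).card
      = (S.filter fun w => w ≠ v ∧ w ≠ v' ∧ y v' * pal u v' * (y w * pal u w) = -1).card := by
  symm
  have key : ∀ w, w ∈ S ∧ w ≠ v' → ∃ i, ev (e i) (vec v') = 0 ∧ ev (e i) (vec w) = 0 :=
    fun w hw => (hS.adj v' hv' w hw.1 hw.2.symm).2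
  have hchi : ∀ w ∈ S, w ≠ v → w ≠ v' → ∀ i, ev (e i) (vec v') = 0 → ev (e i) (vec w) = 0 →
      quadraticChar K (ev (e i) (vec u) * ev (e i) (vec v))
        = y v' * pal u v' * (y w * pal u w) := by
    intro w hw hwv hwv' i hi1 hi2
    rw [quadraticChar_ev_mul h4 (fdisc_ne_zero h4 hp i) hwv'.symm hi1 hi2,
      hpal v hv v' hv' hvv, hpal v hv w hw hwv.symm]
    linear_combination (pal u v' * pal u w * y v' * y w * y v * y v) * hτ +
      (pal u v' * pal u w * y v' * y w) * hy v hv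
  have : Nonempty ι := (hS.adj v hv v' hv' hvv).2.nonempty
  choose! F hF using key
  refine Finset.card_bij (fun w _ => F w) ?_ ?_ ?_
  · intro w hw
    rw [Finset.mem_filter] at hw
    obtain ⟨hw, hwv, hwv', h⟩ := hw
    obtain ⟨h1, h2⟩ := hF w ⟨hw, hwv'⟩
    rw [Finset.mem_filter, mem_opp, hchi w hw hwv hwv' _ h1 h2]
    exact ⟨h, h1⟩
  · intro w hw x hx hwx
    rw [Finset.mem_filter] at hw hx
    obtain ⟨h1, h2⟩ := hF w ⟨hw.1, hw.2.2.1⟩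
    obtain ⟨h3, h5⟩ := hF x ⟨hx.1, hx.2.2.1⟩
    rw [← hwx] at h5
    rcases eq_or_eq_of_zeros (fdisc_ne_zero h4 hp _) h1 h2 hw.2.2.1.symm h5 with h | h
    · exact absurd h hx.2.2.1
    · exact h.symm
  · intro i hi
    rw [Finset.mem_filter] at hi
    obtain ⟨hi, hi'⟩ := hi
    obtain ⟨w, hwv', hiw⟩ := exists_other_zero (fdisc_ne_zero h4 hp i) hi'
    have hw : w ∈ S := hS.closed v' hv' w ⟨hwv'.symm, i, hi', hiw⟩
    have hwv : w ≠ v := by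
      rintro rfl
      exact (ne_zero_of_mem_opp hi).2 hiw
    refine ⟨w, ?_, ?_⟩
    · rw [Finset.mem_filter, ← hchi w hw hwv hwv' i hi' hiw, mem_opp.1 hi]
      exact ⟨hw, hwv, hwv', rfl⟩
    · obtain ⟨h1, h2⟩ := hF w ⟨hw, hwv'⟩
      exact eq_of_zeros h4 hp hwv'.symm h1 h2 hi' hiw

/-- Seen from a point outside, the signs on a component are constant or sum to zero. -/
lemma const_or_sum_eq_zero (h4 : Fintype.card K % 4 = 1) (hp : IsInternalPartition e)
    (hS : IsCliqueComponent e S) {y : Option K → ℤ} {τ : ℤ} (hy : ∀ s ∈ S, y s * y s = 1)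
    (hτ : τ * τ = 1) (hpal : ∀ s ∈ S, ∀ t ∈ S, s ≠ t → pal s t = τ * (y s * y t))
    {u : Option K} (hu : u ∉ S) :
    (∃ c : ℤ, c * c = 1 ∧ ∀ s ∈ S, y s * pal u s = c) ∨ ∑ s ∈ S, y s * pal u s = 0 := by
  classical
  by_cases hconst : ∃ c : ℤ, c * c = 1 ∧ ∀ s ∈ S, y s * pal u s = c
  · exact Or.inl hconst
  right
  rcases S.eq_empty_or_nonempty with rfl | ⟨v, hv⟩
  · simp
  have hx : ∀ s ∈ S, y s * pal u s * (y s * pal u s) = 1 := by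
    intro s hs
    have hus : u ≠ s := by rintro rfl; exact hu hs
    linear_combination (pal u s * pal u s) * hy s hs + pal_mul_self hus
  have hx' : ∀ s ∈ S, y s * pal u s = 1 ∨ y s * pal u s = -1 :=
    fun s hs => mul_self_eq_one_iff.1 (hx s hs)
  obtain ⟨v', hv', hne⟩ : ∃ v' ∈ S, y v' * pal u v' ≠ y v * pal u v := by
    by_contra! h
    exact hconst ⟨_, hx v hv, h⟩
  have hvv : v ≠ v' := by rintro rfl; exact hne rfl
  have hnadj : ∀ s ∈ S, ¬Adj e u s := fun s hs h => hu (hS.closed s hs u h.symm)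
  have hus : ∀ s ∈ S, u ≠ s := by rintro s hs rfl; exact hu hs
  have h1 := card_opp h4 hp (hus v hv) (hnadj v hv)
  have h2 := card_opp h4 hp (hus v' hv') (hnadj v' hv')
  rw [← Finset.card_filter_add_card_filter_not (s := opp e u v)
    (fun i => ev (e i) (vec v') = 0)] at h1
  rw [← Finset.card_filter_add_card_filter_not (s := opp e u v')
    (fun i => ev (e i) (vec v) = 0)] at h2
  -- No line separates `v` from `v'`, so the lines that avoid both separate `u` from `v` and from
  -- `v'` alike, and only the lines through `v` or `v'` distinguish the two counts.
  have h3 : (opp e u v).filter (fun i => ¬ev (e i) (vec v') = 0)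
      = (opp e u v').filter fun i => ¬ev (e i) (vec v) = 0 := by
    ext i
    rw [Finset.mem_filter, Finset.mem_filter]
    have hadj := hS.adj v hv v' hv' hvv
    constructor
    · rintro ⟨hi, hi'⟩
      have h0 := (ne_zero_of_mem_opp hi).2
      refine ⟨?_, h0⟩
      rw [mem_opp, map_mul] at hi ⊢
      rw [← quadraticChar_eq_of_adj h4 hp hadj h0 hi', hi]
    · rintro ⟨hi, hi'⟩
      have h0 := (ne_zero_of_mem_opp hi).2
      refine ⟨?_, h0⟩
      rw [mem_opp, map_mul] at hi ⊢
      rw [quadraticChar_eq_of_adj h4 hp hadj hi' h0, hi]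
  rw [h3, card_opp_inter_star h4 hp hS hy hτ hpal hv hv' hvv] at h1
  rw [card_opp_inter_star h4 hp hS hy hτ hpal hv' hv hvv.symm] at h2
  have hdec : ∀ (g : Option K → ℤ), ∑ s ∈ S, g s
      = g v + g v' + ∑ s ∈ (S.erase v).erase v', g s := by
    intro g
    rw [← Finset.add_sum_erase S g hv,
      ← Finset.add_sum_erase (S.erase v) g (Finset.mem_erase.2 ⟨hvv.symm, hv'⟩)]
    ring
  have hopp : y v' * pal u v' = -(y v * pal u v) := by
    rcases hx' v hv with h | h <;> rcases hx' v' hv' with h' | h' <;>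
      first | exact absurd (h'.trans h.symm) hne | linarith
  have hA : ∀ (a b : Option K), (a = v ∧ b = v') ∨ (a = v' ∧ b = v) → ∀ c,
      (S.filter fun w => w ≠ a ∧ w ≠ b ∧ y b * pal u b * (y w * pal u w) = -1).card = c →
      ((c : ℤ) = ∑ s ∈ (S.erase v).erase v', if y s * pal u s = y a * pal u a then 1 else 0) := by
    intro a b hab c hcard
    rw [← hcard, Finset.sum_boole]
    congr 2
    ext w
    simp only [Finset.mem_filter, Finset.mem_erase]
    have hsig : w ∈ S → (y b * pal u b * (y w * pal u w) = -1 ↔ y w * pal u w = y a * pal u a) := by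
      intro hw
      rcases hab with ⟨rfl, rfl⟩ | ⟨rfl, rfl⟩ <;> rw [hopp] <;>
        rcases hx' _ hw with h | h <;> rw [h] <;> rcases hx' _ hv with h' | h' <;> rw [h'] <;> simp
    rcases hab with ⟨rfl, rfl⟩ | ⟨rfl, rfl⟩ <;> tauto
  have hA1 := hA v v' (Or.inl ⟨rfl, rfl⟩) _ rfl
  have hA2 := hA v' v (Or.inr ⟨rfl, rfl⟩) _ rfl
  have heq : (∑ s ∈ (S.erase v).erase v', if y s * pal u s = y v * pal u v then (1 : ℤ) else 0)
      = ∑ s ∈ (S.erase v).erase v', if y s * pal u s = y v' * pal u v' then (1 : ℤ) else 0 := by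
    rw [← hA1, ← hA2]
    congr 1
    omega
  rw [hdec, hopp]
  have hsum : ∑ s ∈ (S.erase v).erase v', y s * pal u s
      = ∑ s ∈ (S.erase v).erase v',
        ((if y s * pal u s = y v * pal u v then (1 : ℤ) else 0)
          - if y s * pal u s = y v' * pal u v' then (1 : ℤ) else 0) * (y v * pal u v) := by
    refine Finset.sum_congr rfl fun s hs => ?_
    have hs : s ∈ S := Finset.mem_of_mem_erase (Finset.mem_of_mem_erase hs)
    rw [hopp]
    rcases hx' s hs with h | h <;> rw [h] <;> rcases hx' v hv with h' | h' <;> rw [h'] <;> simp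
  rw [hsum, ← Finset.sum_mul, Finset.sum_sub_distrib, heq]
  ring

end

/-! ### The size of a component -/

section

open Polynomial

variable {K : Type*} [Field K] [Fintype K] [DecidableEq K]

/-- `pal u s`, as an element of `K`, is the value at `u` of a polynomial of degree at most
`(q - 1) / 2`; its coefficient in that degree is the value at infinity. -/
lemma pal_cast (h4 : Fintype.card K % 4 = 1) (u s : Option K) :
    ((pal u s : ℤ) : K) = wedge (vec u) (vec s) ^ (Fintype.card K / 2) :=
  quadraticChar_eq_pow_of_char_ne_two' (ringChar_ne_two h4) _

/-- If a signed sum of the functions `pal · s` vanishes in `K` at more than `(q - 1) / 2` affine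
points, then it vanishes everywhere. -/
lemma signed_sum_eq_zero (h4 : Fintype.card K % 4 = 1) (S : Finset (Option K))
    (y : Option K → ℤ) (Z : Finset K) (hZ : Fintype.card K / 2 < Z.card)
    (h0 : ∀ x ∈ Z, ((∑ s ∈ S, y s * pal (some x) s : ℤ) : K) = 0) (u : Option K) :
    ((∑ s ∈ S, y s * pal u s : ℤ) : K) = 0 := by
  set w := Fintype.card K / 2 with hw
  have hw0 : w ≠ 0 := by
    have : 1 < Fintype.card K := Fintype.one_lt_card
    omega
  let f : K[X] := ∑ s ∈ S, C (y s : K) * (C (vec s).2 * X + C (-(vec s).1)) ^ w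
  have hev : ∀ x : K, f.eval x = ((∑ s ∈ S, y s * pal (some x) s : ℤ) : K) := by
    intro x
    simp only [f, eval_finsetSum, eval_mul, eval_C, eval_pow, eval_add, eval_X, Int.cast_sum,
      Int.cast_mul, pal_cast h4]
    refine Finset.sum_congr rfl fun s _ => ?_
    congr 2
    simp only [wedge, vec_some]; ring
  have hdeg1 : ∀ s : Option K, ((C (vec s).2 * X + C (-(vec s).1)) ^ w).natDegree ≤ w := by
    intro s
    refine (natDegree_pow_le_of_le w (natDegree_linear_le)).trans ?_
    omega
  have hdeg : f.natDegree ≤ w := by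
    refine natDegree_sum_le_of_forall_le _ _ fun s _ => ?_
    exact (natDegree_C_mul_le _ _).trans (hdeg1 s)
  have hf : f = 0 := by
    refine eq_zero_of_natDegree_lt_card_of_eval_eq_zero' f Z (fun x hx => ?_)
      (hdeg.trans_lt hZ)
    rw [hev, h0 x hx]
  cases u with
  | some x => rw [← hev, hf, eval_zero]
  | none =>
    have hc : f.coeff w = ((∑ s ∈ S, y s * pal none s : ℤ) : K) := by
      simp only [f, finsetSum_coeff, coeff_C_mul, Int.cast_sum, Int.cast_mul, pal_cast h4]
      refine Finset.sum_congr rfl fun s _ => ?_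
      congr 1
      have := coeff_pow_of_natDegree_le (m := w) (natDegree_linear_le (a := (vec s).2)
        (b := -(vec s).1))
      rw [mul_one] at this
      rw [this]
      simp [wedge, hw]
    rw [← hc, hf, coeff_zero]

variable {ι : Type*} [Fintype ι] {e : ι → Fin 3 → K} {S : Finset (Option K)}

/-- A component with at least three points has exactly `√q + 1` of them. With `n` points in `S`
and `m` points outside at which the signed sum `g` does not vanish, orthogonality gives
`(n - 1)² + n m = q`. So `g` has enough zeros to vanish in `K` everywhere, which forces `p ∣ n - 1`
and then `m = 0`. -/
lemma card_component (h4 : Fintype.card K % 4 = 1) (hp : IsInternalPartition e)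
    (hS : IsCliqueComponent e S) (hn : 2 < S.card) :
    (S.card - 1) ^ 2 = Fintype.card K := by
  classical
  obtain ⟨y, τ, hy, hτ, hpal⟩ := exists_signs h4 hp hS hn
  set n := S.card with hndef
  set q := Fintype.card K with hq
  let g : Option K → ℤ := fun u => ∑ s ∈ S, y s * pal u s
  have hin : ∀ u ∈ S, g u = τ * y u * (n - 1) := by
    intro u hu
    have : ∀ s ∈ S.erase u, y s * pal u s = τ * y u := by
      intro s hs
      rw [Finset.mem_erase] at hs
      rw [hpal u hu s hs.2 hs.1.symm]
      linear_combination τ * y u * hy s hs.2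
    simp only [g]
    rw [← Finset.add_sum_erase S _ hu, pal_self, Finset.sum_congr rfl this, Finset.sum_const,
      Finset.card_erase_of_mem hu, nsmul_eq_mul, Nat.cast_sub (by omega)]
    push_cast; ring
  have hout : ∀ u, u ∉ S → (g u * g u = n ^ 2) ∨ g u = 0 := by
    intro u hu
    rcases const_or_sum_eq_zero h4 hp hS hy hτ hpal hu with ⟨c, hc, h⟩ | h
    · left
      simp only [g]
      rw [Finset.sum_congr rfl h, Finset.sum_const, nsmul_eq_mul]
      linear_combination (n : ℤ) ^ 2 * hc
    · exact Or.inr h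
  let c : Finset (Option K) := Sᶜ.filter fun u => g u ≠ 0
  -- the sum of squares of `g` comes from the orthogonality of the columns of `pal`
  have hsq : ∑ u, g u * g u = q * n := by
    have h1 : ∀ u, g u * g u = ∑ s ∈ S, ∑ t ∈ S, y s * y t * (pal u s * pal u t) := by
      intro u
      simp only [g]
      rw [Finset.sum_mul_sum]
      refine Finset.sum_congr rfl fun s _ => Finset.sum_congr rfl fun t _ => by ring
    simp only [h1]
    rw [Finset.sum_comm]
    have h2 : ∀ s ∈ S, ∑ u, ∑ t ∈ S, y s * y t * (pal u s * pal u t) = q := by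
      intro s hs
      rw [Finset.sum_comm, Finset.sum_eq_single_of_mem s hs]
      · rw [← Finset.mul_sum, sum_pal_sq, hy s hs, one_mul]
      · intro t _ hts
        rw [← Finset.mul_sum, sum_pal_mul h4 hts.symm, mul_zero]
    rw [Finset.sum_congr rfl h2, Finset.sum_const, nsmul_eq_mul, mul_comm]
  have hcount : n * ((n : ℤ) - 1) ^ 2 + n ^ 2 * c.card = q * n := by
    rw [← hsq, ← Finset.sum_add_sum_compl S]
    congr 1
    · have : ∀ u ∈ S, g u * g u = ((n : ℤ) - 1) ^ 2 := by
        intro u hu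
        rw [hin u hu]
        linear_combination ((n : ℤ) - 1) ^ 2 * (y u * y u) * hτ + ((n : ℤ) - 1) ^ 2 * hy u hu
      rw [Finset.sum_congr rfl this, Finset.sum_const, nsmul_eq_mul]
    · have : ∀ u ∈ Sᶜ, g u * g u = if g u ≠ 0 then (n : ℤ) ^ 2 else 0 := by
        intro u hu
        split_ifs with h
        · exact (hout u (Finset.mem_compl.1 hu)).resolve_right h
        · rw [not_not] at h; rw [h, mul_zero]
      rw [Finset.sum_congr rfl this, ← Finset.sum_filter, Finset.sum_const, nsmul_eq_mul]
      ring
  have hcount' : (((n : ℤ) - 1) ^ 2 + n * c.card) = q := by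
    have hn0 : (n : ℤ) ≠ 0 := by
      have : n ≠ 0 := by omega
      exact_mod_cast this
    refine mul_left_cancel₀ hn0 ?_
    linear_combination hcount
  have hn3 : (3 : ℤ) ≤ n := by exact_mod_cast hn
  have hc0 : (0 : ℤ) ≤ c.card := Int.natCast_nonneg _
  -- The smallest case `q = 5` is excluded directly; beyond it, the estimate for `Z` below works.
  have hq9 : (9 : ℤ) ≤ q := by
    by_contra! hlt
    have hq1 : 1 < q := Fintype.one_lt_card
    have h5 : (q : ℤ) = 5 := by omega
    rw [h5] at hcount'
    have : (n : ℤ) = 3 := by nlinarith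
    rw [this] at hcount'
    omega
  have hcle : c.card + n ≤ q + 1 := by
    have : c.card ≤ Sᶜ.card := Finset.card_filter_le _ _
    rw [Finset.card_compl, Fintype.card_option] at this
    have h' := Finset.card_le_univ S
    rw [Fintype.card_option] at h'
    omega
  -- the affine points outside `S` at which `g` vanishes
  let Z : Finset K := Finset.univ.filter fun x => some x ∉ S ∧ g (some x) = 0
  have hZcard : q + 1 ≤ Z.card + 1 + n + c.card := by
    have hsub : (Finset.univ : Finset (Option K))
        ⊆ (Z.map Function.Embedding.some ∪ {none}) ∪ (S ∪ c) := by
      intro u _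
      simp only [Finset.mem_union, Finset.mem_map, Finset.mem_singleton]
      by_cases hu : u ∈ S
      · exact Or.inr (Or.inl hu)
      by_cases hg : g u = 0
      · left
        cases u with
        | none => exact Or.inr rfl
        | some x =>
          exact Or.inl ⟨x, Finset.mem_filter.2 ⟨Finset.mem_univ _, hu, hg⟩, rfl⟩
      · exact Or.inr (Or.inr (Finset.mem_filter.2 ⟨Finset.mem_compl.2 hu, hg⟩))
    have h := (Finset.card_le_card hsub).trans ((Finset.card_union_le _ _).trans
      (Nat.add_le_add (Finset.card_union_le _ _) (Finset.card_union_le _ _)))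
    rw [Finset.card_univ, Fintype.card_option, Finset.card_map, Finset.card_singleton] at h
    omega
  have hZ : q / 2 < Z.card := by
    have h1 : (n : ℤ) * (2 * (Z.card + 1)) ≥ n * (2 * (q + 1 - n - c.card)) := by
      have : (q : ℤ) + 1 ≤ Z.card + 1 + n + c.card := by exact_mod_cast hZcard
      nlinarith
    have h2 : (n : ℤ) * (2 * Z.card) > n * (q - 1) := by nlinarith
    have h3 : (2 * Z.card : ℤ) > q - 1 := lt_of_mul_lt_mul_left h2 (by omega)
    omega
  have hzero := signed_sum_eq_zero h4 S y Z hZ (fun x hx => by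
    have := (Finset.mem_filter.1 hx).2.2
    simp only [g] at this
    rw [this, Int.cast_zero])
  obtain ⟨s, hs⟩ : S.Nonempty := Finset.card_pos.1 (by omega)
  have hn1 : ((n : ℤ) - 1 : K) = 0 := by
    have h := hzero s
    change ((g s : ℤ) : K) = 0 at h
    rw [hin s hs] at h
    have h' : ((τ * y s * (τ * y s * (n - 1)) : ℤ) : K) = 0 := by
      rw [Int.cast_mul, h, mul_zero]
    have h5 : τ * y s * (τ * y s * (n - 1)) = (n : ℤ) - 1 := by
      linear_combination ((n : ℤ) - 1) * (y s * y s) * hτ + ((n : ℤ) - 1) * hy s hs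
    rw [h5] at h'
    exact_mod_cast h'
  have hcempty : c = ∅ := by
    refine Finset.eq_empty_of_forall_notMem fun u hu => ?_
    obtain ⟨hu, hgu⟩ := Finset.mem_filter.1 hu
    have h := (hout u (Finset.mem_compl.1 hu)).resolve_right hgu
    have h0 : ((g u : ℤ) : K) = 0 := hzero u
    have h5 : (((n : ℤ) ^ 2 : ℤ) : K) = 0 := by rw [← h, Int.cast_mul, h0, mul_zero]
    have h6 : ((n : ℤ) : K) = 1 := sub_eq_zero.1 hn1
    rw [Int.cast_pow, h6] at h5
    simp at h5
  rw [hcempty, Finset.card_empty] at hcount'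
  have : ((n - 1 : ℕ) : ℤ) = n - 1 := by rw [Nat.cast_sub (by omega)]; rfl
  zify
  rw [this]
  push_cast at hcount'
  linarith

end

/-! ### The components of the graph -/

section

variable {K : Type*} [Field K] [Fintype K] [DecidableEq K] {ι : Type*} [Fintype ι]
  {e : ι → Fin 3 → K}

/-- The shape of a partition into `q` lines that do not all pass through one point of the conic:
the lines join all pairs of points of a set `S` of `r + 1` points, where `r ^ 2 = q`, and they
match the other points of the conic in pairs. -/
structure IsCliqueWithMatching (e : ι → Fin 3 → K) (S : Finset (Option K)) (r : ℕ) : Prop where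
  sq : r ^ 2 = Fintype.card K
  component : IsCliqueComponent e S
  card_eq : S.card = r + 1
  card_star_of_mem : ∀ u ∈ S, (star e u).card = r
  card_star : ∀ u, u ∉ S → (star e u).card = 1

lemma card_star_of_mem_component (h4 : Fintype.card K % 4 = 1) (hp : IsInternalPartition e)
    {S : Finset (Option K)} (hS : IsCliqueComponent e S) {u : Option K} (hu : u ∈ S) :
    (star e u).card = S.card - 1 := by
  rw [← card_nbr h4 hp, ← Finset.card_erase_of_mem hu]
  congr 1
  ext v
  rw [mem_nbr, Finset.mem_erase]
  exact ⟨fun h => ⟨h.1.symm, hS.closed u hu v h⟩, fun h => hS.adj u hu v h.2 h.1.symm⟩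

/-- Either all lines pass through one point of the conic, or adjacency is transitive. In the
second case a component with more than two points accounts for `q + r` of the `2 q` incidences,
which leaves room for only one such component. -/
theorem star_or_cliqueWithMatching (h4 : Fintype.card K % 4 = 1) (hp : IsInternalPartition e)
    (hc : Fintype.card ι = Fintype.card K) :
    (∃ v, star e v = Finset.univ) ∨ ∃ S r, IsCliqueWithMatching e S r := by
  classical
  by_cases hstar : ∃ v, star e v = Finset.univ
  · exact Or.inl hstar
  right
  have hsmall : ∀ v, 2 * (star e v).card < Fintype.card K + 3 := by
    intro v
    by_contra! h
    exact hstar ⟨v, star_eq_univ h4 hp hc h⟩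
  have htrans : ∀ u v w, Adj e u v → Adj e v w → u ≠ w → Adj e u w := by
    intro u v w huv hvw huw
    by_contra hn
    exact absurd (card_star_of_path h4 hp huv hvw huw hn) (not_le.2 (hsmall v))
  have hcomp : ∀ u, IsCliqueComponent e (insert u (nbr e u)) := by
    refine fun u => ⟨fun s hs t ht hst => ?_, fun s hs t hst => ?_⟩
    · rw [Finset.mem_insert, mem_nbr] at hs ht
      rcases hs with rfl | hs <;> rcases ht with rfl | ht
      · exact absurd rfl hst
      · exact ht
      · exact hs.symm
      · exact htrans s u t hs.symm ht hst
    · rw [Finset.mem_insert, mem_nbr] at hs ⊢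
      rcases hs with rfl | hs
      · exact Or.inr hst
      · by_cases htu : t = u
        · exact Or.inl htu
        · exact Or.inr (htrans u s t hs hst (Ne.symm htu))
  have hccard : ∀ u, (insert u (nbr e u)).card = (star e u).card + 1 := by
    intro u
    rw [Finset.card_insert_of_notMem (by rw [mem_nbr]; exact fun h => h.1 rfl), card_nbr h4 hp]
  have hdeg : ∀ u, 2 ≤ (star e u).card → (star e u).card ^ 2 = Fintype.card K := by
    intro u hu
    have := card_component h4 hp (hcomp u) (by rw [hccard]; omega)
    rwa [hccard] at this
  have hsum := sum_card_star h4 hp hc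
  have hq1 : 1 < Fintype.card K := Fintype.one_lt_card
  obtain ⟨u, hu⟩ : ∃ u, 2 ≤ (star e u).card := by
    by_contra! h
    have : ∑ u, (star e u).card ≤ ∑ _u : Option K, 1 :=
      Finset.sum_le_sum fun u _ => Nat.le_of_lt_succ (h u)
    rw [hsum, Finset.sum_const, Finset.card_univ, Fintype.card_option] at this
    simp only [smul_eq_mul, mul_one] at this
    omega
  set S := insert u (nbr e u) with hS
  set r := (star e u).card with hr
  have hrq := hdeg u hu
  have hSd : ∀ s ∈ S, (star e s).card = r := by
    intro s hs
    rw [card_star_of_mem_component h4 hp (hcomp u) hs, hccard]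
    rfl
  have hSsum : ∑ s ∈ S, (star e s).card = Fintype.card K + r := by
    rw [Finset.sum_congr rfl hSd, Finset.sum_const, hccard, smul_eq_mul, ← hr, ← hrq]
    ring
  have hsplit := Finset.sum_add_sum_compl S fun s => (star e s).card
  rw [hSsum, hsum] at hsplit
  have hle : ∀ w ∈ Sᶜ, (star e w).card ≤ 1 := by
    intro w hw
    rw [Finset.mem_compl] at hw
    by_contra! hw2
    have hwr : (star e w).card = r :=
      Nat.pow_left_injective (n := 2) (by norm_num) ((hdeg w hw2).trans hrq.symm)
    have hsub : insert w (nbr e w) ⊆ Sᶜ := by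
      intro x hx
      rw [Finset.mem_compl]
      intro hxS
      rw [Finset.mem_insert, mem_nbr] at hx
      rcases hx with rfl | hx
      · exact hw hxS
      · exact hw ((hcomp u).closed x hxS w hx.symm)
    have h1 := Finset.sum_le_sum_of_subset (f := fun s => (star e s).card) hsub
    have h2 : ∑ s ∈ insert w (nbr e w), (star e s).card = Fintype.card K + r := by
      have : ∀ s ∈ insert w (nbr e w), (star e s).card = r := by
        intro s hs
        rw [card_star_of_mem_component h4 hp (hcomp w) hs, hccard, hwr]
        rfl
      rw [Finset.sum_congr rfl this, Finset.sum_const, hccard, smul_eq_mul, hwr, ← hrq]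
      ring
    rw [h2] at h1
    omega
  have hcompl : Sᶜ.card + r = Fintype.card K := by
    have := Finset.card_add_card_compl S
    rw [Fintype.card_option, hccard, ← hr] at this
    omega
  have heq : ∑ s ∈ Sᶜ, (star e s).card = ∑ _s ∈ Sᶜ, 1 := by
    rw [Finset.sum_const, smul_eq_mul, mul_one]
    omega
  refine ⟨S, r, hrq, hcomp u, hccard u, hSd, fun w hw => ?_⟩
  exact (Finset.sum_eq_sum_iff_of_le hle).1 heq w (Finset.mem_compl.2 hw)

end

/-! ### Polynomials over the quadratic extension -/

section

open MvPolynomial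

/-- The elements of a field that satisfy `x ^ q = x` lie in any given subfield of order `q`. -/
lemma exists_map_eq_of_pow_card_eq {K F : Type*} [Field K] [Fintype K] [Field F] (φ : K →+* F)
    {x : F} (hx : x ^ Fintype.card K = x) : ∃ a, φ a = x := by
  classical
  by_contra! h
  have h1 : 1 < Fintype.card K := Fintype.one_lt_card
  have hne := FiniteField.X_pow_card_sub_X_ne_zero F h1
  have hsub : insert x (Finset.univ.image φ)
      ⊆ (Polynomial.X ^ Fintype.card K - Polynomial.X : Polynomial F).roots.toFinset := by
    intro y hy
    rw [Multiset.mem_toFinset, Polynomial.mem_roots hne]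
    rw [Finset.mem_insert, Finset.mem_image] at hy
    rcases hy with rfl | ⟨a, -, rfl⟩
    · simp [hx]
    · simp [← map_pow, FiniteField.pow_card]
  have h2 := (Finset.card_le_card hsub).trans
    ((Multiset.toFinset_card_le _).trans (Polynomial.card_roots' _))
  rw [FiniteField.X_pow_card_sub_X_natDegree_eq F h1, Finset.card_insert_of_notMem,
    Finset.card_image_of_injective _ φ.injective, Finset.card_univ] at h2
  · omega
  · rw [Finset.mem_image]
    rintro ⟨a, -, ha⟩
    exact h a ha

/-- A polynomial in two variables of degree less than `q` in each is determined by its values at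
the points `(x, x ^ q)`, for `x` in a field of order `q ^ 2`. -/
lemma eq_zero_of_eval_pow_eq_zero {F : Type*} [Field F] [Fintype F] {q : ℕ}
    (hF : Fintype.card F = q ^ 2) (H : MvPolynomial (Fin 2) F) (hdeg : ∀ j, H.degreeOf j < q)
    (h0 : ∀ x, eval ![x, x ^ q] H = 0) : H = 0 := by
  classical
  have hm : ∀ m ∈ H.support, ∀ j, m j < q := fun m hm j =>
    (monomial_le_degreeOf j hm).trans_lt (hdeg j)
  let h : Polynomial F := ∑ m ∈ H.support, Polynomial.monomial (m 0 + q * m 1) (H.coeff m)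
  have hev : ∀ x, h.eval x = 0 := by
    intro x
    rw [← h0 x, eval_eq']
    simp only [h, Polynomial.eval_finsetSum, Polynomial.eval_monomial]
    refine Finset.sum_congr rfl fun m _ => ?_
    rw [Fin.prod_univ_two]
    simp only [Matrix.cons_val_zero, Matrix.cons_val_one]
    rw [pow_add, pow_mul]
  have hlt : ∀ m ∈ H.support, m 0 + q * m 1 < q ^ 2 := by
    intro m hmm
    have h1 := hm m hmm 0
    have h2 := hm m hmm 1
    nlinarith
  have hz : h = 0 := by
    by_cases hsupp : H.support.Nonempty
    · refine Polynomial.eq_zero_of_natDegree_lt_card_of_eval_eq_zero' h Finset.univ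
        (fun x _ => hev x) ?_
      rw [Finset.card_univ, hF]
      obtain ⟨m0, hm0⟩ := hsupp
      refine Nat.lt_of_le_sub_one (lt_of_le_of_lt (Nat.zero_le _) (hlt m0 hm0)) ?_
      refine Polynomial.natDegree_sum_le_of_forall_le _ _ fun m hmm => ?_
      exact (Polynomial.natDegree_monomial_le _).trans (Nat.le_sub_one_of_lt (hlt m hmm))
    · simp only [h]
      rw [Finset.not_nonempty_iff_eq_empty.1 hsupp, Finset.sum_empty]
  ext m
  rw [coeff_zero]
  by_contra hne
  have hms : m ∈ H.support := mem_support_iff.2 hne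
  have hc : h.coeff (m 0 + q * m 1) = H.coeff m := by
    simp only [h, Polynomial.finsetSum_coeff, Polynomial.coeff_monomial]
    rw [Finset.sum_eq_single_of_mem m hms, if_pos rfl]
    intro m' hm' hmm
    refine if_neg fun heq => hmm ?_
    have hq : 0 < q := lt_of_le_of_lt (Nat.zero_le _) (hm m hms 0)
    have h00 : m' 0 = m 0 := by
      have := congrArg (· % q) heq
      simpa [Nat.add_mul_mod_self_left, Nat.mod_eq_of_lt (hm m hms 0),
        Nat.mod_eq_of_lt (hm m' hm' 0)] using this
    have h11 : m' 1 = m 1 := by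
      rw [h00] at heq
      exact Nat.eq_of_mul_eq_mul_left hq (Nat.add_left_cancel heq)
    ext j
    fin_cases j
    · exact h00
    · exact h11
  rw [hz, Polynomial.coeff_zero] at hc
  exact hne hc.symm

lemma degreeOf_sub_le_of_le {F : Type*} [Field F] {p₁ p₂ : MvPolynomial (Fin 2) F} {j : Fin 2}
    {n : ℕ} (h1 : p₁.degreeOf j ≤ n) (h2 : p₂.degreeOf j ≤ n) : (p₁ - p₂).degreeOf j ≤ n := by
  rw [sub_eq_add_neg]
  refine (degreeOf_add_le _ _ _).trans (max_le h1 ?_)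
  have : -p₂ = C (-1) * p₂ := by simp
  rw [this]
  exact (degreeOf_C_mul_le _ _ _).trans h2

lemma degreeOf_X_le_one {F : Type*} [Field F] (i j : Fin 2) :
    (X i : MvPolynomial (Fin 2) F).degreeOf j ≤ 1 := by
  rw [degreeOf_X]; split_ifs <;> simp

lemma degreeOf_pow_le_of_le {F : Type*} [Field F] {p : MvPolynomial (Fin 2) F} {j : Fin 2}
    (h : p.degreeOf j ≤ 1) (n : ℕ) : (p ^ n).degreeOf j ≤ n :=
  (degreeOf_pow_le _ _ _).trans (by nlinarith)

variable {K : Type*} [Field K] [Fintype K]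

/-- An element of a quadratic extension outside `K` has trace `T` and norm `N` in `K`, with
nonsquare `T² - 4N`. -/
lemma exists_trace_norm {F : Type*} [Field F] [Fintype F] (φ : K →+* F)
    (hF : Fintype.card F = Fintype.card K ^ 2) (h2 : (2 : K) ≠ 0) {x : F}
    (hx : ∀ a, φ a ≠ x) :
    ∃ N T : K, φ N = x * x ^ Fintype.card K ∧ φ T = x + x ^ Fintype.card K ∧
      ¬IsSquare (T ^ 2 - 4 * N) := by
  set q := Fintype.card K with hq
  have hxq : (x ^ q) ^ q = x := by
    rw [← pow_mul, ← pow_two, ← hF, FiniteField.pow_card]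
  obtain ⟨p, hpc⟩ := CharP.exists K
  obtain ⟨n, hp, hn⟩ := FiniteField.card K p
  have : Fact p.Prime := ⟨hp⟩
  have : CharP F p := charP_of_injective_ringHom φ.injective p
  obtain ⟨N, hN⟩ := exists_map_eq_of_pow_card_eq φ (x := x * x ^ q) (by
    rw [← hq, mul_pow, hxq, mul_comm])
  obtain ⟨T, hT⟩ := exists_map_eq_of_pow_card_eq φ (x := x + x ^ q) (by
    rw [← hq, hq, hn, add_pow_char_pow, ← hn, ← hq, hxq, add_comm])
  refine ⟨N, T, hN, hT, ?_⟩
  rintro ⟨s, hs⟩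
  have h1 : (φ s - (x - x ^ q)) * (φ s + (x - x ^ q)) = 0 := by
    have := congrArg φ hs
    simp only [map_sub, map_mul, map_pow, hN, hT, map_ofNat] at this
    linear_combination -this
  have h2' : φ 2 ≠ 0 := fun h => h2 ((map_eq_zero φ).1 h)
  rcases mul_eq_zero.1 h1 with h | h
  · refine hx ((T + s) / 2) ?_
    rw [map_div₀, map_add, hT, div_eq_iff h2', map_ofNat]
    linear_combination h
  · refine hx ((T - s) / 2) ?_
    rw [map_div₀, map_sub, hT, div_eq_iff h2', map_ofNat]
    linear_combination -h

end

/-! ### Lines of the partition through a pole -/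

section

open MvPolynomial

variable {K : Type*} [Field K]

/-- A pair of conjugate points of the conic over the quadratic extension, with norm `N` and
trace `T` in the coordinates `p₀, p₁`, stands for an internal point. -/
lemma existsUnique_of_trace_norm {ι : Type*} {e : ι → Fin 3 → K} (hp : IsInternalPartition e)
    {p₀ p₁ : K × K} (h : wedge p₀ p₁ ≠ 0) {N T : K} (hns : ¬IsSquare (T ^ 2 - 4 * N)) :
    ∃! i, 2 * N * ev (e i) p₀ + T * pol (e i) p₀ p₁ + 2 * ev (e i) p₁ = 0 := by
  let g : Fin 3 → K := ![2 * N * p₀.1 ^ 2 + T * (2 * (p₀.1 * p₁.1)) + 2 * p₁.1 ^ 2,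
    2 * N * (p₀.1 * p₀.2) + T * (p₀.1 * p₁.2 + p₀.2 * p₁.1) + 2 * (p₁.1 * p₁.2),
    2 * N * p₀.2 ^ 2 + T * (2 * (p₀.2 * p₁.2)) + 2 * p₁.2 ^ 2]
  have hg : qform g = (T ^ 2 - 4 * N) * wedge p₀ p₁ ^ 2 := by
    simp only [g, qform, wedge, Matrix.cons_val_zero, Matrix.cons_val_one, Matrix.cons_val]
    ring
  have hdot : ∀ i, e i ⬝ᵥ g
      = 2 * N * ev (e i) p₀ + T * pol (e i) p₀ p₁ + 2 * ev (e i) p₁ := by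
    intro i
    simp only [g, dotProduct, Fin.sum_univ_three, ev, pol, Matrix.cons_val_zero,
      Matrix.cons_val_one, Matrix.cons_val]
    ring
  have hsq : ¬IsSquare (qform g) := by
    rintro ⟨s, hs⟩
    refine hns ⟨s / wedge p₀ p₁, ?_⟩
    rw [hg] at hs
    field_simp
    rw [pow_two s, ← hs]
  have := hp.existsUnique g hsq
  simpa only [hdot] using this

variable [Fintype K] [DecidableEq K] {ι : Type*} [Fintype ι] {e : ι → Fin 3 → K}

/-- The power sum with exponent `q - 1` counts the nonzero values, modulo the characteristic. -/
lemma sum_pow_card_sub_one {F : Type*} [Field F] (φ : K →+* F) (g : ι → K) :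
    ∑ i, φ (g i) ^ (Fintype.card K - 1)
      = (Fintype.card ι : F) - ((Finset.univ.filter fun i => g i = 0).card : F) := by
  have h : ∀ i, φ (g i) ^ (Fintype.card K - 1) = 1 - if g i = 0 then 1 else 0 := by
    intro i
    have h1 : 1 < Fintype.card K := Fintype.one_lt_card
    split_ifs with h
    · rw [h, map_zero, zero_pow (by omega), sub_self]
    · rw [← map_pow, FiniteField.pow_card_sub_one_eq_one _ h, map_one, sub_zero]
  simp only [h]
  rw [Finset.sum_sub_distrib, Finset.sum_const, Finset.card_univ, Finset.sum_boole, nsmul_eq_mul,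
    mul_one]

/-- The number of lines of the partition through the pole of the secant `uv` is congruent to
`d_u + d_v - 1` modulo the characteristic, where `d_u` is the number of lines through `u`. The
pole is a point of the plane, but the congruence comes from the conjugate points over the
quadratic extension `F`: the polynomial `Z` below vanishes at all `(x, x ^ q)`. -/
theorem card_star_add_card_star (h4 : Fintype.card K % 4 = 1) (hp : IsInternalPartition e)
    (hc : Fintype.card ι = Fintype.card K) {u v : Option K} (huv : u ≠ v) :
    ((Finset.univ.filter fun i => pol (e i) (vec u) (vec v) = 0).card : K) + 1
      = (star e u).card + (star e v).card := by
  classical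
  set q := Fintype.card K with hq
  have hq1 : 1 < q := Fintype.one_lt_card
  have h2 : (2 : K) ≠ 0 := two_ne_zero_of_card h4
  obtain ⟨p, hpc⟩ := CharP.exists K
  obtain ⟨n, hpp, hn⟩ := FiniteField.card K p
  have : Fact p.Prime := ⟨hpp⟩
  let F := FiniteField.Extension K p 2
  have : Fintype F := Fintype.ofFinite F
  have hF : Fintype.card F = q ^ 2 := by
    rw [← Nat.card_eq_fintype_card, FiniteField.natCard_extension, Nat.card_eq_fintype_card]
  let φ : K →+* F := algebraMap K F
  have hKq : (q : F) = 0 := by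
    have := congrArg φ (FiniteField.cast_card_eq_zero K)
    rwa [map_natCast, map_zero] at this
  -- coordinates in which `u` and `v` are the affine points `0` and `-1`
  obtain ⟨p₀, hp₀⟩ : ∃ p₀, p₀ = vec u + vec v := ⟨_, rfl⟩
  obtain ⟨p₁, hp₁⟩ : ∃ p₁, p₁ = vec u := ⟨_, rfl⟩
  have hw : wedge p₀ p₁ ≠ 0 := by
    have : wedge p₀ p₁ = wedge (vec v) (vec u) := by
      simp only [hp₀, hp₁, wedge, Prod.fst_add, Prod.snd_add]; ring
    rw [this]
    exact fun h => huv (wedge_vec_eq_zero.1 h).symm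
  let d : K → ℕ := fun s =>
    (Finset.univ.filter fun i => 2 * ev (e i) (s • p₀ + (1 : K) • p₁) = 0).card
  let B : ι → MvPolynomial (Fin 2) F := fun i =>
    C (φ (2 * ev (e i) p₀)) * (X 0 * X 1) + C (φ (pol (e i) p₀ p₁)) * (X 0 + X 1)
      + C (φ (2 * ev (e i) p₁))
  let Z : MvPolynomial (Fin 2) F := ∑ i, B i ^ (q - 1) - (X 0 - X 1) ^ (q - 1)
    - ∑ s : K, C (-(d s : F)) *
      (1 - (X 0 - C (φ s)) ^ (q - 1) * (X 1 - C (φ s)) ^ (q - 1))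
  have hevB : ∀ i (x y : F), eval ![x, y] (B i) = φ (2 * ev (e i) p₀) * (x * y)
      + φ (pol (e i) p₀ p₁) * (x + y) + φ (2 * ev (e i) p₁) := by
    intro i x y
    simp [B]
  have hevZ : ∀ x y : F, eval ![x, y] Z = ∑ i, eval ![x, y] (B i) ^ (q - 1) - (x - y) ^ (q - 1)
      - ∑ s : K, (-(d s : F)) * (1 - (x - φ s) ^ (q - 1) * (y - φ s) ^ (q - 1)) := by
    intro x y
    simp only [Z, map_sub, map_sum, map_mul, map_pow, eval_X, eval_C, map_one,
      Matrix.cons_val_zero, Matrix.cons_val_one]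
  have hXC : ∀ (i j : Fin 2) (a : F), (X i - C a : MvPolynomial (Fin 2) F).degreeOf j ≤ 1 :=
    fun i j a => degreeOf_sub_le_of_le (degreeOf_X_le_one i j) (by rw [degreeOf_C]; omega)
  have hX01 : ∀ j, (X 0 * X 1 : MvPolynomial (Fin 2) F).degreeOf j ≤ 1 := by
    intro j
    refine (degreeOf_mul_le _ _ _).trans ?_
    rw [degreeOf_X, degreeOf_X]
    fin_cases j <;> simp
  have hdegB : ∀ i j, (B i).degreeOf j ≤ 1 := by
    intro i j
    refine (degreeOf_add_le _ _ _).trans (max_le ((degreeOf_add_le _ _ _).trans (max_le ?_ ?_)) ?_)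
    · exact (degreeOf_C_mul_le _ _ _).trans (hX01 j)
    · exact (degreeOf_C_mul_le _ _ _).trans ((degreeOf_add_le _ _ _).trans
        (max_le (degreeOf_X_le_one _ _) (degreeOf_X_le_one _ _)))
    · rw [degreeOf_C]; omega
  have hprod : ∀ (s : K) j, ((X 0 - C (φ s)) ^ (q - 1) * (X 1 - C (φ s)) ^ (q - 1) :
      MvPolynomial (Fin 2) F).degreeOf j ≤ q - 1 := by
    intro s j
    have h0 : ∀ i : Fin 2, i ≠ j → (X i - C (φ s) : MvPolynomial (Fin 2) F).degreeOf j ≤ 0 :=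
      fun i hij => degreeOf_sub_le_of_le (by rw [degreeOf_X_of_ne hij.symm])
        (by rw [degreeOf_C])
    refine (degreeOf_mul_le _ _ _).trans ?_
    have h1 := fun i => degreeOf_pow_le j (X i - C (φ s) : MvPolynomial (Fin 2) F) (q - 1)
    have h3 := degreeOf_pow_le_of_le (hXC 0 j (φ s)) (q - 1)
    have h5 := degreeOf_pow_le_of_le (hXC 1 j (φ s)) (q - 1)
    fin_cases j
    · have h6 := h1 1
      rw [Nat.le_zero.1 (h0 1 (by decide)), mul_zero] at h6
      exact (Nat.add_le_add h3 h6).trans (by omega)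
    · have h6 := h1 0
      rw [Nat.le_zero.1 (h0 0 (by decide)), mul_zero] at h6
      exact (Nat.add_le_add h6 h5).trans (by omega)
  have hdeg : ∀ j, Z.degreeOf j < q := by
    intro j
    refine lt_of_le_of_lt (b := q - 1) ?_ (by omega)
    refine degreeOf_sub_le_of_le (degreeOf_sub_le_of_le ?_ ?_) ?_
    · exact (degreeOf_sum_le _ _ _).trans
        (Finset.sup_le fun i _ => degreeOf_pow_le_of_le (hdegB i j) _)
    · exact degreeOf_pow_le_of_le
        (degreeOf_sub_le_of_le (degreeOf_X_le_one _ _) (degreeOf_X_le_one _ _)) _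
    · refine (degreeOf_sum_le _ _ _).trans (Finset.sup_le fun s _ => ?_)
      refine (degreeOf_C_mul_le _ _ _).trans (degreeOf_sub_le_of_le ?_ (hprod s j))
      rw [degreeOf_one]; omega
  have hvan : ∀ x : F, eval ![x, x ^ q] Z = 0 := by
    intro x
    rw [hevZ]
    by_cases hx : ∃ a, φ a = x
    · obtain ⟨a, rfl⟩ := hx
      have haq : φ a ^ q = φ a := by rw [← map_pow, FiniteField.pow_card]
      have hB : ∀ i, eval ![φ a, φ a ^ q] (B i) = φ (2 * ev (e i) (a • p₀ + (1 : K) • p₁)) := by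
        intro i
        rw [hevB, haq, ev_comb]
        simp only [map_add, map_mul, map_pow, map_ofNat, map_one]
        ring
      have hs : ∀ s : K, (-(d s : F)) * (1 - (φ a - φ s) ^ (q - 1) * (φ a ^ q - φ s) ^ (q - 1))
          = if s = a then -(d s : F) else 0 := by
        intro s
        rw [haq, ← map_sub, ← map_pow]
        split_ifs with h
        · rw [h, sub_self, zero_pow (by omega), map_zero]; ring
        · rw [FiniteField.pow_card_sub_one_eq_one _ (sub_ne_zero.2 (Ne.symm h)), map_one]; ring
      simp only [hB, hs]
      rw [sum_pow_card_sub_one, Finset.sum_ite_eq' Finset.univ a, if_pos (Finset.mem_univ _), haq,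
        sub_self, zero_pow (by omega), hc, hKq]
      simp only [d]
      ring
    · push Not at hx
      obtain ⟨N, T, hN, hT, hns⟩ := exists_trace_norm φ hF h2 hx
      rw [← hq] at hN hT
      have hB : ∀ i, eval ![x, x ^ q] (B i)
          = φ (2 * N * ev (e i) p₀ + T * pol (e i) p₀ p₁ + 2 * ev (e i) p₁) := by
        intro i
        rw [hevB, ← hN, ← hT]
        simp only [map_add, map_mul, map_ofNat]
        ring
      have hone : (Finset.univ.filter fun i =>
          2 * N * ev (e i) p₀ + T * pol (e i) p₀ p₁ + 2 * ev (e i) p₁ = 0).card = 1 := by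
        obtain ⟨i, hi, hiu⟩ := existsUnique_of_trace_norm hp hw hns
        rw [Finset.card_eq_one]
        refine ⟨i, ?_⟩
        ext j
        rw [Finset.mem_filter, Finset.mem_singleton]
        exact ⟨fun h => hiu j h.2, fun h => h ▸ ⟨Finset.mem_univ _, hi⟩⟩
      have hxq : (x ^ q) ^ q = x := by
        rw [← pow_mul, ← pow_two, ← hF, FiniteField.pow_card]
      have : CharP F p := charP_of_injective_ringHom φ.injective p
      have hfrob : ∀ a b : F, (a - b) ^ q = a ^ q - b ^ q := by
        intro a b
        rw [hq, hn, sub_pow_char_pow]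
      have hxx : x - x ^ q ≠ 0 := by
        intro h
        obtain ⟨a, ha⟩ := exists_map_eq_of_pow_card_eq φ (x := x) (sub_eq_zero.1 h).symm
        exact hx a ha
      have hneg : (x - x ^ q) ^ (q - 1) = -1 := by
        have : (x - x ^ q) ^ (q - 1) * (x - x ^ q) = -1 * (x - x ^ q) := by
          rw [← pow_succ, Nat.sub_add_cancel hq1.le, hfrob, hxq]; ring
        exact mul_right_cancel₀ hxx this
      have hs : ∀ s : K, (-(d s : F)) * (1 - (x - φ s) ^ (q - 1) * (x ^ q - φ s) ^ (q - 1))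
          = 0 := by
        intro s
        have h1 : x ^ q - φ s = (x - φ s) ^ q := by
          rw [hfrob, ← map_pow, FiniteField.pow_card]
        have h3 : q - 1 + q * (q - 1) = Fintype.card F - 1 := by
          rw [hF]
          obtain ⟨k, hk⟩ : ∃ k, q = k + 1 := ⟨q - 1, by omega⟩
          rw [hk]
          simp only [Nat.add_sub_cancel]
          have : (k + 1) ^ 2 = k + (k + 1) * k + 1 := by ring
          omega
        rw [h1, ← pow_mul, ← pow_add, h3, FiniteField.pow_card_sub_one_eq_one _
          (sub_ne_zero.2 (Ne.symm (hx s))), sub_self, mul_zero]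
      simp only [hB, hs]
      rw [sum_pow_card_sub_one, hone, hneg, hc, hKq]
      simp
  -- The value of `Z = 0` at the point that stands for the pair `u, v` is the congruence.
  have hZ := eq_zero_of_eval_pow_eq_zero hF Z hdeg hvan
  have hfin := hevZ (φ 0) (φ (-1))
  rw [hZ, map_zero] at hfin
  have hB : ∀ i, eval ![φ 0, φ (-1)] (B i) = φ (-pol (e i) (vec u) (vec v)) := by
    intro i
    rw [hevB]
    have : pol (e i) p₀ p₁ = 2 * ev (e i) p₁ + pol (e i) (vec u) (vec v) := by
      simp only [pol, ev, hp₀, hp₁, Prod.fst_add, Prod.snd_add]; ring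
    rw [this]
    simp only [map_add, map_mul, map_ofNat, map_neg, map_zero, map_one]
    ring
  have hs : ∀ s : K, (-(d s : F)) * (1 - (φ 0 - φ s) ^ (q - 1) * (φ (-1) - φ s) ^ (q - 1))
      = (if s = 0 then -(d s : F) else 0) + if s = -1 then -(d s : F) else 0 := by
    intro s
    rw [← map_sub, ← map_sub, ← map_pow, ← map_pow]
    have h10 : (-1 : K) ≠ 0 := neg_ne_zero.2 one_ne_zero
    by_cases h : s = 0
    · rw [if_pos h, if_neg (by rw [h]; exact h10.symm), h, sub_self, zero_pow (by omega), map_zero]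
      ring
    · by_cases h' : s = -1
      · rw [if_neg h, if_pos h', h', sub_self, zero_pow (by omega), map_zero]
        ring
      · rw [if_neg h, if_neg h', FiniteField.pow_card_sub_one_eq_one _ (sub_ne_zero.2 (Ne.symm h)),
          FiniteField.pow_card_sub_one_eq_one _ (sub_ne_zero.2 (Ne.symm h')), map_one]
        ring
  have hd0 : d 0 = (star e u).card := by
    simp only [d, star]
    congr 1
    ext i
    simp [hp₁, h2]
  have hd1 : d (-1) = (star e v).card := by
    simp only [d, star]
    congr 1
    ext i
    have : (-1 : K) • p₀ + (1 : K) • p₁ = (-1 : K) • vec v := by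
      simp only [hp₀, hp₁]
      module
    simp only [Finset.mem_filter, Finset.mem_univ, true_and]
    rw [this, ev_smul]
    simp [h2]
  simp only [hB, hs] at hfin
  rw [sum_pow_card_sub_one, Finset.sum_add_distrib, Finset.sum_ite_eq' Finset.univ (0 : K),
    Finset.sum_ite_eq' Finset.univ (-1 : K), if_pos (Finset.mem_univ _),
    if_pos (Finset.mem_univ _), hd0, hd1, ← map_sub, ← map_pow,
    FiniteField.pow_card_sub_one_eq_one _ (by simp), hc, hKq, map_one] at hfin
  simp only [neg_eq_zero] at hfin
  apply φ.injective
  simp only [map_add, map_natCast, map_one]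
  linear_combination hfin

end

/-! ### Harmonic closure -/

section

section

variable {K : Type*} [Field K]

open Classical in
/-- The point of the projective line `K ∪ {∞}` with the given coordinate vector. The zero vector
goes to `∞`. -/
noncomputable def pt (v : K × K) : Option K := if v.2 = 0 then none else some (v.1 / v.2)

lemma pt_vec (u : Option K) : pt (vec u) = u := by
  cases u <;> simp [pt]

lemma pt_smul {c : K} (hc : c ≠ 0) (v : K × K) : pt (c • v) = pt v := by
  unfold pt
  by_cases h : v.2 = 0
  · simp [h]
  · simp [h, hc, mul_div_mul_left]

lemma exists_vec_pt {v : K × K} (hv : v ≠ 0) : ∃ c : K, c ≠ 0 ∧ v = c • vec (pt v) := by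
  obtain ⟨u, c, hc, h⟩ := exists_vec hv
  refine ⟨c, hc, ?_⟩
  rw [h, pt_smul hc, pt_vec]

lemma pt_eq_pt_iff {v w : K × K} (hv : v ≠ 0) (hw : w ≠ 0) : pt v = pt w ↔ wedge v w = 0 := by
  obtain ⟨c, hc, h⟩ := exists_vec_pt hv
  obtain ⟨d, hd, h'⟩ := exists_vec_pt hw
  conv_rhs => rw [h, h', wedge_smul_left, wedge_smul_right]
  rw [mul_eq_zero, mul_eq_zero, wedge_vec_eq_zero]
  simp [hc, hd]

lemma ev_pt_eq_zero_iff (f : Fin 3 → K) {v : K × K} (hv : v ≠ 0) :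
    ev f (vec (pt v)) = 0 ↔ ev f v = 0 := by
  obtain ⟨c, hc, h⟩ := exists_vec_pt hv
  conv_rhs => rw [h, ev_smul]
  simp [hc]

lemma comb_ne_zero {p p' : K × K} (h : wedge p p' ≠ 0) {a b : K} (hab : a ≠ 0 ∨ b ≠ 0) :
    a • p + b • p' ≠ 0 := by
  intro h0
  have h1 : wedge p (a • p + b • p') = b * wedge p p' := by
    simp only [wedge, Prod.smul_fst, Prod.smul_snd, smul_eq_mul, Prod.fst_add, Prod.snd_add]; ring
  have h2 : wedge (a • p + b • p') p' = a * wedge p p' := by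
    simp only [wedge, Prod.smul_fst, Prod.smul_snd, smul_eq_mul, Prod.fst_add, Prod.snd_add]; ring
  have h3 : b * wedge p p' = 0 := by rw [← h1, h0]; simp [wedge]
  have h4 : a * wedge p p' = 0 := by rw [← h2, h0]; simp [wedge]
  rw [mul_eq_zero] at h3 h4
  exact hab.elim (fun ha => ha (h4.resolve_right h)) (fun hb => hb (h3.resolve_right h))

lemma wedge_comb (a b c d : K) (p p' : K × K) :
    wedge (a • p + b • p') (c • p + d • p') = (a * d - b * c) * wedge p p' := by
  simp only [wedge, Prod.smul_fst, Prod.smul_snd, smul_eq_mul, Prod.fst_add, Prod.snd_add]; ring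

lemma pt_comb_eq_iff {p p' : K × K} (h : wedge p p' ≠ 0) {a b c d : K} (hab : a ≠ 0 ∨ b ≠ 0)
    (hcd : c ≠ 0 ∨ d ≠ 0) :
    pt (a • p + b • p') = pt (c • p + d • p') ↔ a * d = b * c := by
  rw [pt_eq_pt_iff (comb_ne_zero h hab) (comb_ne_zero h hcd), wedge_comb, mul_eq_zero,
    or_iff_left h, sub_eq_zero]

lemma exists_comb {p p' : K × K} (h : wedge p p' ≠ 0) (v : K × K) :
    ∃ a b : K, v = a • p + b • p' := by
  refine ⟨wedge v p' / wedge p p', wedge p v / wedge p p', ?_⟩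
  ext
  · simp only [Prod.fst_add, Prod.smul_fst, smul_eq_mul]
    field_simp
    simp only [wedge]; ring
  · simp only [Prod.snd_add, Prod.smul_snd, smul_eq_mul]
    field_simp
    simp only [wedge]; ring

end

variable {K : Type*} [Field K] [Fintype K] [DecidableEq K] {ι : Type*} [Fintype ι]
  {e : ι → Fin 3 → K} {S : Finset (Option K)} {r : ℕ}

/-- The pole of the secant through two points outside `S` lies on a line of the partition. -/
lemma exists_pol_eq_zero (h4 : Fintype.card K % 4 = 1) (hp : IsInternalPartition e)
    (hc : Fintype.card ι = Fintype.card K) (hM : IsCliqueWithMatching e S r) {u v : Option K}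
    (huv : u ≠ v) (hu : u ∉ S) (hv : v ∉ S) : ∃ i, pol (e i) (vec u) (vec v) = 0 := by
  by_contra! h
  have h1 := card_star_add_card_star h4 hp hc huv
  rw [hM.card_star u hu, hM.card_star v hv, Finset.filter_false_of_mem (fun i _ => h i)] at h1
  simp at h1

/-- On the secant through `u ∈ S` and `u' ∉ S` there is no pole of a secant joining two points
of `S`. The pole of the secant through `u + κ u'` and `u - κ u'` is the point `u - κ² u'` of `uu'`.
If neither of the two points is in `S`, then a line of the partition passes through the pole; there
are `(q - 1) / 2 - r` lines available for this, and a pair `±κ` with both points in `S` would leave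
more poles than lines. -/
lemma not_harmonic (h4 : Fintype.card K % 4 = 1) (hp : IsInternalPartition e)
    (hc : Fintype.card ι = Fintype.card K) (hM : IsCliqueWithMatching e S r) {u u' : Option K}
    (hu : u ∈ S) (hu' : u' ∉ S) {κ : K} (hκ : κ ≠ 0)
    (h1 : pt ((1 : K) • vec u + κ • vec u') ∈ S) (h2 : pt ((1 : K) • vec u + (-κ) • vec u') ∈ S) :
    False := by
  classical
  have huu : u ≠ u' := by rintro rfl; exact hu' hu
  have hw : wedge (vec u) (vec u') ≠ 0 := fun h => huu (wedge_vec_eq_zero.1 h)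
  have htwo := two_ne_zero_of_card h4
  have hnadj : ¬Adj e u u' := fun h => hu' (hM.component.closed u hu u' h)
  let a : K → Option K := fun κ => pt ((1 : K) • vec u + κ • vec u')
  have ha : ∀ κ, a κ = pt ((1 : K) • vec u + κ • vec u') := fun _ => rfl
  have hinj : Function.Injective a := by
    intro κ κ' h
    rw [ha, ha, pt_comb_eq_iff hw (Or.inl one_ne_zero) (Or.inl one_ne_zero)] at h
    linear_combination -h
  let Z : Finset K := Finset.univ.filter fun κ => κ ≠ 0 ∧ a κ ∈ S
  let Z' : Finset K := Finset.univ.filter fun κ => κ ≠ 0 ∧ a (-κ) ∈ S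
  let W : Finset K := Finset.univ.filter fun κ => κ ≠ 0 ∧ a κ ∉ S ∧ a (-κ) ∉ S
  have hZ : Z.card = r := by
    have : Z.card = (S.erase u).card := by
      refine Finset.card_bij (fun κ _ => a κ) ?_ (fun κ _ κ' _ h => hinj h) ?_
      · intro κ hκ
        obtain ⟨-, h0, hS⟩ := Finset.mem_filter.1 hκ
        refine Finset.mem_erase.2 ⟨fun h => h0 ?_, hS⟩
        have h' : a 0 = u := by
          rw [ha, one_smul, zero_smul, add_zero, pt_vec]
        exact hinj (h.trans h'.symm)
      · intro s hs
        obtain ⟨hsu, hs⟩ := Finset.mem_erase.1 hs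
        obtain ⟨x, y, hxy⟩ := exists_comb hw (vec s)
        have hx : x ≠ 0 := by
          rintro rfl
          rw [zero_smul, zero_add] at hxy
          have hy : y ≠ 0 := by
            rintro rfl
            rw [zero_smul] at hxy
            exact vec_ne_zero s hxy
          have : s = u' := by rw [← pt_vec s, hxy, pt_smul hy, pt_vec]
          exact hu' (this ▸ hs)
        have has : a (y / x) = s := by
          rw [ha, ← pt_smul hx, ← pt_vec s, hxy, smul_add, smul_smul, smul_smul, mul_one,
            mul_div_cancel₀ _ hx]
        refine ⟨y / x, Finset.mem_filter.2 ⟨Finset.mem_univ _, ?_, has ▸ hs⟩, has⟩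
        intro h
        rw [h, ha, one_smul, zero_smul, add_zero, pt_vec] at has
        exact hsu has.symm
    rw [this, Finset.card_erase_of_mem hu, hM.card_eq, Nat.add_sub_cancel]
  have hZ' : Z'.card = r := by
    rw [← hZ]
    refine Finset.card_nbij' (fun κ => -κ) (fun κ => -κ) ?_ ?_ ?_ ?_
    · intro κ hκ
      simpa [Z, Z'] using hκ
    · intro κ hκ
      simpa [Z, Z'] using hκ
    · intro κ _; simp
    · intro κ _; simp
  have hZZ : (Z ∪ Z').card + 1 ≤ 2 * r := by
    have h3 := Finset.card_union_add_card_inter Z Z'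
    have h5 : 0 < (Z ∩ Z').card := Finset.card_pos.2 ⟨κ, Finset.mem_inter.2
      ⟨Finset.mem_filter.2 ⟨Finset.mem_univ _, hκ, h1⟩,
        Finset.mem_filter.2 ⟨Finset.mem_univ _, hκ, h2⟩⟩⟩
    omega
  have hcover : Fintype.card K ≤ W.card + (Z ∪ Z').card + 1 := by
    have hsub : (Finset.univ : Finset K) ⊆ W ∪ (Z ∪ Z') ∪ {0} := by
      intro x _
      simp only [W, Z, Z', Finset.mem_union, Finset.mem_filter, Finset.mem_univ, true_and,
        Finset.mem_singleton]
      tauto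
    have h3 := (Finset.card_le_card hsub).trans ((Finset.card_union_le _ _).trans
      (Nat.add_le_add_right (Finset.card_union_le _ _) _))
    rwa [Finset.card_univ, Finset.card_singleton] at h3
  -- the lines of the partition through an external point of the secant `uu'`
  let G : Finset ι := (opp e u u' ∪ (star e u ∪ star e u'))ᶜ
  have hG : 2 * G.card + 2 * r + 1 = Fintype.card K := by
    have h3 : Disjoint (star e u) (star e u') := by
      rw [Finset.disjoint_left]
      intro i hi hi'
      exact hnadj ⟨huu, i, mem_star.1 hi, mem_star.1 hi'⟩
    have h5 : Disjoint (opp e u u') (star e u ∪ star e u') := by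
      rw [Finset.disjoint_left]
      intro i hi hi'
      have := ne_zero_of_mem_opp hi
      rw [Finset.mem_union, mem_star, mem_star] at hi'
      tauto
    have h6 := Finset.card_add_card_compl (opp e u u' ∪ (star e u ∪ star e u'))
    rw [Finset.card_union_of_disjoint h5, Finset.card_union_of_disjoint h3,
      hM.card_star_of_mem u hu, hM.card_star u' hu', hc] at h6
    have h7 := card_opp h4 hp huu hnadj
    have h8 : G.card = (opp e u u' ∪ (star e u ∪ star e u'))ᶜ.card := rfl
    omega
  have key : ∀ κ ∈ W, ∃ i, ev (e i) (vec u) = κ ^ 2 * ev (e i) (vec u') := by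
    intro κ hκ
    obtain ⟨-, h0, hS1, hS2⟩ := Finset.mem_filter.1 hκ
    have hne : a κ ≠ a (-κ) := by
      intro h
      have := hinj h
      have h3 : 2 * κ = 0 := by linear_combination this
      exact (mul_ne_zero htwo h0) h3
    obtain ⟨i, hi⟩ := exists_pol_eq_zero h4 hp hc hM hne hS1 hS2
    obtain ⟨c, hc0, hc⟩ := exists_vec_pt (comb_ne_zero hw (a := 1) (b := κ) (Or.inl one_ne_zero))
    obtain ⟨d, hd0, hd⟩ := exists_vec_pt (comb_ne_zero hw (a := 1) (b := -κ) (Or.inl one_ne_zero))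
    have h3 : pol (e i) ((1 : K) • vec u + κ • vec u') ((1 : K) • vec u + (-κ) • vec u') = 0 := by
      rw [hc, hd, pol_smul, ← ha, ← ha, hi, mul_zero]
    refine ⟨i, mul_left_cancel₀ htwo ?_⟩
    rw [← sub_eq_zero, ← h3]
    simp only [pol, ev, Prod.smul_fst, Prod.smul_snd, smul_eq_mul, Prod.fst_add, Prod.snd_add]
    ring
  have : Nonempty ι := by
    rw [← Fintype.card_pos_iff, hc]; exact Fintype.card_pos
  choose! F hF using key
  have hF0 : ∀ κ ∈ W, ev (e (F κ)) (vec u) ≠ 0 ∧ ev (e (F κ)) (vec u') ≠ 0 := by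
    intro κ hκ
    have h0 : κ ≠ 0 := (Finset.mem_filter.1 hκ).2.1
    have h3 := hF κ hκ
    have h5 : ev (e (F κ)) (vec u') ≠ 0 := by
      intro h
      rw [h, mul_zero] at h3
      exact hnadj ⟨huu, _, h3, h⟩
    exact ⟨by rw [h3]; exact mul_ne_zero (pow_ne_zero _ h0) h5, h5⟩
  have himg : W.image F ⊆ G := by
    intro i hi
    obtain ⟨κ, hκ, rfl⟩ := Finset.mem_image.1 hi
    have h0 : κ ≠ 0 := (Finset.mem_filter.1 hκ).2.1
    obtain ⟨h3, h5⟩ := hF0 κ hκ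
    rw [Finset.mem_compl, Finset.mem_union, Finset.mem_union, mem_star, mem_star, not_or, not_or]
    refine ⟨fun h => ?_, h3, h5⟩
    rw [mem_opp, hF κ hκ, mul_assoc, quadraticChar_sq_mul h0, ← pow_two,
      quadraticChar_sq_one' h5] at h
    simp at h
  have hfib : ∀ i ∈ W.image F, (W.filter fun κ => F κ = i).card ≤ 2 := by
    intro i hi
    obtain ⟨κ₀, hκ₀, rfl⟩ := Finset.mem_image.1 hi
    refine (Finset.card_le_card (t := {κ₀, -κ₀}) ?_).trans Finset.card_le_two
    intro κ hκ
    obtain ⟨hκ, hFκ⟩ := Finset.mem_filter.1 hκ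
    have h3 := hF κ hκ
    rw [hFκ, hF κ₀ hκ₀] at h3
    have h5 := mul_right_cancel₀ (hF0 κ₀ hκ₀).2 h3
    rw [Finset.mem_insert, Finset.mem_singleton]
    exact sq_eq_sq_iff_eq_or_eq_neg.1 h5.symm
  have hWle := Finset.card_le_mul_card_image W 2 hfib
  have := Finset.card_le_card himg
  omega

/-- `S` is closed under harmonic conjugation. -/
theorem pt_harmonic_mem (h4 : Fintype.card K % 4 = 1) (hp : IsInternalPartition e)
    (hc : Fintype.card ι = Fintype.card K) (hM : IsCliqueWithMatching e S r) {p p' : K × K}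
    (hw : wedge p p' ≠ 0) {a b : K} (ha : a ≠ 0) (hb : b ≠ 0) (h1 : pt p ∈ S) (h2 : pt p' ∈ S)
    (h3 : pt (a • p + b • p') ∈ S) : pt (a • p + (-b) • p') ∈ S := by
  by_contra hn
  have htwo := two_ne_zero_of_card h4
  obtain ⟨c, hc0, hcv⟩ := exists_vec_pt (comb_ne_zero hw (a := a) (b := b) (Or.inl ha))
  obtain ⟨d, hd0, hdv⟩ := exists_vec_pt (comb_ne_zero hw (a := a) (b := -b) (Or.inl ha))
  set u := pt (a • p + b • p')
  set u' := pt (a • p + (-b) • p')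
  have hcu : vec u = c⁻¹ • (a • p + b • p') := by rw [hcv, smul_smul, inv_mul_cancel₀ hc0, one_smul]
  have hdu : vec u' = d⁻¹ • (a • p + (-b) • p') := by
    rw [hdv, smul_smul, inv_mul_cancel₀ hd0, one_smul]
  refine not_harmonic h4 hp hc hM h3 hn (κ := c⁻¹ * d) (mul_ne_zero (inv_ne_zero hc0) hd0) ?_ ?_
  · have : (1 : K) • vec u + (c⁻¹ * d) • vec u' = (2 * c⁻¹ * a) • p := by
      rw [hcu, hdu, smul_smul (c⁻¹ * d), mul_assoc c⁻¹ d, mul_inv_cancel₀ hd0]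
      module
    rw [this, pt_smul (mul_ne_zero (mul_ne_zero htwo (inv_ne_zero hc0)) ha)]
    exact h1
  · have : (1 : K) • vec u + (-(c⁻¹ * d)) • vec u' = (2 * c⁻¹ * b) • p' := by
      rw [hcu, hdu, smul_smul (-(c⁻¹ * d)), neg_mul, mul_assoc c⁻¹ d, mul_inv_cancel₀ hd0]
      module
    rw [this, pt_smul (mul_ne_zero (mul_ne_zero htwo (inv_ne_zero hc0)) hb)]
    exact h2

end

/-! ### The subfield -/

section

section

variable {K : Type*} [Field K] {p p' : K × K}

lemma pt_affine_ne (hw : wedge p p' ≠ 0) (t : K) : pt (t • p + (1 : K) • p') ≠ pt p := by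
  intro h
  have h' : pt p = pt ((1 : K) • p + (0 : K) • p') := by rw [one_smul, zero_smul, add_zero]
  rw [h', pt_comb_eq_iff hw (Or.inr one_ne_zero) (Or.inl one_ne_zero)] at h
  simp at h

lemma eq_pt_or_exists_affine (hw : wedge p p' ≠ 0) (u : Option K) :
    u = pt p ∨ ∃ t : K, u = pt (t • p + (1 : K) • p') := by
  obtain ⟨a, b, hab⟩ := exists_comb hw (vec u)
  by_cases hb : b = 0
  · left
    rw [hb, zero_smul, add_zero] at hab
    have ha : a ≠ 0 := by
      rintro rfl
      rw [zero_smul] at hab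
      exact vec_ne_zero u hab
    rw [← pt_vec u, hab, pt_smul ha]
  · right
    refine ⟨a / b, ?_⟩
    rw [← pt_vec u, hab, ← pt_smul hb ((a / b) • p + (1 : K) • p'), smul_add, smul_smul,
      smul_smul, mul_one, mul_div_cancel₀ _ hb]

end

variable {K : Type*} [Field K] [Fintype K] {ι : Type*} [Fintype ι]
  {e : ι → Fin 3 → K} {S : Finset (Option K)} {r : ℕ}

lemma IsCliqueWithMatching.three_le (h4 : Fintype.card K % 4 = 1)
    (hM : IsCliqueWithMatching e S r) : 3 ≤ r := by
  by_contra! h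
  have h1 := hM.sq
  have hq : 1 < Fintype.card K := Fintype.one_lt_card
  interval_cases r <;> omega

variable [DecidableEq K]

/-- In suitable coordinates `S` is the subline over a subfield of order `√q`: a set of affine
coordinates that is closed under harmonic conjugation (together with `∞`) and contains `0` and `1`
is closed under midpoints, point reflections, and the inversions `t ↦ a² / t`. -/
theorem exists_subfield (h4 : Fintype.card K % 4 = 1) (hp : IsInternalPartition e)
    (hc : Fintype.card ι = Fintype.card K) (hM : IsCliqueWithMatching e S r) :
    ∃ (k : Subfield K) (p p' : K × K), wedge p p' ≠ 0 ∧ Nat.card k = r ∧ pt p ∈ S ∧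
      ∀ t : K, pt (t • p + (1 : K) • p') ∈ S ↔ t ∈ k := by
  have h2 := two_ne_zero_of_card h4
  have hr := hM.three_le h4
  obtain ⟨s₀, hs₀, s₁, hs₁, s₂, hs₂, h01, h02, h12⟩ :=
    Finset.two_lt_card.1 (show 2 < S.card by rw [hM.card_eq]; omega)
  have hw0 : wedge (vec s₀) (vec s₁) ≠ 0 := fun h => h01 (wedge_vec_eq_zero.1 h)
  obtain ⟨a, b, hab⟩ := exists_comb hw0 (vec s₂)
  have ha : a ≠ 0 := by
    rintro rfl
    refine h12 (wedge_vec_eq_zero.1 ?_)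
    rw [hab]; simp only [wedge, Prod.smul_fst, Prod.smul_snd, smul_eq_mul, Prod.fst_add,
      Prod.snd_add]; ring
  have hb : b ≠ 0 := by
    rintro rfl
    refine h02 (wedge_vec_eq_zero.1 ?_)
    rw [hab]; simp only [wedge, Prod.smul_fst, Prod.smul_snd, smul_eq_mul, Prod.fst_add,
      Prod.snd_add]; ring
  obtain ⟨p, hp0⟩ : ∃ p, p = a • vec s₀ := ⟨_, rfl⟩
  obtain ⟨p', hp1⟩ : ∃ p', p' = b • vec s₁ := ⟨_, rfl⟩
  have hw : wedge p p' ≠ 0 := by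
    rw [hp0, hp1, wedge_smul_left, wedge_smul_right]
    exact mul_ne_zero ha (mul_ne_zero hb hw0)
  have hpS : pt p ∈ S := by rw [hp0, pt_smul ha, pt_vec]; exact hs₀
  have hpS' : pt p' ∈ S := by rw [hp1, pt_smul hb, pt_vec]; exact hs₁
  have hppS : pt (p + p') ∈ S := by rw [hp0, hp1, ← hab, pt_vec]; exact hs₂
  let A : Set K := {t | pt (t • p + (1 : K) • p') ∈ S}
  have h0A : (0 : K) ∈ A := by
    change pt _ ∈ S
    rwa [zero_smul, zero_add, one_smul]
  have h1A : (1 : K) ∈ A := by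
    change pt _ ∈ S
    rwa [one_smul, one_smul]
  have hwedge : ∀ x y : K, wedge (x • p + (1 : K) • p') (y • p + (1 : K) • p')
      = (x - y) * wedge p p' := by
    intro x y; rw [wedge_comb]; ring
  have hreflect : ∀ x ∈ A, ∀ y ∈ A, 2 * x - y ∈ A := by
    intro x hx y hy
    by_cases hxy : y = x
    · rw [hxy]; convert hx using 1; ring
    have hww : wedge p (x • p + (1 : K) • p') ≠ 0 := by
      have : wedge p (x • p + (1 : K) • p') = wedge p p' := by
        simp only [wedge, Prod.smul_fst, Prod.smul_snd, smul_eq_mul, Prod.fst_add,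
          Prod.snd_add]; ring
      rwa [this]
    have h := pt_harmonic_mem h4 hp hc hM hww (sub_ne_zero.2 hxy) one_ne_zero hpS hx (by
      have : (y - x) • p + (1 : K) • (x • p + (1 : K) • p') = y • p + (1 : K) • p' := by module
      rw [this]; exact hy)
    change pt _ ∈ S
    rw [← pt_smul (neg_ne_zero.2 (one_ne_zero (α := K)))]
    convert h using 2
    module
  have hmid : ∀ x ∈ A, ∀ y ∈ A, (x + y) / 2 ∈ A := by
    intro x hx y hy
    by_cases hxy : x = y
    · rw [hxy]; convert hy using 1; field_simp; ring
    have hww : wedge (x • p + (1 : K) • p') (y • p + (1 : K) • p') ≠ 0 := by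
      rw [hwedge]; exact mul_ne_zero (sub_ne_zero.2 hxy) hw
    have h := pt_harmonic_mem h4 hp hc hM hww one_ne_zero (neg_ne_zero.2 one_ne_zero) hx hy (by
      have : (1 : K) • (x • p + (1 : K) • p') + (-1 : K) • (y • p + (1 : K) • p')
          = (x - y) • p := by module
      rw [this, pt_smul (sub_ne_zero.2 hxy)]; exact hpS)
    change pt _ ∈ S
    rw [← pt_smul h2, smul_add, smul_smul, mul_div_cancel₀ _ h2]
    convert h using 2
    module
  have hneg : ∀ x ∈ A, -x ∈ A := by
    intro x hx
    have := hreflect 0 h0A x hx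
    convert this using 1; ring
  have hadd : ∀ x ∈ A, ∀ y ∈ A, x + y ∈ A := by
    intro x hx y hy
    have := hreflect _ (hmid x hx y hy) 0 h0A
    convert this using 1
    field_simp; ring
  have hinvn : ∀ x ∈ A, ∀ y ∈ A, x ≠ 0 → y ≠ 0 → x ^ 2 / y ∈ A := by
    intro x hx y hy hx0 hy0
    by_cases hxy : x = y
    · rw [hxy, pow_two, mul_div_cancel_right₀ _ hy0]; exact hy
    by_cases hxy' : x = -y
    · rw [hxy', neg_sq, pow_two, mul_div_cancel_right₀ _ hy0]; exact hy
    have h2x : 2 * x ≠ 0 := mul_ne_zero h2 hx0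
    have hww : wedge (x • p + (1 : K) • p') ((-x) • p + (1 : K) • p') ≠ 0 := by
      rw [hwedge, sub_neg_eq_add, ← two_mul]; exact mul_ne_zero h2x hw
    have h := pt_harmonic_mem h4 hp hc hM hww (a := (x + y) / (2 * x)) (b := (x - y) / (2 * x))
      (div_ne_zero (fun h => hxy' (eq_neg_of_add_eq_zero_left h)) h2x)
      (div_ne_zero (sub_ne_zero.2 hxy) h2x) hx (hneg x hx) (by
        have : ((x + y) / (2 * x)) • (x • p + (1 : K) • p')
            + ((x - y) / (2 * x)) • ((-x) • p + (1 : K) • p') = y • p + (1 : K) • p' := by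
          match_scalars <;> field_simp <;> ring
        rw [this]; exact hy)
    change pt _ ∈ S
    rw [← pt_smul (div_ne_zero hy0 hx0)]
    convert h using 2
    match_scalars <;> field_simp <;> ring
  have hsq : ∀ x ∈ A, x ^ 2 ∈ A := by
    intro x hx
    by_cases hx0 : x = 0
    · rw [hx0, zero_pow two_ne_zero]; exact h0A
    · have := hinvn x hx 1 h1A hx0 one_ne_zero
      rwa [div_one] at this
  have hmul : ∀ x ∈ A, ∀ y ∈ A, x * y ∈ A := by
    intro x hx y hy
    have := hmid _ (hsq _ (hadd x hx y hy)) _ (hneg _ (hadd _ (hsq x hx) _ (hsq y hy)))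
    convert this using 1
    field_simp; ring
  have hinv : ∀ x ∈ A, x⁻¹ ∈ A := by
    intro x hx
    by_cases hx0 : x = 0
    · rw [hx0, inv_zero]; exact h0A
    · have := hinvn 1 h1A x hx one_ne_zero hx0
      rwa [one_pow, one_div] at this
  let k : Subfield K :=
    { carrier := A
      mul_mem' := fun {x y} hx hy => hmul x hx y hy
      one_mem' := h1A
      add_mem' := fun {x y} hx hy => hadd x hx y hy
      zero_mem' := h0A
      neg_mem' := fun {x} hx => hneg x hx
      inv_mem' := fun x hx => hinv x hx }
  refine ⟨k, p, p', hw, ?_, hpS, fun t => Iff.rfl⟩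
  have hcard : A.ncard = (S.erase (pt p) : Set (Option K)).ncard := by
    refine Set.ncard_congr (fun t _ => pt (t • p + (1 : K) • p')) ?_ ?_ ?_
    · intro t ht
      exact Finset.mem_coe.2 (Finset.mem_erase.2 ⟨pt_affine_ne hw t, ht⟩)
    · intro x y _ _ hxy
      rw [pt_comb_eq_iff hw (Or.inr one_ne_zero) (Or.inr one_ne_zero)] at hxy
      linear_combination hxy
    · intro u hu
      obtain ⟨hup, huS⟩ := Finset.mem_erase.1 (Finset.mem_coe.1 hu)
      obtain ⟨t, rfl⟩ := (eq_pt_or_exists_affine hw u).resolve_left hup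
      exact ⟨t, huS, rfl⟩
  rw [Set.ncard_coe_finset, Finset.card_erase_of_mem hpS, hM.card_eq, Nat.add_sub_cancel] at hcard
  exact hcard

end

/-! ### The matching outside the subline -/

section

section

variable {K : Type*} [Field K]

lemma ext_of_ev {f g : Fin 3 → K} (h : ∀ v, ev f v = ev g v) : f = g := by
  have h0 := h (1, 0)
  have h2 := h (0, 1)
  have h1 := h (1, 1)
  simp only [ev] at h0 h1 h2
  have h00 : f 0 = g 0 := by linear_combination h0
  have h22 : f 2 = g 2 := by linear_combination h2
  have h11 : f 1 = g 1 := by linear_combination h1 - h0 - h2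
  ext j
  fin_cases j
  · exact h00
  · exact h11
  · exact h22

lemma exists_smul_of_zeros {f g : Fin 3 → K} (hf : fdisc f ≠ 0) (hg : fdisc g ≠ 0)
    {u v : Option K} (huv : u ≠ v) (hfu : ev f (vec u) = 0) (hfv : ev f (vec v) = 0)
    (hgu : ev g (vec u) = 0) (hgv : ev g (vec v) = 0) : ∃ c : K, c ≠ 0 ∧ f = c • g := by
  have hw : wedge (vec u) (vec v) ≠ 0 := fun h => huv (wedge_vec_eq_zero.1 h)
  have hpf := pol_ne_zero hf hfu hw
  have hpg := pol_ne_zero hg hgu hw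
  refine ⟨pol f (vec u) (vec v) / pol g (vec u) (vec v), div_ne_zero hpf hpg, ext_of_ev fun x => ?_⟩
  have h1 := ev_of_zeros hfu hfv x
  have h2 := ev_of_zeros hgu hgv x
  rw [ev_smul_left]
  refine mul_left_cancel₀ (pow_ne_zero 2 hw) ?_
  rw [h1]
  field_simp
  linear_combination -h2

/-- The coefficients of `f` with respect to the basis `p, p'` of `K²` lie in the subfield `k`
after a suitable scaling of `f`. -/
def IsRational (k : Subfield K) (p p' : K × K) (f : Fin 3 → K) : Prop :=
  ∃ c : K, c ≠ 0 ∧ c * ev f p ∈ k ∧ c * pol f p p' ∈ k ∧ c * ev f p' ∈ k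

lemma ev_affine (f : Fin 3 → K) (p p' : K × K) (x : K) :
    ev f (x • p + (1 : K) • p') = ev f p * x ^ 2 + pol f p p' * x + ev f p' := by
  rw [ev_comb]; ring

lemma isRational_of_roots {k : Subfield K} {p p' : K × K} (hw : wedge p p' ≠ 0) {f : Fin 3 → K}
    (hf : fdisc f ≠ 0) {a b : K} (hab : a ≠ b) (ha : ev f (a • p + (1 : K) • p') = 0)
    (hb : ev f (b • p + (1 : K) • p') = 0) (hadd : a + b ∈ k) (hmul : a * b ∈ k) :
    IsRational k p p' f := by
  rw [ev_affine] at ha hb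
  have h1 : pol f p p' = -(ev f p * (a + b)) := by
    refine mul_left_cancel₀ (sub_ne_zero.2 hab) ?_
    linear_combination ha - hb
  have h2 : ev f p' = ev f p * (a * b) := by
    rw [h1] at ha
    linear_combination ha
  have h0 : ev f p ≠ 0 := by
    intro h0
    have h := pol_sq f p p'
    rw [h1, h2, h0] at h
    have : fdisc f * wedge p p' ^ 2 = 0 := by rw [← h]; ring
    simp [hf, hw] at this
  refine ⟨(ev f p)⁻¹, inv_ne_zero h0, ?_, ?_, ?_⟩
  · rw [inv_mul_cancel₀ h0]; exact one_mem k
  · rw [h1, mul_neg, inv_mul_cancel_left₀ h0]; exact neg_mem hadd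
  · rw [h2, inv_mul_cancel_left₀ h0]; exact hmul

lemma isRational_of_root_infinity {k : Subfield K} {p p' : K × K} (hw : wedge p p' ≠ 0)
    {f : Fin 3 → K} (hf : fdisc f ≠ 0) {b : K} (hp : ev f p = 0)
    (hb : ev f (b • p + (1 : K) • p') = 0) (hbk : b ∈ k) : IsRational k p p' f := by
  have h0 := pol_ne_zero hf hp hw
  rw [ev_affine, hp] at hb
  have h2 : ev f p' = pol f p p' * -b := by linear_combination hb
  refine ⟨(pol f p p')⁻¹, inv_ne_zero h0, ?_, ?_, ?_⟩
  · rw [hp, mul_zero]; exact zero_mem k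
  · rw [inv_mul_cancel₀ h0]; exact one_mem k
  · rw [h2, inv_mul_cancel_left₀ h0]; exact neg_mem hbk

end

variable {K : Type*} [Field K] [Fintype K]

lemma mem_subfield_iff (k : Subfield K) (x : K) : x ∈ k ↔ x ^ Nat.card k = x := by
  classical
  have : Fintype k := Fintype.ofFinite k
  rw [Nat.card_eq_fintype_card]
  constructor
  · intro hx
    have := FiniteField.pow_card (⟨x, hx⟩ : k)
    exact congrArg Subtype.val this
  · intro hx
    obtain ⟨a, rfl⟩ := exists_map_eq_of_pow_card_eq k.subtype hx
    exact a.2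

lemma add_pow_card_subfield (k : Subfield K) (x y : K) :
    (x + y) ^ Nat.card k = x ^ Nat.card k + y ^ Nat.card k := by
  classical
  have : Fintype k := Fintype.ofFinite k
  rw [Nat.card_eq_fintype_card]
  obtain ⟨p, hpc⟩ := CharP.exists k
  obtain ⟨n, hp, hn⟩ := FiniteField.card k p
  have : Fact p.Prime := ⟨hp⟩
  have : CharP K p := charP_of_injective_ringHom k.subtype.injective p
  rw [hn, add_pow_char_pow]

variable [DecidableEq K] {ι : Type*} [Fintype ι]
  {e : ι → Fin 3 → K} {S : Finset (Option K)} {r : ℕ}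

lemma quadraticChar_ev_pt (f : Fin 3 → K) {v : K × K} (hv : v ≠ 0) :
    quadraticChar K (ev f (vec (pt v))) = quadraticChar K (ev f v) := by
  obtain ⟨c, hc, h⟩ := exists_vec_pt hv
  conv_rhs => rw [h, ev_smul, quadraticChar_sq_mul hc]

/-- The lines of the partition match each point outside the subline with its conjugate. The two
points see each point of `S` with the same sign, since `(x - t) (x ^ r - t) = (x - t) ^ (r + 1)` is
a square for `t ∈ k`. If they were not joined, then the `(q - 1) / 2` lines separating them would
avoid `S`, but only `(q - r) / 2` lines do. -/
theorem adj_conj (h4 : Fintype.card K % 4 = 1) (hp : IsInternalPartition e)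
    (hc : Fintype.card ι = Fintype.card K) (hM : IsCliqueWithMatching e S r) {k : Subfield K}
    {p p' : K × K} (hw : wedge p p' ≠ 0) (hk : Nat.card k = r)
    (hS : ∀ t : K, pt (t • p + (1 : K) • p') ∈ S ↔ t ∈ k) {x : K} (hx : x ∉ k) :
    Adj e (pt (x • p + (1 : K) • p')) (pt (x ^ r • p + (1 : K) • p')) := by
  classical
  have hr := hM.three_le h4
  have hrodd : Odd r := by
    rw [← Nat.not_even_iff_odd]
    intro hev
    have h := hM.sq
    have : Even (Fintype.card K) := h ▸ (hev.pow_of_ne_zero two_ne_zero)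
    rw [Nat.even_iff] at this
    omega
  by_contra hn
  set v := x • p + (1 : K) • p' with hv
  set v' := x ^ r • p + (1 : K) • p' with hv'
  have hv0 : v ≠ 0 := comb_ne_zero hw (Or.inr one_ne_zero)
  have hv0' : v' ≠ 0 := comb_ne_zero hw (Or.inr one_ne_zero)
  have hne : pt v ≠ pt v' := by
    rw [hv, hv', Ne, pt_comb_eq_iff hw (Or.inr one_ne_zero) (Or.inr one_ne_zero)]
    intro h
    apply hx
    rw [mem_subfield_iff, hk]
    linear_combination -h
  have hopp := card_opp h4 hp hne hn
  have hsame : ∀ s ∈ S, quadraticChar K (wedge v (vec s) * wedge v' (vec s)) = 1 := by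
    intro s hs
    rcases eq_pt_or_exists_affine hw s with h | ⟨t, h⟩
    · have hp0 : p ≠ 0 := by rintro rfl; simp [wedge] at hw
      obtain ⟨c, hc, hpc⟩ := exists_vec_pt hp0
      rw [← h] at hpc
      have h1 : c * wedge v (vec s) = -wedge p p' := by
        rw [← wedge_smul_right, ← hpc]
        simp only [hv, wedge, Prod.smul_fst, Prod.smul_snd, smul_eq_mul, Prod.fst_add,
          Prod.snd_add]; ring
      have h2 : c * wedge v' (vec s) = -wedge p p' := by
        rw [← wedge_smul_right, ← hpc]
        simp only [hv', wedge, Prod.smul_fst, Prod.smul_snd, smul_eq_mul, Prod.fst_add,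
          Prod.snd_add]; ring
      rw [← quadraticChar_sq_mul hc, ← quadraticChar_sq_one' hw]
      congr 1
      linear_combination (c * wedge v' (vec s)) * h1 - wedge p p' * h2
    · have htk : t ∈ k := (hS t).1 (h ▸ hs)
      obtain ⟨c, hc, hpc⟩ := exists_vec_pt
        (comb_ne_zero hw (a := t) (Or.inr (one_ne_zero (α := K))))
      rw [← h] at hpc
      have hxt : x - t ≠ 0 := fun h' => hx (by rw [sub_eq_zero.1 h']; exact htk)
      have h1 : c * wedge v (vec s) = (x - t) * wedge p p' := by
        rw [← wedge_smul_right, ← hpc, hv, wedge_comb]; ring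
      have h2 : c * wedge v' (vec s) = (x - t) ^ r * wedge p p' := by
        have h3 : (x - t) ^ r + t = x ^ r := by
          have := add_pow_card_subfield k (x - t) t
          rw [(mem_subfield_iff k t).1 htk, hk, sub_add_cancel] at this
          exact this.symm
        rw [← wedge_smul_right, ← hpc, hv', wedge_comb, ← h3]; ring
      obtain ⟨m, hm⟩ := hrodd
      rw [← quadraticChar_sq_mul hc,
        ← quadraticChar_sq_one' (mul_ne_zero (pow_ne_zero (m + 1) hxt) hw)]
      congr 1
      have h5 : (x - t) ^ r * (x - t) = ((x - t) ^ (m + 1)) ^ 2 := by rw [hm]; ring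
      rw [mul_pow, ← h5]
      linear_combination (c * wedge v' (vec s)) * h1 + (x - t) * wedge p p' * h2
  have hout : ∀ i ∈ opp e (pt v) (pt v'), ∀ s, ev (e i) (vec s) = 0 → s ∉ S := by
    intro i hi s his hs
    obtain ⟨t, hts, hit⟩ := exists_other_zero (fdisc_ne_zero h4 hp i) his
    have ht : t ∈ S := hM.component.closed s hs t ⟨hts.symm, i, his, hit⟩
    have hd : wedge (vec s) (vec t) ≠ 0 := fun h => hts (wedge_vec_eq_zero.1 h).symm
    have hpol := pol_ne_zero (fdisc_ne_zero h4 hp i) his hd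
    rw [mem_opp, map_mul, quadraticChar_ev_pt _ hv0, quadraticChar_ev_pt _ hv0', ← map_mul,
      ← quadraticChar_sq_mul (pow_ne_zero 2 hd)] at hi
    have h1 := ev_of_zeros his hit v
    have h2 := ev_of_zeros his hit v'
    have h3 : (wedge (vec s) (vec t) ^ 2) ^ 2 * (ev (e i) v * ev (e i) v')
        = pol (e i) (vec s) (vec t) ^ 2 * ((wedge v (vec s) * wedge v' (vec s))
          * (wedge v (vec t) * wedge v' (vec t))) := by
      linear_combination (wedge (vec s) (vec t) ^ 2 * ev (e i) v') * h1
        - pol (e i) (vec s) (vec t) * (wedge v (vec s) * wedge v (vec t)) * h2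
    rw [h3, quadraticChar_sq_mul hpol, map_mul, hsame s hs, hsame t ht] at hi
    simp at hi
  have hcount : 2 * (opp e (pt v) (pt v')).card ≤ Sᶜ.card := by
    have h1 : ∑ u ∈ Sᶜ, (star e u).card = Sᶜ.card := by
      rw [Finset.sum_congr rfl fun u hu => hM.card_star u (Finset.mem_compl.1 hu), Finset.sum_const,
        smul_eq_mul, mul_one]
    rw [← h1]
    have h2 : ∑ u ∈ Sᶜ, (star e u).card
        = ∑ i, (Sᶜ.filter fun u => ev (e i) (vec u) = 0).card := by
      simp only [star, Finset.card_filter]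
      rw [Finset.sum_comm]
      convert rfl
    rw [h2, mul_comm, ← smul_eq_mul, ← Finset.sum_const]
    have h3 : ∀ i ∈ opp e (pt v) (pt v'), 2 ≤ (Sᶜ.filter fun u => ev (e i) (vec u) = 0).card := by
      intro i hi
      obtain ⟨s, t, hst, hs, ht⟩ := exists_zeros h4 hp hc i
      rw [← Finset.card_pair hst]
      refine Finset.card_le_card fun w hw => ?_
      rw [Finset.mem_insert, Finset.mem_singleton] at hw
      rw [Finset.mem_filter, Finset.mem_compl]
      rcases hw with rfl | rfl
      · exact ⟨hout i hi _ hs, hs⟩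
      · exact ⟨hout i hi _ ht, ht⟩
    exact (Finset.sum_le_sum h3).trans (Finset.sum_le_sum_of_subset (Finset.subset_univ _))
  rw [Finset.card_compl, Fintype.card_option, hM.card_eq] at hcount
  have hq1 : 1 < Fintype.card K := Fintype.one_lt_card
  omega

end

/-! ### The partition in terms of the subfield -/

section

variable {K : Type*} [Field K] [Fintype K]

lemma pow_card_not_mem {k : Subfield K} (hk : Nat.card k ^ 2 = Fintype.card K) {x : K}
    (hx : x ∉ k) : x ^ Nat.card k ≠ x ∧ x ^ Nat.card k ∉ k := by
  rw [mem_subfield_iff] at hx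
  refine ⟨hx, fun h => hx ?_⟩
  rw [mem_subfield_iff, ← pow_mul, ← pow_two, hk, FiniteField.pow_card] at h
  exact h.symm

/-- Conjugation permutes the zeros of a form with coefficients in `k`. -/
lemma ev_conj_eq_zero {k : Subfield K} {p p' : K × K} {f : Fin 3 → K} {x : K}
    (h0 : ev f p ∈ k) (h1 : pol f p p' ∈ k) (h2 : ev f p' ∈ k)
    (hx : ev f (x • p + (1 : K) • p') = 0) :
    ev f (x ^ Nat.card k • p + (1 : K) • p') = 0 := by
  rw [mem_subfield_iff] at h0 h1 h2
  rw [ev_affine] at hx ⊢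
  have h := congrArg (· ^ Nat.card k) hx
  simp only [add_pow_card_subfield, mul_pow] at h
  rw [h0, h1, h2, zero_pow Nat.card_pos.ne'] at h
  rw [← h]
  ring

/-- The elements of the subfield of order `√q` are squares. -/
lemma isSquare_of_mem_subfield (h4 : Fintype.card K % 4 = 1) {k : Subfield K}
    (hk : Nat.card k ^ 2 = Fintype.card K) {x : K} (hx : x ∈ k) : IsSquare x := by
  by_cases h0 : x = 0
  · rw [h0]; exact IsSquare.zero
  rw [FiniteField.isSquare_iff (ringChar_ne_two h4) h0]
  have hodd : Nat.card k % 2 = 1 := by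
    rw [← Nat.odd_iff, ← Nat.not_even_iff_odd]
    intro hev
    have : Even (Fintype.card K) := hk ▸ (hev.pow_of_ne_zero two_ne_zero)
    rw [Nat.even_iff] at this
    omega
  obtain ⟨m, hm⟩ : ∃ m, Nat.card k = 2 * m + 1 := ⟨Nat.card k / 2, by omega⟩
  have h1 : x ^ (2 * m) = 1 := by
    have h := (mem_subfield_iff k x).1 hx
    rw [hm, pow_succ] at h
    exact mul_right_cancel₀ h0 (by rw [h, one_mul])
  have h2 : Fintype.card K / 2 = 2 * m * (m + 1) := by
    rw [← hk, hm]
    have : (2 * m + 1) ^ 2 = 2 * (2 * m * (m + 1)) + 1 := by ring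
    omega
  rw [h2, pow_mul, h1, one_pow]

variable [DecidableEq K] {ι : Type*} [Fintype ι]
  {e : ι → Fin 3 → K} {S : Finset (Option K)} {r : ℕ}

/-- If the joining lines of the partition form a clique with a matching, then the partition
consists of the secants of the conic with coefficients in a subfield of order `√q`. -/
theorem exists_iff_isRational (h4 : Fintype.card K % 4 = 1) (hp : IsInternalPartition e)
    (hc : Fintype.card ι = Fintype.card K) (hM : IsCliqueWithMatching e S r) :
    ∃ (k : Subfield K) (p p' : K × K), wedge p p' ≠ 0 ∧ Nat.card k ^ 2 = Fintype.card K ∧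
      ∀ f : Fin 3 → K, fdisc f ≠ 0 →
        ((∃ i, ∃ c : K, c ≠ 0 ∧ f = c • e i) ↔ IsRational k p p' f) := by
  obtain ⟨k, p, p', hw, hk, hpS, hS⟩ := exists_subfield h4 hp hc hM
  have hk2 : Nat.card k ^ 2 = Fintype.card K := by rw [hk, hM.sq]
  refine ⟨k, p, p', hw, hk2, fun f hf => ?_⟩
  have h2 := two_ne_zero_of_card h4
  have hp0 : p ≠ 0 := by rintro rfl; simp [wedge] at hw
  have haff : ∀ t : K, t • p + (1 : K) • p' ≠ 0 := fun t =>
    comb_ne_zero hw (Or.inr one_ne_zero)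
  constructor
  · rintro ⟨i, c, hc0, rfl⟩
    suffices h : IsRational k p p' (e i) by
      obtain ⟨d, hd, h0, h1, h3⟩ := h
      have hdc : ∀ y : K, d * c⁻¹ * (c * y) = d * y := fun y => by
        field_simp
      refine ⟨d * c⁻¹, mul_ne_zero hd (inv_ne_zero hc0), ?_, ?_, ?_⟩
      · rwa [ev_smul_left, hdc]
      · have : pol (c • e i) p p' = c * pol (e i) p p' := by
          simp only [pol, Pi.smul_apply, smul_eq_mul]; ring
        rwa [this, hdc]
      · rwa [ev_smul_left, hdc]
    have hfi := fdisc_ne_zero h4 hp i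
    obtain ⟨u, v, huv, hu, hv⟩ := exists_zeros h4 hp hc i
    have hadj : Adj e u v := ⟨huv, i, hu, hv⟩
    by_cases huS : u ∈ S
    · have hvS := hM.component.closed u huS v hadj
      rcases eq_pt_or_exists_affine hw u with rfl | ⟨a, rfl⟩ <;>
        rcases eq_pt_or_exists_affine hw v with rfl | ⟨b, rfl⟩
      · exact absurd rfl huv
      · rw [ev_pt_eq_zero_iff _ hp0] at hu
        rw [ev_pt_eq_zero_iff _ (haff b)] at hv
        exact isRational_of_root_infinity hw hfi hu hv ((hS b).1 hvS)
      · rw [ev_pt_eq_zero_iff _ hp0] at hv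
        rw [ev_pt_eq_zero_iff _ (haff a)] at hu
        exact isRational_of_root_infinity hw hfi hv hu ((hS a).1 huS)
      · rw [ev_pt_eq_zero_iff _ (haff a)] at hu
        rw [ev_pt_eq_zero_iff _ (haff b)] at hv
        have ha := (hS a).1 huS
        have hb := (hS b).1 hvS
        exact isRational_of_roots hw hfi (fun h => huv (by rw [h])) hu hv (add_mem ha hb)
          (mul_mem ha hb)
    · obtain ⟨x, rfl⟩ := (eq_pt_or_exists_affine hw u).resolve_left (fun h => huS (h ▸ hpS))
      have hx : x ∉ k := fun h => huS ((hS x).2 h)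
      obtain ⟨hne, j, hju, hjv⟩ := adj_conj h4 hp hc hM hw hk hS hx
      -- the point `u` lies on one line of the partition only
      have hij : i = j := by
        obtain ⟨l, hl⟩ := Finset.card_eq_one.1 (hM.card_star _ huS)
        have h1 := mem_star.2 hu
        have h3 := mem_star.2 hju
        rw [hl, Finset.mem_singleton] at h1 h3
        rw [h1, h3]
      subst hij
      rw [ev_pt_eq_zero_iff _ (haff _)] at hu hjv
      have hxr := (pow_card_not_mem hk2 hx).1
      rw [hk] at hxr
      have hxq : (x ^ r) ^ r = x := by
        rw [← pow_mul, ← pow_two, hM.sq, FiniteField.pow_card]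
      refine isRational_of_roots hw hfi (Ne.symm hxr) hu hjv ?_ ?_
      · rw [mem_subfield_iff, add_pow_card_subfield, hk, hxq, add_comm]
      · rw [mem_subfield_iff, hk, mul_pow, hxq, mul_comm]
  · rintro ⟨c, hc0, h0, h1, h3⟩
    -- The zeros of `f` exist because its discriminant lies in `k` up to a square factor, and
    -- it is enough to join the two zeros of `f`
    have hadj : ∃ u v, Adj e u v ∧ ev f (vec u) = 0 ∧ ev f (vec v) = 0 := by
      have hconj : ∀ x : K, ev f (x • p + (1 : K) • p') = 0 →
          ev f (x ^ r • p + (1 : K) • p') = 0 := by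
        intro x hx
        have hcf : ∀ v, ev (c • f) v = c * ev f v := ev_smul_left f c
        have hpf : pol (c • f) p p' = c * pol f p p' := by
          simp only [pol, Pi.smul_apply, smul_eq_mul]; ring
        have h := ev_conj_eq_zero (k := k) (f := c • f) (p := p) (p' := p') (x := x)
          (by rwa [hcf]) (by rwa [hpf]) (by rwa [hcf]) (by rw [hcf, hx, mul_zero])
        rw [hcf, hk] at h
        exact (mul_eq_zero.1 h).resolve_left hc0
      obtain ⟨u, hu⟩ : ∃ u, ev f (vec u) = 0 := by
        by_cases hα : ev f p = 0
        · exact ⟨pt p, (ev_pt_eq_zero_iff _ hp0).2 hα⟩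
        · have hDk : (c * pol f p p') ^ 2 - 4 * (c * ev f p) * (c * ev f p') ∈ k := by
            refine sub_mem (pow_mem h1 2) (mul_mem (mul_mem ?_ h0) h3)
            exact_mod_cast natCast_mem k 4
          obtain ⟨s, hs⟩ := isSquare_of_mem_subfield h4 hk2 hDk
          refine ⟨pt (((-(c * pol f p p') + s) / (2 * (c * ev f p))) • p + (1 : K) • p'), ?_⟩
          rw [ev_pt_eq_zero_iff _ (haff _), ev_affine]
          have h5 : c * ev f p ≠ 0 := mul_ne_zero hc0 hα
          refine (mul_eq_zero.1 (?_ : (4 * c ^ 2 * ev f p) * _ = 0)).resolve_left ?_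
          · have h6 : ((-(c * pol f p p') + s) / (2 * (c * ev f p))) * (2 * (c * ev f p))
                = -(c * pol f p p') + s := div_mul_cancel₀ _ (mul_ne_zero h2 h5)
            set X := (-(c * pol f p p') + s) / (2 * (c * ev f p))
            linear_combination (X * (2 * (c * ev f p)) + c * pol f p p' + s) * h6 - hs
          · exact mul_ne_zero (mul_ne_zero (four_ne_zero_of_two_ne_zero h2) (pow_ne_zero 2 hc0)) hα
      obtain ⟨v, hvu, hv⟩ := exists_other_zero hf hu
      have hout : ∀ w, w ∉ S → ev f (vec w) = 0 → ∃ w', w' ∉ S ∧ Adj e w w' ∧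
          ev f (vec w') = 0 := by
        intro w hwS hw0
        obtain ⟨x, rfl⟩ := (eq_pt_or_exists_affine hw w).resolve_left (fun h => hwS (h ▸ hpS))
        have hx : x ∉ k := fun h => hwS ((hS x).2 h)
        rw [ev_pt_eq_zero_iff _ (haff _)] at hw0
        refine ⟨_, fun h => ?_, adj_conj h4 hp hc hM hw hk hS hx,
          (ev_pt_eq_zero_iff _ (haff _)).2 (hconj x hw0)⟩
        have := (pow_card_not_mem hk2 hx).2
        rw [hk] at this
        exact this ((hS _).1 h)
      by_cases huS : u ∈ S
      · by_cases hvS : v ∈ S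
        · exact ⟨u, v, hM.component.adj u huS v hvS hvu.symm, hu, hv⟩
        · obtain ⟨w, -, hvw, hw0⟩ := hout v hvS hv
          exact ⟨v, w, hvw, hv, hw0⟩
      · obtain ⟨w, -, huw, hw0⟩ := hout u huS hu
        exact ⟨u, w, huw, hu, hw0⟩
    obtain ⟨u, v, ⟨huv, i, hiu, hiv⟩, hu, hv⟩ := hadj
    exact ⟨i, exists_smul_of_zeros hf (fdisc_ne_zero h4 hp i) huv hu hv hiu hiv⟩

end

/-! ### Normal form of the conic -/

section

open Matrix

section

variable {K : Type*} [Field K]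

/-- Coordinates in which a nondegenerate ternary quadratic form over a finite field of odd
characteristic is a multiple of `Y² - XZ`. -/
lemma exists_frame [Fintype K] (h2 : (2 : K) ≠ 0) (hcard : Fintype.card K % 2 = 1)
    (Q : QuadraticForm K (Fin 3 → K)) (hQ : (QuadraticMap.polarBilin Q).Nondegenerate) :
    ∃ (M : Matrix (Fin 3) (Fin 3) K) (c : K), IsUnit M ∧ c ≠ 0 ∧ ∀ g, Q (M *ᵥ g) = c * qform g := by
  have : Invertible (2 : K) := invertibleOfNonzero h2
  have hass : (QuadraticMap.associated (R := K) Q).SeparatingLeft := by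
    intro x hx
    refine hQ.1 x fun y => ?_
    have h := hx y
    rw [QuadraticMap.associated_apply] at h
    rw [QuadraticMap.polarBilin_apply_apply, QuadraticMap.polar]
    simpa [h2] using h
  obtain ⟨w, ⟨φ⟩⟩ := Q.equivalent_weightedSumSquares_units_of_nondegenerate' hass
  have hfr : Module.finrank K (Fin 3 → K) = 3 := by simp
  generalize Module.finrank K (Fin 3 → K) = n at w φ hfr
  subst hfr
  -- In diagonal coordinates `a X² + b Y² + c Z²` take `x, y` with `a x² + b y² = -c`. The columns
  -- of `N` are the isotropic vectors `(x, y, 1)` and a multiple of `(x, y, -1)`, and between them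
  -- a vector orthogonal to both.
  set a : K := ((w 0 : Kˣ) : K) with ha
  set b : K := ((w 1 : Kˣ) : K) with hb
  set c : K := ((w 2 : Kˣ) : K) with hc
  have ha0 : a ≠ 0 := (w 0).ne_zero
  have hb0 : b ≠ 0 := (w 1).ne_zero
  have hc0 : c ≠ 0 := (w 2).ne_zero
  obtain ⟨x, y, hxy⟩ : ∃ x y : K, a * x ^ 2 + (b * y ^ 2 + c) = 0 := by
    obtain ⟨x, y, h⟩ := FiniteField.exists_root_sum_quadratic
      (f := Polynomial.C a * Polynomial.X ^ 2 + Polynomial.C 0 * Polynomial.X + Polynomial.C 0)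
      (g := Polynomial.C b * Polynomial.X ^ 2 + Polynomial.C 0 * Polynomial.X + Polynomial.C c)
      (Polynomial.degree_quadratic ha0) (Polynomial.degree_quadratic hb0) hcard
    exact ⟨x, y, by simpa using h⟩
  have h4 := four_ne_zero_of_two_ne_zero h2
  obtain ⟨t, ht0, ht4⟩ : ∃ t : K, t ≠ 0 ∧ 4 * t = -(a * b) :=
    ⟨-(a * b) / 4, div_ne_zero (neg_ne_zero.2 (mul_ne_zero ha0 hb0)) h4, by field_simp⟩
  set N : Matrix (Fin 3) (Fin 3) K := !![x, -(b * y), t * x; y, a * x, t * y; 1, 0, -t] with hN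
  have hNdet : N.det = 2 * t * c := by
    rw [hN, Matrix.det_fin_three]
    simp only [Matrix.of_apply, Matrix.cons_val', Matrix.cons_val_zero, Matrix.cons_val_one,
      Matrix.cons_val_fin_one, Matrix.cons_val]
    linear_combination (-2 * t) * hxy
  have hNu : IsUnit N := by
    rw [Matrix.isUnit_iff_isUnit_det, hNdet]
    exact (mul_ne_zero (mul_ne_zero h2 ht0) hc0).isUnit
  set ψ : (Fin 3 → K) →ₗ[K] (Fin 3 → K) :=
    φ.toLinearEquiv.symm.toLinearMap ∘ₗ Matrix.mulVecLin N with hψ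
  have hψg : ∀ g, ψ g = φ.toLinearEquiv.symm (N *ᵥ g) := fun g => rfl
  refine ⟨LinearMap.toMatrix' ψ, -(a * b * c), ?_, ?_, fun g => ?_⟩
  · rw [← Matrix.mulVec_injective_iff_isUnit]
    intro g g' h
    simp only [LinearMap.toMatrix'_mulVec, hψg] at h
    exact Matrix.mulVec_injective_iff_isUnit.2 hNu (φ.toLinearEquiv.symm.injective h)
  · exact neg_ne_zero.2 (mul_ne_zero (mul_ne_zero ha0 hb0) hc0)
  · rw [LinearMap.toMatrix'_mulVec, hψg]
    have h1 := φ.map_app (φ.toLinearEquiv.symm (N *ᵥ g))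
    have h3 : φ (φ.toLinearEquiv.symm (N *ᵥ g)) = N *ᵥ g := φ.toLinearEquiv.apply_symm_apply _
    rw [← h1, h3, QuadraticMap.weightedSumSquares_apply, Fin.sum_univ_three]
    simp only [Units.smul_def, smul_eq_mul, ← ha, ← hb, ← hc, qform]
    rw [hN]
    simp only [Matrix.mulVec, dotProduct, Fin.sum_univ_three, Matrix.of_apply, Matrix.cons_val',
      Matrix.cons_val_zero, Matrix.cons_val_one, Matrix.cons_val_fin_one,
      Matrix.cons_val]
    linear_combination ((g 0 + t * g 2) ^ 2 + a * b * g 1 ^ 2) * hxy - c * g 0 * g 2 * ht4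

/-- The parametrization reaches every point of the conic `Y² = XZ`. -/
lemma exists_eq_smul_ver {g : Fin 3 → K} (hg : g ≠ 0) (h : qform g = 0) :
    ∃ (u : Option K) (c : K), c ≠ 0 ∧ g = c • ver (vec u) := by
  have h' : g 1 ^ 2 = g 0 * g 2 := by rw [qform] at h; linear_combination h
  by_cases h2 : g 2 = 0
  · have h1 : g 1 = 0 := by simpa [h2] using h'
    refine ⟨none, g 0, fun h0 => hg ?_, ?_⟩
    · ext j; fin_cases j <;> simp [h0, h1, h2]
    · ext j; fin_cases j <;> simp [ver, vec, h1, h2]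
  · refine ⟨some (g 1 / g 2), g 2, h2, ?_⟩
    ext j; fin_cases j
    · simp [ver, vec]; field_simp; linear_combination -h'
    · simp [ver, vec]; field_simp
    · simp [ver, vec]

lemma ver_vec_ne_zero (u : Option K) : ver (vec u) ≠ 0 := by
  cases u with
  | none => intro h; simpa [ver, vec] using congrFun h 0
  | some a => intro h; simpa [ver, vec] using congrFun h 2

lemma eq_of_ver_eq_smul {u v : Option K} {c : K} (h : ver (vec u) = c • ver (vec v)) : u = v := by
  rw [← wedge_vec_eq_zero]
  have h0 := congrFun h 0
  have h1 := congrFun h 1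
  have h2 := congrFun h 2
  cases u <;> cases v <;> simp [ver, vec, wedge] at h0 h1 h2 ⊢
  · simp [← h2] at h0
  · simp [← h2] at h1; simp [h1]

/-- A line touches the conic if and only if its binary form has discriminant zero. -/
lemma existsUnique_zero_iff (h2 : (2 : K) ≠ 0) {f : Fin 3 → K} (hf : f ≠ 0) :
    (∃! u : Option K, ev f (vec u) = 0) ↔ fdisc f = 0 := by
  constructor
  · rintro ⟨u, hu, huni⟩
    by_contra hd
    obtain ⟨v, hv, hv0⟩ := exists_other_zero hd hu
    exact hv (huni v hv0)
  · intro hd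
    have huniq : ∀ u v : Option K, ev f (vec u) = 0 → ev f (vec v) = 0 → u = v := by
      intro u v hu hv
      by_contra huv
      have hw : wedge (vec u) (vec v) ≠ 0 := fun h => huv (wedge_vec_eq_zero.1 h)
      have hp : pol f (vec u) (vec v) = 0 := by
        have h := pol_sq f (vec u) (vec v)
        rw [hu, hd] at h
        exact pow_eq_zero_iff two_ne_zero |>.1 (by linear_combination h)
      refine hf (ext_of_ev fun x => mul_left_cancel₀ (pow_ne_zero 2 hw) ?_)
      rw [ev_of_zeros hu hv, hp]
      simp [ev]
    suffices ∃ u : Option K, ev f (vec u) = 0 from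
      this.imp fun u hu => ⟨hu, fun v hv => huniq v u hv hu⟩
    rw [fdisc] at hd
    by_cases h0 : f 0 = 0
    · exact ⟨none, by simp [ev, vec, h0]⟩
    · refine ⟨some (-f 1 / (2 * f 0)), ?_⟩
      simp only [ev, vec]
      field_simp
      linear_combination -hd

/-- A point with `Y² - XZ` a square lies on a line whose form has discriminant zero. -/
lemma exists_fdisc_eq_zero {g : Fin 3 → K} (hg : IsSquare (qform g)) :
    ∃ f : Fin 3 → K, f ≠ 0 ∧ fdisc f = 0 ∧ f ⬝ᵥ g = 0 := by
  obtain ⟨s, hs⟩ := hg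
  rw [qform] at hs
  by_cases h2 : g 2 = 0
  · exact ⟨![0, 0, 1], fun h => by simpa using congrFun h 2, by simp [fdisc],
      by simp [dotProduct, Fin.sum_univ_three, h2]⟩
  · refine ⟨![g 2 ^ 2, -2 * (g 1 + s) * g 2, (g 1 + s) ^ 2], fun h => h2 ?_, ?_, ?_⟩
    · simpa using congrFun h 0
    · simp [fdisc]; ring
    · simp [dotProduct, Fin.sum_univ_three]
      linear_combination (-g 2) * hs

end

end

/-! ### Lines and points in the frame of the conic -/

section

open Matrix

section

variable {K : Type*} [Field K]

/-- The binary quadratic form cut out on the parametrized conic by the line `l`: the coordinates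
of `l` in the frame `M`. -/
noncomputable def lineForm (M : Matrix (Fin 3) (Fin 3) K) (l : Line K) : Fin 3 → K := l.rep ᵥ* M

variable {M : Matrix (Fin 3) (Fin 3) K}

lemma mem_line_iff (l : Line K) (v : Fin 3 → K) (hv : v ≠ 0) :
    (Projectivization.mk K v hv : Point K) ∈ l ↔ l.rep ⬝ᵥ v = 0 := by
  rw [Configuration.ofField.mem_iff]
  conv_lhs => rw [← Projectivization.mk_rep l]
  rw [Projectivization.orthogonal_mk, dotProduct_comm]

lemma mulVec_ne_zero (hM : IsUnit M) {g : Fin 3 → K} (hg : g ≠ 0) : M *ᵥ g ≠ 0 := fun h =>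
  hg (mulVec_injective_iff_isUnit.2 hM (h.trans (mulVec_zero M).symm))

lemma lineForm_ne_zero (hM : IsUnit M) (l : Line K) : lineForm M l ≠ 0 := fun h =>
  l.rep_nonzero (vecMul_injective_iff_isUnit.2 hM (h.trans (zero_vecMul M).symm))

/-- The point with coordinate vector `g` in the frame `M`. -/
noncomputable def framePoint (hM : IsUnit M) (g : Fin 3 → K) (hg : g ≠ 0) : Point K :=
  Projectivization.mk K (M *ᵥ g) (mulVec_ne_zero hM hg)

lemma framePoint_mem_line (hM : IsUnit M) {g : Fin 3 → K} (hg : g ≠ 0) (l : Line K) :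
    framePoint hM g hg ∈ l ↔ lineForm M l ⬝ᵥ g = 0 := by
  rw [framePoint, mem_line_iff, lineForm, dotProduct_mulVec]

lemma exists_framePoint (hM : IsUnit M) (p : Point K) :
    ∃ (g : Fin 3 → K) (hg : g ≠ 0), p = framePoint hM g hg := by
  induction p using Projectivization.ind with
  | h v hv =>
    obtain ⟨g, rfl⟩ := mulVec_surjective_iff_isUnit.2 hM v
    exact ⟨g, fun h => hv (by rw [h, mulVec_zero]), rfl⟩

lemma framePoint_eq_iff (hM : IsUnit M) {g g' : Fin 3 → K} (hg : g ≠ 0) (hg' : g' ≠ 0) :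
    framePoint hM g hg = framePoint hM g' hg' ↔ ∃ c : K, c • g' = g := by
  rw [framePoint, framePoint, Projectivization.mk_eq_mk_iff']
  refine exists_congr fun c => ?_
  rw [← mulVec_smul]
  exact (mulVec_injective_iff_isUnit.2 hM).eq_iff

lemma exists_lineForm_eq_smul (hM : IsUnit M) {f : Fin 3 → K} (hf : f ≠ 0) :
    ∃ (l : Line K) (c : K), c ≠ 0 ∧ lineForm M l = c • f := by
  obtain ⟨w, rfl⟩ := vecMul_surjective_iff_isUnit.2 hM f
  have hw : w ≠ 0 := fun h => hf (by rw [h]; exact zero_vecMul M)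
  obtain ⟨a, ha⟩ := Projectivization.exists_smul_eq_mk_rep K w hw
  refine ⟨Projectivization.mk K w hw, a, a.ne_zero, ?_⟩
  rw [lineForm, ← ha]
  exact smul_vecMul _ _ _

lemma eq_of_lineForm_eq_smul (hM : IsUnit M) {l l' : Line K} {c : K}
    (h : lineForm M l = c • lineForm M l') : l = l' := by
  rw [lineForm, lineForm, ← smul_vecMul] at h
  have h' := vecMul_injective_iff_isUnit.2 hM h
  rw [← Projectivization.mk_rep l, ← Projectivization.mk_rep l', Projectivization.mk_eq_mk_iff']
  exact ⟨c, h'.symm⟩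

/-- The point of the conic with parameter `u`. -/
noncomputable def conicPoint (hM : IsUnit M) (u : Option K) : Point K :=
  framePoint hM (ver (vec u)) (ver_vec_ne_zero u)

lemma conicPoint_mem_line (hM : IsUnit M) (u : Option K) (l : Line K) :
    conicPoint hM u ∈ l ↔ ev (lineForm M l) (vec u) = 0 := by
  rw [conicPoint, framePoint_mem_line, ev_ver]

lemma conicPoint_injective (hM : IsUnit M) : Function.Injective (conicPoint hM) := by
  intro u v h
  obtain ⟨c, hc⟩ := (framePoint_eq_iff hM _ _).1 h
  exact eq_of_ver_eq_smul hc.symm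

variable {Q : QuadraticForm K (Fin 3 → K)} {c : K}

lemma framePoint_mem_conic (hM : IsUnit M) (hc : c ≠ 0) (hQ : ∀ g, Q (M *ᵥ g) = c * qform g)
    {g : Fin 3 → K} (hg : g ≠ 0) : framePoint hM g hg ∈ conic Q ↔ qform g = 0 := by
  rw [framePoint, mk_mem_conic, hQ]
  simp [hc]

lemma mem_conic_iff (hM : IsUnit M) (hc : c ≠ 0) (hQ : ∀ g, Q (M *ᵥ g) = c * qform g)
    (p : Point K) : p ∈ conic Q ↔ ∃ u, p = conicPoint hM u := by
  obtain ⟨g, hg, rfl⟩ := exists_framePoint hM p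
  rw [framePoint_mem_conic hM hc hQ]
  constructor
  · intro h
    obtain ⟨u, d, -, hd⟩ := exists_eq_smul_ver hg h
    exact ⟨u, (framePoint_eq_iff hM _ _).2 ⟨d, hd.symm⟩⟩
  · rintro ⟨u, h⟩
    obtain ⟨d, rfl⟩ := (framePoint_eq_iff hM _ _).1 h
    simp [qform, ver]; ring

lemma isTangent_iff (h2 : (2 : K) ≠ 0) (hM : IsUnit M) (hc : c ≠ 0)
    (hQ : ∀ g, Q (M *ᵥ g) = c * qform g) (l : Line K) :
    IsTangent (conic Q) l ↔ fdisc (lineForm M l) = 0 := by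
  rw [← existsUnique_zero_iff h2 (lineForm_ne_zero hM l)]
  constructor
  · rintro ⟨p, ⟨hpl, hp⟩, huniq⟩
    obtain ⟨u, rfl⟩ := (mem_conic_iff hM hc hQ p).1 hp
    exact ⟨u, (conicPoint_mem_line hM u l).1 hpl, fun v hv => conicPoint_injective hM
      (huniq _ ⟨(conicPoint_mem_line hM v l).2 hv, (mem_conic_iff hM hc hQ _).2 ⟨v, rfl⟩⟩)⟩
  · rintro ⟨u, hu, huniq⟩
    refine ⟨conicPoint hM u, ⟨(conicPoint_mem_line hM u l).2 hu,
      (mem_conic_iff hM hc hQ _).2 ⟨u, rfl⟩⟩, ?_⟩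
    rintro p ⟨hpl, hp⟩
    obtain ⟨v, rfl⟩ := (mem_conic_iff hM hc hQ p).1 hp
    rw [huniq v ((conicPoint_mem_line hM v l).1 hpl)]

/-- In the frame, the internal points are those at which `Y² - XZ` is a nonsquare. -/
lemma framePoint_mem_internalPoints (h2 : (2 : K) ≠ 0) (hM : IsUnit M) (hc : c ≠ 0)
    (hQ : ∀ g, Q (M *ᵥ g) = c * qform g) {g : Fin 3 → K} (hg : g ≠ 0) :
    framePoint hM g hg ∈ internalPoints (conic Q) ↔ ¬IsSquare (qform g) := by
  constructor
  · rintro ⟨-, h⟩ hsq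
    obtain ⟨f, hf, hdf, hfg⟩ := exists_fdisc_eq_zero hsq
    obtain ⟨l, d, hd, hl⟩ := exists_lineForm_eq_smul hM hf
    refine h l ((framePoint_mem_line hM hg l).2 ?_) ((isTangent_iff h2 hM hc hQ l).2 ?_)
    · rw [hl, smul_dotProduct, hfg, smul_zero]
    · rw [hl, fdisc_smul, hdf, mul_zero]
  · intro h
    refine ⟨fun hC => h ?_, fun l hl ht => h ?_⟩
    · rw [(framePoint_mem_conic hM hc hQ hg).1 hC]
      exact IsSquare.zero
    · exact isSquare_qform_of_fdisc_eq_zero h2 (lineForm_ne_zero hM l)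
        ((isTangent_iff h2 hM hc hQ l).1 ht) ((framePoint_mem_line hM hg l).1 hl)

lemma isInternalPartition_lineForm (h2 : (2 : K) ≠ 0) (hM : IsUnit M) (hc : c ≠ 0)
    (hQ : ∀ g, Q (M *ᵥ g) = c * qform g) {L : Set (Line K)}
    (hL : IsLinePartition L (internalPoints (conic Q))) :
    IsInternalPartition fun l : L => lineForm M l where
  ne_zero l := lineForm_ne_zero hM l
  existsUnique g hg := by
    have hg0 : g ≠ 0 := by
      rintro rfl
      exact hg (by simp [qform])
    obtain ⟨l, ⟨hl, hpl⟩, huniq⟩ := hL.existsUnique _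
      ((framePoint_mem_internalPoints h2 hM hc hQ hg0).2 hg)
    refine ⟨⟨l, hl⟩, (framePoint_mem_line hM hg0 l).1 hpl, fun l' hl' => Subtype.ext ?_⟩
    exact huniq l' ⟨l'.2, (framePoint_mem_line hM hg0 l').2 hl'⟩
  nonempty l := by
    obtain ⟨p, hp, hpl⟩ := hL.nonempty l l.2
    obtain ⟨g, hg, rfl⟩ := exists_framePoint hM p
    exact ⟨g, (framePoint_mem_internalPoints h2 hM hc hQ hg).1 hp,
      (framePoint_mem_line hM hg l).1 hpl⟩

lemma eq_of_common_conicPoints (hM : IsUnit M) {l l' : Line K} (hl : fdisc (lineForm M l) ≠ 0)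
    (hl' : fdisc (lineForm M l') ≠ 0) {u v : Option K} (huv : u ≠ v)
    (hlu : ev (lineForm M l) (vec u) = 0) (hlv : ev (lineForm M l) (vec v) = 0)
    (hlu' : ev (lineForm M l') (vec u) = 0) (hlv' : ev (lineForm M l') (vec v) = 0) : l = l' := by
  obtain ⟨d, -, hd⟩ := exists_smul_of_zeros hl hl' huv hlu hlv hlu' hlv'
  exact eq_of_lineForm_eq_smul hM hd

end

section

variable {K : Type*} [Field K] [Fintype K] [DecidableEq K] {ι : Type*} [Fintype ι]
  {e : ι → Fin 3 → K}

/-- If all forms vanish at `v`, then `v` is adjacent to every other point. -/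
lemma adj_of_star_eq_univ (h4 : Fintype.card K % 4 = 1) (hp : IsInternalPartition e)
    (hc : Fintype.card ι = Fintype.card K) {v u : Option K} (hv : star e v = Finset.univ)
    (huv : u ≠ v) : Adj e v u := by
  classical
  rw [← mem_nbr]
  have hsub : nbr e v ⊆ Finset.univ.erase v := fun w hw =>
    Finset.mem_erase.2 ⟨(mem_nbr.1 hw).1.symm, Finset.mem_univ _⟩
  have heq : nbr e v = Finset.univ.erase v := by
    refine Finset.eq_of_subset_of_card_le hsub ?_
    rw [card_nbr h4 hp, hv, Finset.card_univ, hc, Finset.card_erase_of_mem (Finset.mem_univ _),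
      Finset.card_univ, Fintype.card_option, Nat.add_sub_cancel]
  rw [heq]
  exact Finset.mem_erase.2 ⟨huv, Finset.mem_univ _⟩

end

end

/-! ### Lines of a Baer subgeometry -/

section

open Matrix

section

variable {K : Type*} [Field K] {T : Matrix (Fin 3) (Fin 3) K}

/-- The basis of `K³` formed by the columns of an invertible matrix. -/
noncomputable def columnBasis (hT : IsUnit T) : Module.Basis (Fin 3) K (Fin 3 → K) :=
  (Pi.basisFun K (Fin 3)).map (LinearEquiv.ofBijective T.mulVecLin
    ⟨mulVec_injective_iff_isUnit.2 hT, mulVec_surjective_iff_isUnit.2 hT⟩)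

lemma columnBasis_repr (hT : IsUnit T) (g : Fin 3 → K) (i : Fin 3) :
    (columnBasis hT).repr (T *ᵥ g) i = g i := by
  have h : (LinearEquiv.ofBijective T.mulVecLin
    ⟨mulVec_injective_iff_isUnit.2 hT, mulVec_surjective_iff_isUnit.2 hT⟩).symm (T *ᵥ g) = g := by
    rw [LinearEquiv.symm_apply_eq]; rfl
  simp [columnBasis, h]

lemma mem_subgeometry_iff (k : Subfield K) (hT : IsUnit T) (p : Point K) :
    p ∈ subgeometry k (columnBasis hT) ↔
      ∃ (g : Fin 3 → K) (hg : g ≠ 0), (∀ i, g i ∈ k) ∧ p = framePoint hT g hg := by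
  constructor
  · rintro ⟨v, hv, hk, rfl⟩
    obtain ⟨g, rfl⟩ := mulVec_surjective_iff_isUnit.2 hT v
    refine ⟨g, fun h => hv (by rw [h, mulVec_zero]), fun i => ?_, rfl⟩
    rw [← columnBasis_repr hT g i]
    exact hk i
  · rintro ⟨g, hg, hk, rfl⟩
    refine ⟨T *ᵥ g, mulVec_ne_zero hT hg, fun i => ?_, rfl⟩
    rw [columnBasis_repr]
    exact hk i

/-- A nonzero vector with coordinates in `k` is orthogonal to two independent such vectors. -/
lemma exists_orthogonal_pair (k : Subfield K) {f : Fin 3 → K} (hf : f ≠ 0) (hk : ∀ i, f i ∈ k) :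
    ∃ g g' : Fin 3 → K, (∀ i, g i ∈ k) ∧ (∀ i, g' i ∈ k) ∧ f ⬝ᵥ g = 0 ∧ f ⬝ᵥ g' = 0 ∧
      crossProduct g g' ≠ 0 := by
  have h0 := hk 0
  have h1 := hk 1
  have h2 := hk 2
  by_cases hf0 : f 0 = 0
  · by_cases hf1 : f 1 = 0
    · have hf2 : f 2 ≠ 0 := fun hf2 => hf (by ext j; fin_cases j <;> assumption)
      refine ⟨![1, 0, 0], ![0, 1, 0], ?_, ?_, ?_, ?_, fun h => ?_⟩
      · simp [Fin.forall_fin_succ, k.zero_mem, k.one_mem]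
      · simp [Fin.forall_fin_succ, k.zero_mem, k.one_mem]
      · simp [dotProduct, Fin.sum_univ_three, hf0]
      · simp [dotProduct, Fin.sum_univ_three, hf1]
      · simpa [cross_apply] using congrFun h 2
    · refine ⟨![1, 0, 0], ![0, -f 2, f 1], ?_, ?_, ?_, ?_, fun h => hf1 ?_⟩
      · simp [Fin.forall_fin_succ, k.zero_mem, k.one_mem]
      · simp [Fin.forall_fin_succ, k.zero_mem, k.neg_mem h2, h1]
      · simp [dotProduct, Fin.sum_univ_three, hf0]
      · simp [dotProduct, Fin.sum_univ_three]; ring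
      · simpa [cross_apply] using congrFun h 1
  · refine ⟨![-f 1, f 0, 0], ![-f 2, 0, f 0], ?_, ?_, ?_, ?_, fun h => hf0 ?_⟩
    · simp [Fin.forall_fin_succ, k.zero_mem, h0, h1]
    · simp [Fin.forall_fin_succ, k.zero_mem, h0, h2]
    · simp [dotProduct, Fin.sum_univ_three]; ring
    · simp [dotProduct, Fin.sum_univ_three]; ring
    · simpa [cross_apply] using congrFun h 0

/-- A line belongs to a subgeometry if and only if its coordinates in the corresponding frame are
proportional to elements of the subfield. -/
lemma mem_linesOf_subgeometry (k : Subfield K) (hT : IsUnit T) (l : Line K) :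
    l ∈ linesOf (subgeometry k (columnBasis hT)) ↔
      ∃ c : K, c ≠ 0 ∧ ∀ i, c * lineForm T l i ∈ k := by
  constructor
  · rintro ⟨x, hx, y, hy, hxy, hxl, hyl⟩
    obtain ⟨g, hg, hgk, rfl⟩ := (mem_subgeometry_iff k hT x).1 hx
    obtain ⟨g', hg', hgk', rfl⟩ := (mem_subgeometry_iff k hT y).1 hy
    rw [framePoint_mem_line] at hxl hyl
    have hcr : crossProduct g g' ≠ 0 := by
      rw [Ne, ← Projectivization.mk_eq_mk_iff_crossProduct_eq_zero hg hg',
        Projectivization.mk_eq_mk_iff']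
      exact fun h => hxy ((framePoint_eq_iff hT hg hg').2 h)
    have h0 : crossProduct (crossProduct g g') (lineForm T l) = 0 := by
      rw [cross_cross_eq_smul_sub_smul, dotProduct_comm g, dotProduct_comm g', hxl, hyl]
      simp
    rw [← Projectivization.mk_eq_mk_iff_crossProduct_eq_zero hcr (lineForm_ne_zero hT l),
      Projectivization.mk_eq_mk_iff'] at h0
    obtain ⟨c, hc⟩ := h0
    refine ⟨c, fun h => hcr (by rw [← hc, h, zero_smul]), fun i => ?_⟩
    have hi : c * lineForm T l i = crossProduct g g' i := congrFun hc i
    rw [hi, cross_apply]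
    fin_cases i <;>
      exact k.sub_mem (k.mul_mem (hgk _) (hgk' _)) (k.mul_mem (hgk _) (hgk' _))
  · rintro ⟨c, hc, hk⟩
    have hne : c • lineForm T l ≠ 0 := smul_ne_zero hc (lineForm_ne_zero hT l)
    obtain ⟨g, g', hgk, hgk', h, h', hcr⟩ := exists_orthogonal_pair k hne hk
    have hg : g ≠ 0 := by rintro rfl; simp at hcr
    have hg' : g' ≠ 0 := by rintro rfl; simp at hcr
    rw [smul_dotProduct, smul_eq_zero_iff_right hc] at h h'
    refine ⟨framePoint hT g hg, (mem_subgeometry_iff k hT _).2 ⟨g, hg, hgk, rfl⟩,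
      framePoint hT g' hg', (mem_subgeometry_iff k hT _).2 ⟨g', hg', hgk', rfl⟩, fun heq => ?_,
      (framePoint_mem_line hT hg l).2 h, (framePoint_mem_line hT hg' l).2 h'⟩
    rw [framePoint_eq_iff, ← Projectivization.mk_eq_mk_iff' _ _ _ hg hg',
      Projectivization.mk_eq_mk_iff_crossProduct_eq_zero] at heq
    exact hcr heq

/-- The symmetric square of a basis `p, p'` of `K²`: the coefficients of a binary quadratic form
with respect to `p, p'` are its product with this matrix. -/
def symSquare (p p' : K × K) : Matrix (Fin 3) (Fin 3) K :=
  !![p.1 ^ 2, 2 * (p.1 * p'.1), p'.1 ^ 2;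
     p.1 * p.2, p.1 * p'.2 + p.2 * p'.1, p'.1 * p'.2;
     p.2 ^ 2, 2 * (p.2 * p'.2), p'.2 ^ 2]

lemma isUnit_symSquare {p p' : K × K} (h : wedge p p' ≠ 0) : IsUnit (symSquare p p') := by
  have hdet : (symSquare p p').det = wedge p p' ^ 3 := by
    rw [symSquare, det_fin_three, wedge]
    simp
    ring
  rw [isUnit_iff_isUnit_det, hdet]
  exact (pow_ne_zero 3 h).isUnit

lemma vecMul_symSquare (f : Fin 3 → K) (p p' : K × K) :
    f ᵥ* symSquare p p' = ![ev f p, pol f p p', ev f p'] := by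
  ext j
  fin_cases j
  · simp [symSquare, vecMul, dotProduct, Fin.sum_univ_three, ev]
  · simp [symSquare, vecMul, dotProduct, Fin.sum_univ_three, pol]; ring
  · simp [symSquare, vecMul, dotProduct, Fin.sum_univ_three, ev]

/-- The Baer subgeometry attached to a subfield `k` and a basis `p, p'` of `K²` has as lines the
lines whose binary forms are rational over `k` with respect to `p, p'`. -/
lemma mem_linesOf_iff_isRational {M : Matrix (Fin 3) (Fin 3) K} (k : Subfield K) {p p' : K × K}
    (hT : IsUnit (M * symSquare p p')) (l : Line K) :
    l ∈ linesOf (subgeometry k (columnBasis hT)) ↔ IsRational k p p' (lineForm M l) := by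
  have hl : lineForm (M * symSquare p p') l =
      ![ev (lineForm M l) p, pol (lineForm M l) p p', ev (lineForm M l) p'] := by
    rw [← vecMul_symSquare, lineForm, lineForm, vecMul_vecMul]
  rw [mem_linesOf_subgeometry, hl, IsRational]
  simp [Fin.forall_fin_succ]

end

end

end ConicPartition

theorem proposition3p7 {K : Type*} [Field K] [Finite K] (q : ℕ) (hq : Nat.card K = q)
    (hq4 : q ≡ 1 [MOD 4])
    (Q : QuadraticForm K (Fin 3 → K)) (hQ : (QuadraticMap.polarBilin Q).Nondegenerate)
    (L : Set (ConicPartition.Line K))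
    (hL : ConicPartition.IsLinePartition L
      (ConicPartition.internalPoints (ConicPartition.conic Q)))
    (hcard : L.ncard = q) :
    (∃ P ∈ ConicPartition.conic Q,
      L = {l | P ∈ l ∧ ¬ ConicPartition.IsTangent (ConicPartition.conic Q) l}) ∨
    (∃ B : Set (ConicPartition.Point K), ConicPartition.IsBaerSubgeometry B ∧
      L = {l | l ∈ ConicPartition.linesOf B ∧
        ¬ ConicPartition.IsTangent (ConicPartition.conic Q) l}) := by
  classical
  have := Fintype.ofFinite K
  have h4 : Fintype.card K % 4 = 1 := by
    rw [← Nat.card_eq_fintype_card, hq]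
    exact hq4
  have h2 := ConicPartition.two_ne_zero_of_card h4
  obtain ⟨M, c, hM, hc, hMQ⟩ := ConicPartition.exists_frame h2 (by omega) Q hQ
  have hq0 : L.ncard ≠ 0 := by
    rw [hcard, ← hq]
    exact Nat.card_pos.ne'
  have := (Set.finite_of_ncard_ne_zero hq0).fintype
  have hcL : Fintype.card L = Fintype.card K := by
    rw [← Nat.card_eq_fintype_card, ← Nat.card_eq_fintype_card, Nat.card_coe_set_eq, hcard, hq]
  have hp := ConicPartition.isInternalPartition_lineForm h2 hM hc hMQ hL
  have htan := ConicPartition.isTangent_iff h2 hM hc hMQ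
  have hd : ∀ l ∈ L, ConicPartition.fdisc (ConicPartition.lineForm M l) ≠ 0 := fun l hl =>
    ConicPartition.fdisc_ne_zero h4 hp ⟨l, hl⟩
  obtain ⟨v, hv⟩ | ⟨S, r, hS⟩ := ConicPartition.star_or_cliqueWithMatching h4 hp hcL
  · refine Or.inl ⟨ConicPartition.conicPoint hM v,
      (ConicPartition.mem_conic_iff hM hc hMQ _).2 ⟨v, rfl⟩, Set.ext fun l => ⟨fun hl => ?_, ?_⟩⟩
    · refine ⟨(ConicPartition.conicPoint_mem_line hM v l).2 ?_, fun ht => hd l hl ((htan l).1 ht)⟩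
      have h := Finset.mem_univ (⟨l, hl⟩ : L)
      rw [← hv, ConicPartition.mem_star] at h
      exact h
    · rintro ⟨hvl, ht⟩
      rw [htan] at ht
      have hvl' := (ConicPartition.conicPoint_mem_line hM v l).1 hvl
      obtain ⟨u, huv, hul⟩ := ConicPartition.exists_other_zero ht hvl'
      obtain ⟨-, i, hiv, hiu⟩ := ConicPartition.adj_of_star_eq_univ h4 hp hcL hv huv
      rw [ConicPartition.eq_of_common_conicPoints hM ht (hd i i.2) huv hul hvl' hiu hiv]
      exact i.2
  · obtain ⟨k, p, p', hw, hk, hrat⟩ := ConicPartition.exists_iff_isRational h4 hp hcL hS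
    have hT := hM.mul (ConicPartition.isUnit_symSquare hw)
    refine Or.inr ⟨_, ⟨k, ConicPartition.columnBasis hT, ?_, rfl⟩, Set.ext fun l => ?_⟩
    · rw [hk, Nat.card_eq_fintype_card]
    · rw [Set.mem_ofPred_eq, ConicPartition.mem_linesOf_iff_isRational, htan]
      constructor
      · exact fun hl => ⟨(hrat _ (hd l hl)).1
          ⟨⟨l, hl⟩, 1, one_ne_zero, (one_smul _ _).symm⟩, hd l hl⟩
      · rintro ⟨hr, hdl⟩
        obtain ⟨i, c, -, hi⟩ := (hrat _ hdl).2 hr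
        rw [ConicPartition.eq_of_lineForm_eq_smul hM hi]
        exact i.2
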